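/- Let $k$ be a field, let $Y$ be a complete, geometrically irreducible (integral) algebraic curve over $k$, let $P$ be a singular point of $Y$, let $\mathcal O=\widehat{\mathcal O}_{P,Y}$ be the completed local ring and $\widetilde{\mathcal O}$ its normalization (the integral closure in the total ring of fractions). *Notation.* Suppose that $\widetilde{\mathcal O}$ is identified with $k[[t_1]]\times\cdots\times k[[t_d]]$. Let $S(\mathcal O)\subseteq\mathbb N^d$ be the set of all $(\operatorname{ord} z_1,\dots,\operatorname{ord} z_d)$ with $z\in\mathcal O$ and all $z_i\neq 0$; let $c$ be the least element of $\mathbb N^d$ with $c+\mathbb N^d\subseteq S(\mathcal O)$; let $\delta=\dim_k\widetilde{\mathcal O}/\mathcal O$; for $n\in\mathbb N^d$ let $J_n(\mathcal O)=\{z\in\mathcal O: \operatorname{ord} z_i\ge n_i \text{ for all } i\}$, $l(n)=\dim_k\mathcal O/J_n(\mathcal O)$, $\|n\|=n_1+\dots+n_d$, and $T^n=T_1^{n_1}\cdots T_d^{n_d}$. Let $\mathcal J=\widetilde{\mathcal O}^{\times}/\mathcal O^{\times}$, as an algebraic group over $k$, and for $n\in S(\mathcal O)$ let $\mathcal I_n\subseteq\mathcal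 J$ be the algebraic subset of the classes of those $\mu$ with $t^n\mu\in\mathcal O$; it parametrizes the principal ideals $z\mathcal O$ with $(\operatorname{ord} z_i)_i=n$. Let $K_0(\mathrm{Var}_k)$ be the Grothendieck ring of varieties, $\mathbb L=[\mathbb A^1_k]$, $\mathcal M_k=K_0(\mathrm{Var}_k)[\mathbb L^{-1}]$, and $$Z(T_1,\dots,T_d,\mathcal O)=\sum_{n\in S(\mathcal O)}[\mathcal I_n]\,\mathbb L^{-\|n\|}\,T^n\in\mathcal M_k[[T_1,\dots,T_d]].$$ The field $k$ is *big enough for $Y$* if for every singular point of $Y$ the completed local ring is totally rational (all residue fields of its normalization are equal to $k$) and $\mathcal J\cong(\mathbb G_m)^{d-1}\times(\mathbb G_a)^{\delta-d+1}$ as algebraic groups. Let $S\subseteq\mathbb N^d$ be the semigroup $S(\mathcal O')$ of the completed local ring $\mathcal O'$ of a complete, geometrically irreducible complex algebraic curve at a singular point, and let $c,\delta,l$ be those of $\mathcal O'$. With $I_0=\{1,\dots,d\}$ and an indeterminate $U$ put $$\mathcal I_n(U)=(U-1)^{-1}U^{\|n\|+1}\sum_{I\subseteq I_0}(-1)^{\#I}\,U^{-l(n+\underline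 1_I)}\qquad(n\in S),$$ where $\underline 1_I$ is the indicator vector of $I$, and define the universal zeta function $$\mathcal Z(T_1,\dots,T_d,U,S)=\sum_{n\in S,\ n_i<c_i\,\forall i}\mathcal I_n(U)\,U^{-\|n\|}T^n+\sum_{\emptyset\subsetneq J\subsetneq I_0}\ \sum_{m\in B_J}\mathcal I_{f_J(m)}(U)\,U^{-\|f_J(m)\|}\frac{T^{f_J(m)}}{\prod_{i\in J}(1-U^{-1}T_i)}+(U-1)^{d-1}U^{\delta-d+1}U^{-\|c\|}\frac{T^{c}}{\prod_{i=1}^d(1-U^{-1}T_i)}.$$ Here $B_J$ is the set of all $m\in\prod_{i\notin J}\{0,\dots,c_i-1\}$ for which there is $n\in S$ with $n_i\ge c_i$ for $i\in J$ and $n_i=m_i$ for $i\notin J$, and $f_J(m)$ has the components $c_i$ for $i\in J$ and $m_i$ for $i\notin J$. **Statement.** Suppose that $k$ is big enough for $Y$ and that $S=S(\mathcal O)$. Then every $\mathcal I_n$, $n\in S$, is an algebraic variety over $k$, the coefficients of $\mathcal Z(T_1,\dots,T_d,U,S)$, expanded as a power series in $T_1,\dots,T_d$, lie in $\mathbb Z[U,U^{-1}]$,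 and $$Z(T_1,\dots,T_d,\mathcal O)=\mathcal Z(T_1,\dots,T_d,U,S)\big|_{U=[\mathbb A^1_k]}\quad\text{in }\mathcal M_k[[T_1,\dots,T_d]].$$ -/

import Mathlib

open CategoryTheory CategoryTheory.Limits AlgebraicGeometry
open scoped TensorProduct PowerSeries LaurentPolynomial

universe u

noncomputable section

/-! ### The Grothendieck ring of varieties -/

/-- An algebraic variety over `k`: a separated scheme of finite type over `k`. (Requiring the
schemes to be reduced would not change the Grothendieck ring, since the class of a scheme equals
the class of its reduction by the scissor relation.) -/
structure AlgVariety (k : Type u) [Field k] : Type (u + 1) where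
  toOver : Over (Spec (CommRingCat.of k))
  separated : IsSeparated toOver.hom
  locallyOfFiniteType : LocallyOfFiniteType toOver.hom
  quasiCompact : QuasiCompact toOver.hom

namespace AlgVariety

variable (k : Type u) [Field k]

/-- The one-point variety `Spec k`. -/
def point : AlgVariety k where
  toOver := Over.mk (𝟙 (Spec (CommRingCat.of k)))
  separated := by dsimp; infer_instance
  locallyOfFiniteType := by dsimp; infer_instance
  quasiCompact := by dsimp; infer_instance

variable {k}

/-- The product `V × W`, the fibre product over `Spec k`. -/
def prod (V W : AlgVariety k) : AlgVariety k where
  toOver := Over.mk (pullback.fst V.toOver.hom W.toOver.hom ≫ V.toOver.hom)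
  separated := by
    have := V.separated
    have := W.separated
    dsimp; infer_instance
  locallyOfFiniteType := by
    have := V.locallyOfFiniteType
    have := W.locallyOfFiniteType
    dsimp; infer_instance
  quasiCompact := by
    have := V.quasiCompact
    have := W.quasiCompact
    dsimp; infer_instance

variable (k)

/-- The affine variety `Spec R` of a `k`-algebra `R` of finite type. -/
def affine (R : Type u) [CommRing R] [Algebra k R] [h : Algebra.FiniteType k R] :
    AlgVariety k where
  toOver := Over.mk (Spec.map (CommRingCat.ofHom (algebraMap k R)))
  separated := by dsimp; infer_instance
  locallyOfFiniteType := by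
    have h' : (algebraMap k R).FiniteType := (RingHom.finiteType_algebraMap).2 h
    dsimp
    exact (HasRingHomProperty.Spec_iff (P := @LocallyOfFiniteType)).2 h'
  quasiCompact := by dsimp; infer_instance

end AlgVariety

/-- The defining relations between the symbols `[V]`. -/
inductive GrothendieckRel (k : Type u) [Field k] :
    MvPolynomial (AlgVariety k) ℤ → MvPolynomial (AlgVariety k) ℤ → Prop
  | iso (V W : AlgVariety k) (e : V.toOver ≅ W.toOver) :
      GrothendieckRel k (MvPolynomial.X V) (MvPolynomial.X W)
  | scissor (V Z U : AlgVariety k) (i : Z.toOver ⟶ V.toOver) (j : U.toOver ⟶ V.toOver)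
      (hi : IsClosedImmersion i.left) (hj : IsOpenImmersion j.left)
      (h : Set.range j.left = (Set.range i.left)ᶜ) :
      GrothendieckRel k (MvPolynomial.X V) (MvPolynomial.X U + MvPolynomial.X Z)
  | prod (V W : AlgVariety k) :
      GrothendieckRel k (MvPolynomial.X (V.prod W)) (MvPolynomial.X V * MvPolynomial.X W)
  | point : GrothendieckRel k (MvPolynomial.X (AlgVariety.point k)) 1

/-- The Grothendieck ring `K₀(Var_k)`. -/
abbrev GrothendieckRing (k : Type u) [Field k] : Type (u + 1) :=
  MvPolynomial (AlgVariety k) ℤ ⧸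
    Ideal.span {x | ∃ p q, GrothendieckRel k p q ∧ x = p - q}

/-- The class `[V]` of a variety in `K₀(Var_k)`. -/
def AlgVariety.grothendieckClass {k : Type u} [Field k] (V : AlgVariety k) :
    GrothendieckRing k :=
  Ideal.Quotient.mk _ (MvPolynomial.X V)

/-- The class `𝕃 = [𝔸¹]` in `K₀(Var_k)`. -/
def lefschetzClass (k : Type u) [Field k] : GrothendieckRing k :=
  (AlgVariety.affine k (Polynomial k)).grothendieckClass

/-- The ring `𝓜_k = K₀(Var_k)[𝕃⁻¹]`. -/
abbrev MotivicRing (k : Type u) [Field k] : Type (u + 1) :=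
  Localization.Away (lefschetzClass k)

/-- `𝕃` as a unit of `𝓜_k`. -/
def lefschetzUnit (k : Type u) [Field k] : (MotivicRing k)ˣ :=
  (IsLocalization.Away.algebraMap_isUnit (S := MotivicRing k) (lefschetzClass k)).unit

/-! ### Curves, completed local rings and their normalizations -/

/-- `Y` is a complete, geometrically irreducible algebraic curve over `k`
(an integral scheme, since it has a function field). -/
structure IsAlgebraicCurve {k : Type u} [Field k] (Y : Over (Spec (CommRingCat.of k))) :
    Prop where
  proper : IsProper Y.hom
  integral : IsIntegral Y.left
  geometricallyIrreducible : GeometricallyIrreducible Y.hom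
  dimension_one : topologicalKrullDim Y.left = 1

/-- The local ring `O_{P,Y}`. -/
def LocalRingAt {k : Type u} [Field k] (Y : Over (Spec (CommRingCat.of k))) (P : Y.left) :
    Type u :=
  Y.left.presheaf.stalk P

section

variable {k : Type u} [Field k] (Y : Over (Spec (CommRingCat.of k))) (P : Y.left)

instance : CommRing (LocalRingAt Y P) :=
  inferInstanceAs (CommRing (Y.left.presheaf.stalk P))

instance : IsLocalRing (LocalRingAt Y P) :=
  inferInstanceAs (IsLocalRing (Y.left.presheaf.stalk P))

/-- The `k`-algebra structure on `O_{P,Y}` given by the structure morphism of `Y`. -/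
instance : Algebra k (LocalRingAt Y P) :=
  RingHom.toAlgebra
    ((Y.left.presheaf.germ ⊤ P trivial).hom.comp
      ((Y.hom.appTop).hom.comp (Scheme.ΓSpecIso (CommRingCat.of k)).inv.hom))

/-- `P` is a singular point of `Y`. -/
def IsSingularPoint : Prop := ¬ IsRegularLocalRing (LocalRingAt Y P)

/-- The completion of `O_{P,Y}` with respect to its maximal ideal. -/
def CompletedLocalRing : Type u :=
  AdicCompletion (IsLocalRing.maximalIdeal (LocalRingAt Y P)) (LocalRingAt Y P)

instance : CommRing (CompletedLocalRing Y P) :=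
  inferInstanceAs (CommRing
    (AdicCompletion (IsLocalRing.maximalIdeal (LocalRingAt Y P)) (LocalRingAt Y P)))

instance : Algebra k (CompletedLocalRing Y P) :=
  inferInstanceAs (Algebra k
    (AdicCompletion (IsLocalRing.maximalIdeal (LocalRingAt Y P)) (LocalRingAt Y P)))

end

/-- The normalization of a ring: its integral closure in its total ring of fractions. For the
completed local ring of a curve this is the product of the complete discrete valuation rings
attached to the points of the normalization of the curve above the given point. -/
abbrev NormalizationRing (O : Type u) [CommRing O] : Subalgebra O (FractionRing O) :=
  integralClosure O (FractionRing O)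

/-- `O` is totally rational: all residue fields of its normalization are equal to `k`. -/
def IsTotallyRational (k : Type u) [Field k] (O : Type u) [CommRing O] [Algebra k O] : Prop :=
  ∀ M : Ideal (NormalizationRing O), M.IsMaximal →
    Function.Bijective (algebraMap k (NormalizationRing O ⧸ M))

/-- An identification of the normalization of `O` with `k⟦t₁⟧ × ⋯ × k⟦t_d⟧`, that is, a numbering
of the branches and a choice of a uniformizing parameter on each of them. -/
abbrev BranchCoordinates (k : Type u) [Field k] (O : Type u) [CommRing O] [Algebra k O]
    (d : ℕ) : Type u :=
  NormalizationRing O ≃ₐ[k] (Fin d → k⟦X⟧)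

/-- The ring `O`, viewed as a subring of `k⟦t₁⟧ × ⋯ × k⟦t_d⟧`. -/
def branchImage {k : Type u} [Field k] {O : Type u} [CommRing O] [Algebra k O] {d : ℕ}
    (e : BranchCoordinates k O d) : Subalgebra k (Fin d → k⟦X⟧) :=
  (e.toAlgHom.comp (IsScalarTower.toAlgHom k O (NormalizationRing O))).range

/-! ### Semigroup of values, conductor, singularity degree -/

section Values

variable {k : Type u} [Field k] {d : ℕ} (O : Subalgebra k (Fin d → k⟦X⟧))

/-- The semigroup of values `S(O)`, consisting of the vectors of orders of the elements of `O`
all of whose components are non-zero. -/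
def valueSemigroup : Set (Fin d → ℕ) :=
  {n | ∃ z ∈ O, ∀ i, (z i).order = n i}

/-- The conductor of a semigroup `S`: the least `c` with `c + ℕ^d ⊆ S` (the infimum is taken
coordinatewise). -/
def semigroupConductor (S : Set (Fin d → ℕ)) : Fin d → ℕ :=
  sInf {c | ∀ n, c ≤ n → n ∈ S}

/-- The singularity degree `δ = dim_k Õ / O`. -/
def singularityDegree : ℕ :=
  Module.finrank k ((Fin d → k⟦X⟧) ⧸ Subalgebra.toSubmodule O)

/-- The ideal `J_n(O) = {z ∈ O | v(z) ≥ n}`. -/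
def valuationIdeal (n : Fin d → ℕ) : Ideal O where
  carrier := {z | ∀ i, (n i : ℕ∞) ≤ ((z : Fin d → k⟦X⟧) i).order}
  add_mem' {a b} ha hb i := by
    simpa using (le_min (ha i) (hb i)).trans (PowerSeries.min_order_le_order_add _ _)
  zero_mem' i := by simp
  smul_mem' a b hb i := by
    simpa using (hb i).trans (by rw [PowerSeries.order_mul]; exact le_add_self)

/-- `l(n) = dim_k O / J_n(O)`. -/
def valuationColength (n : Fin d → ℕ) : ℕ :=
  Module.finrank k (O ⧸ valuationIdeal O n)

/-- `t^n = (t₁^{n₁}, …, t_d^{n_d})`. -/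
def tPow (k : Type u) [Field k] {d : ℕ} (n : Fin d → ℕ) : Fin d → k⟦X⟧ :=
  fun i => PowerSeries.X ^ n i

end Values

/-! ### The algebraic group `𝒥 = Õˣ / Oˣ` and the varieties of principal ideals -/

section Jacobian

variable {k : Type u} [Field k] {d : ℕ} (O : Subalgebra k (Fin d → k⟦X⟧))

/-- The conductor ideal `𝓕 = t^c Õ` of `Õ`. -/
def conductorIdeal : Ideal (Fin d → k⟦X⟧) :=
  Ideal.span {tPow k (semigroupConductor (valueSemigroup O))}

/-- The finite-dimensional algebra `Õ / 𝓕`. -/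
abbrev TruncatedNormalization : Type u := (Fin d → k⟦X⟧) ⧸ conductorIdeal O

/-- The subalgebra `O / 𝓕` of `Õ / 𝓕`. -/
def truncatedRing : Subalgebra k (TruncatedNormalization O) :=
  O.map (Ideal.Quotient.mkₐ k (conductorIdeal O))

variable (A : Type u) [CommRing A] [Algebra k A]

/-- The inclusion `A ⊗ O/𝓕 → A ⊗ Õ/𝓕`, for a `k`-algebra `A`. -/
def truncatedInclusion : A ⊗[k] truncatedRing O →ₐ[k] A ⊗[k] TruncatedNormalization O :=
  Algebra.TensorProduct.map (AlgHom.id k A) (truncatedRing O).val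

/-- The `A`-valued points of the algebraic group `Oˣ / (1 + 𝓕)`, inside those of
`Õˣ / (1 + 𝓕)`. -/
def truncatedUnits : Subgroup (A ⊗[k] TruncatedNormalization O)ˣ :=
  (Units.map (truncatedInclusion O A).toRingHom.toMonoidHom).range

instance : (truncatedUnits O A).Normal :=
  ⟨fun n hn g => by
    have h : g * n * g⁻¹ = n := by
      ext
      simp [mul_comm (g : A ⊗[k] TruncatedNormalization O), mul_assoc]
    rwa [h]⟩

/-- The algebraic group `𝒥 = Õˣ / Oˣ = (Õˣ / (1 + 𝓕)) / (Oˣ / (1 + 𝓕))`, given by its functor of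
points: this is the group of its `A`-valued points. (The quotient map of algebraic groups
`Õˣ / (1 + 𝓕) → 𝒥` has a section by polynomial representatives, so it is surjective
on `A`-valued points for every `A`, and no sheafification is needed.) -/
abbrev JacobianPoints : Type u :=
  (A ⊗[k] TruncatedNormalization O)ˣ ⧸ truncatedUnits O A

variable {A} {B : Type u} [CommRing B] [Algebra k B]

/-- Base change of units along `f : A → B`. -/
def unitsBaseChange (f : A →ₐ[k] B) :
    (A ⊗[k] TruncatedNormalization O)ˣ →* (B ⊗[k] TruncatedNormalization O)ˣ :=
  Units.map
    (Algebra.TensorProduct.map f (AlgHom.id k (TruncatedNormalization O))).toRingHom.toMonoidHom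

lemma truncatedUnits_le_comap (f : A →ₐ[k] B) :
    truncatedUnits O A ≤ (truncatedUnits O B).comap (unitsBaseChange O f) := by
  rintro _ ⟨u, rfl⟩
  refine ⟨Units.map
    (Algebra.TensorProduct.map f (AlgHom.id k (truncatedRing O))).toRingHom.toMonoidHom u, ?_⟩
  ext
  have h : (truncatedInclusion O B).comp
        (Algebra.TensorProduct.map f (AlgHom.id k (truncatedRing O))) =
      (Algebra.TensorProduct.map f (AlgHom.id k (TruncatedNormalization O))).comp
        (truncatedInclusion O A) := by
    apply Algebra.TensorProduct.ext'
    intros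
    simp [truncatedInclusion]
  exact DFunLike.congr_fun h (u : A ⊗[k] truncatedRing O)

/-- The functoriality of `𝒥(A)` in `A`. -/
def jacobianMap (f : A →ₐ[k] B) : JacobianPoints O A →* JacobianPoints O B :=
  QuotientGroup.map _ _ (unitsBaseChange O f) (truncatedUnits_le_comap O f)

/-- `𝒥 ≅ (G_m)^{d-1} × (G_a)^{δ-d+1}` as algebraic groups, i.e. there is an isomorphism of group
valued functors on the category of commutative `k`-algebras. -/
def JacobianSplits : Prop :=
  ∃ e : ∀ (A : Type u) [CommRing A] [Algebra k A], JacobianPoints O A ≃*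
      (Fin (d - 1) → Aˣ) × Multiplicative (Fin (singularityDegree O + 1 - d) → A),
    ∀ (A B : Type u) [CommRing A] [Algebra k A] [CommRing B] [Algebra k B] (f : A →ₐ[k] B)
      (x : JacobianPoints O A),
      e B (jacobianMap O f x) =
        (fun i => Units.map f.toRingHom.toMonoidHom ((e A x).1 i),
          Multiplicative.ofAdd fun i => f (Multiplicative.toAdd (e A x).2 i))

/-- The algebraic subset `𝓘_n` of `𝒥`, consisting of the classes of those `μ` for which
`t^n μ ∈ O`, given by its functor of points. The class of `μ` corresponds to the
principal ideal `t^n μ O` of `O`, whose generators have value `n`. -/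
def principalIdealLocus (n : Fin d → ℕ) (A : Type u) [CommRing A] [Algebra k A] :
    Set (JacobianPoints O A) :=
  {x | ∃ μ : (A ⊗[k] TruncatedNormalization O)ˣ, (QuotientGroup.mk μ : JacobianPoints O A) = x ∧
    (1 ⊗ₜ[k] Ideal.Quotient.mk (conductorIdeal O) (tPow k n)) *
        (μ : A ⊗[k] TruncatedNormalization O) ∈
      (truncatedInclusion O A).range}

/-- `R` is the coordinate ring of `𝓘_n`, with universal point `ξ`: that is, `Spec R` represents
the functor of points of `𝓘_n`. -/
def IsCoordinateRing (n : Fin d → ℕ) (R : Type u) [CommRing R] [Algebra k R]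
    (ξ : JacobianPoints O R) : Prop :=
  ξ ∈ principalIdealLocus O n R ∧
    ∀ (A : Type u) [CommRing A] [Algebra k A], ∀ x ∈ principalIdealLocus O n A,
      ∃! f : R →ₐ[k] A, jacobianMap O f ξ = x

/-- `𝓘_n` is an affine algebraic variety over `k`. -/
def LocusIsVariety (n : Fin d → ℕ) : Prop :=
  ∃ R : CommAlgCat.{u} k, Algebra.FiniteType k R ∧ ∃ ξ, IsCoordinateRing O n R ξ

open Classical in
/-- The class `[𝓘_n]` of the variety `𝓘_n` in `K₀(Var_k)`. -/
def principalIdealClass (n : Fin d → ℕ) : GrothendieckRing k :=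
  if h : LocusIsVariety O n then
    haveI := h.choose_spec.1
    (AlgVariety.affine k h.choose).grothendieckClass
  else 0

end Jacobian

/-! ### The two zeta functions -/

/-- `‖n‖ = n₁ + ⋯ + n_d`. -/
def vecNorm {d : ℕ} (n : Fin d → ℕ) : ℕ := ∑ i, n i

open Classical in
/-- The zeta function `Z(T₁, …, T_d, O) = ∑_{n ∈ S} [𝓘_n] 𝕃^{-‖n‖} T^n ∈ 𝓜_k⟦T₁, …, T_d⟧`. -/
def motivicZeta {k : Type u} [Field k] {d : ℕ} (O : Subalgebra k (Fin d → k⟦X⟧)) :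
    MvPowerSeries (Fin d) (MotivicRing k) :=
  fun n =>
    if (n : Fin d → ℕ) ∈ valueSemigroup O then
      algebraMap (GrothendieckRing k) (MotivicRing k) (principalIdealClass O n) *
        ((lefschetzUnit k ^ (-(vecNorm (n : Fin d → ℕ) : ℤ)) : (MotivicRing k)ˣ) :
          MotivicRing k)
    else 0

section Universal

variable {d : ℕ} (O : Subalgebra ℂ (Fin d → ℂ⟦X⟧))

/-- The indeterminate `U`, in the field `ℚ(U)`. -/
abbrev indetU : RatFunc ℚ := RatFunc.X

/-- `𝓘_n(U) = (U - 1)⁻¹ U^{‖n‖ + 1} ∑_{I ⊆ I₀} (-1)^{#I} U^{-l(n + 1_I)}`. -/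
def universalClass (n : Fin d → ℕ) : RatFunc ℚ :=
  (indetU - 1)⁻¹ * indetU ^ (vecNorm n + 1) *
    ∑ I : Finset (Fin d), (-1) ^ I.card *
      indetU ^ (-(valuationColength O (n + fun i => if i ∈ I then 1 else 0) : ℤ))

/-- The monomial `a T^n`. -/
def zetaMonomial (n : Fin d → ℕ) (a : RatFunc ℚ) : MvPowerSeries (Fin d) (RatFunc ℚ) :=
  MvPowerSeries.monomial (Finsupp.equivFunOnFinite.symm n) a

/-- `∏_{i ∈ J} (1 - U⁻¹ T_i)⁻¹`. -/
def geometricFactor (J : Finset (Fin d)) : MvPowerSeries (Fin d) (RatFunc ℚ) :=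
  ∏ i ∈ J, (1 - MvPowerSeries.C indetU⁻¹ * MvPowerSeries.X i)⁻¹

/-- `f_J(m)`: the vector with components `c_i` for `i ∈ J` and `m_i` for `i ∉ J`. -/
def boundaryVector (c : Fin d → ℕ) (J : Finset (Fin d)) (m : Fin d → ℕ) : Fin d → ℕ :=
  fun i => if i ∈ J then c i else m i

open Classical in
/-- The index set `B_J`, of those `m` with `m_i < c_i` for `i ∉ J` for which there is `n ∈ S` with
`n_i ≥ c_i` for `i ∈ J` and `n_i = m_i` for `i ∉ J`. Only the components of `m` outside of
`J` matter; the other ones are set to `0`. -/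
def boundaryIndices (S : Set (Fin d → ℕ)) (J : Finset (Fin d)) : Finset (Fin d → ℕ) :=
  (Fintype.piFinset fun i =>
      if i ∈ J then {0} else Finset.range (semigroupConductor S i)).filter
    fun m => ∃ n ∈ S, (∀ i ∈ J, semigroupConductor S i ≤ n i) ∧ ∀ i ∉ J, n i = m i

open Classical in
/-- The universal zeta function `𝒵(T₁, …, T_d, U, S)` of the semigroup `S = S(O)` of a complex
curve singularity `O`, expanded as a power series in `T₁, …, T_d` over `ℚ(U)`. -/
def universalZeta : MvPowerSeries (Fin d) (RatFunc ℚ) :=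
  let S := valueSemigroup O
  let c := semigroupConductor S
  (∑ n ∈ (Fintype.piFinset fun i => Finset.range (c i)).filter (fun n => n ∈ S),
      zetaMonomial n (universalClass O n * indetU ^ (-(vecNorm n : ℤ)))) +
  (∑ J ∈ Finset.univ.filter (fun J : Finset (Fin d) => J ≠ ∅ ∧ J ≠ Finset.univ),
    ∑ m ∈ boundaryIndices S J,
      zetaMonomial (boundaryVector c J m)
          (universalClass O (boundaryVector c J m) *
            indetU ^ (-(vecNorm (boundaryVector c J m) : ℤ))) *
        geometricFactor J) +
  zetaMonomial c ((indetU - 1) ^ ((d : ℤ) - 1) *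
        indetU ^ ((singularityDegree O : ℤ) - d + 1) * indetU ^ (-(vecNorm c : ℤ))) *
    geometricFactor Finset.univ

end Universal

/-- The ring homomorphism `ℤ[U, U⁻¹] → R` that substitutes the unit `u` for `U`. -/
def substituteU {R : Type*} [CommRing R] (u : Rˣ) : ℤ[T;T⁻¹] →+* R :=
  LaurentPolynomial.eval₂ (Int.castRingHom R) u

/-- The power series `W` over `R` is obtained from the power series `Z` over `ℚ(U)` by
substituting the unit `u` for `U`: the coefficients of `Z` lie in the subring `ℤ[U, U⁻¹]` of
`ℚ(U)`, and `W` is the image of `Z` under the homomorphism `ℤ[U, U⁻¹] → R` with `U ↦ u`. -/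
def IsSubstitution {R : Type*} [CommRing R] {d : ℕ} (Z : MvPowerSeries (Fin d) (RatFunc ℚ))
    (u : Rˣ) (W : MvPowerSeries (Fin d) R) : Prop :=
  ∃ Φ : MvPowerSeries (Fin d) ℤ[T;T⁻¹],
    MvPowerSeries.map (substituteU (Units.mk0 indetU RatFunc.X_ne_zero)) Φ = Z ∧
      MvPowerSeries.map (substituteU u) Φ = W

/-- `k` is big enough for the curve `Y`: for every singular point `P` of `Y`, the completed local
ring at `P` is totally rational, and its group `𝒥` is isomorphic to
`(G_m)^{d-1} × (G_a)^{δ-d+1}`. (Up to isomorphism of algebraic groups, `𝒥` does not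
depend on the choice of coordinates on the branches.) -/
def IsBigEnough {k : Type u} [Field k] (Y : Over (Spec (CommRingCat.of k))) : Prop :=
  ∀ P : Y.left, IsSingularPoint Y P →
    IsTotallyRational k (CompletedLocalRing Y P) ∧
      ∃ (d : ℕ) (e : BranchCoordinates k (CompletedLocalRing Y P) d),
        JacobianSplits (branchImage e)

end

noncomputable section

/-! ### Power series -/

/-! The coefficient of `T^n` in the universal zeta function is `𝓘_n(U) U^{-‖n‖}` for every `n ∈ S`
and zero otherwise (`coeff_universalZeta`): beyond the conductor `𝓘_n(U)` no longer changes, and the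
geometric series collect these constant stretches. The colengths `l(n)` are determined by the
semigroup (`valuationColength_congr`), so they agree for `O` and the complex singularity. It remains
to show that the class of `𝓘_n` is `𝓘_n(𝕃)`.

For this, `𝓘_n` is realized as the complement of a hyperplane arrangement. A basis of `O/𝓕` in row
echelon form singles out pivot coordinates on `Õ/𝓕`. Over every `k`-algebra, each class in `Õˣ/Oˣ`
has exactly one representative `μ` whose first pivot coordinate is `1` and whose other pivot
coordinates vanish (`exists_isSlice`, `IsSlice.exists_mk_eq`, `IsSlice.eq_of_mk_eq`). On this slice
`t^n μ ∈ O` is a system of linear equations, and `μ` is a unit iff its values `ℓ_i(μ)` at the closed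
points of the branches are units. Thus `𝓘_n` is an affine space minus the hyperplanes `ℓ_i = 0`
(`IsSlice.exists_isCoordinateRing`), and inclusion-exclusion expresses its class through the flats
(`exists_isArrangementRing`).

The flat of `I` is empty or an affine space of dimension `‖n‖ - l(n + 1_I)`
(`IsSlice.finrank_flat`). The normalization to `1` concerns the value `ℓ_{i₀}` on one branch `i₀`,
and the flat is empty precisely when `l(n + 1_I)` does not change on adding `i₀` to `I`
(`IsSlice.mem_flat_iff`). This gives `locusPolynomial`, a Laurent polynomial that avoids dividing by
`𝕃 - 1`. Pairing `I` with `I ∪ {i₀}` in the definition of `𝓘_n(U)` yields the same polynomial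
(`substituteU_locusPolynomial_eq_universalClass`).

All this needs only that `O` has equal constant terms on all branches and contains some `t^c Õ`. The
second property follows from the completeness of `O` by a form of Nakayama's lemma
(`exists_conductor_branchImage`). -/

lemma PowerSeries.natCast_le_order_iff {R : Type*} [Semiring R] (n : ℕ) (φ : R⟦X⟧) :
    (n : ℕ∞) ≤ φ.order ↔ ∀ m < n, PowerSeries.coeff m φ = 0 :=
  ⟨fun h m hm => PowerSeries.coeff_of_lt_order m (lt_of_lt_of_le (by exact_mod_cast hm) h),
    fun h => PowerSeries.nat_le_order φ n h⟩

lemma PowerSeries.dvd_of_order_le {k : Type*} [Field k] {a b : k⟦X⟧} (ha : a ≠ 0)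
    (h : a.order ≤ b.order) : a ∣ b := by
  obtain ⟨n, hn⟩ : ∃ n : ℕ, a.order = n :=
    ⟨_, (ENat.natCast_toNat (PowerSeries.order_eq_top.not.2 ha)).symm⟩
  have hb : PowerSeries.X ^ n ∣ b :=
    PowerSeries.X_pow_dvd_iff.2 ((PowerSeries.natCast_le_order_iff n b).1 (hn ▸ h))
  obtain ⟨w, hw⟩ : PowerSeries.X ^ n ∣ a :=
    PowerSeries.X_pow_dvd_iff.2 ((PowerSeries.natCast_le_order_iff n a).1 hn.ge)
  have hw' : IsUnit w := by
    rw [PowerSeries.isUnit_iff_constantCoeff, isUnit_iff_ne_zero]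
    have := (PowerSeries.order_eq_nat.1 hn).1
    rw [hw, PowerSeries.coeff_X_pow_mul', if_pos le_rfl, Nat.sub_self] at this
    simpa using this
  rw [hw]
  exact (hw'.mul_right_dvd).2 hb

/-! ### Finite free modules over complete rings -/

lemma IsPrecomplete.pi_fintype {R : Type*} [CommRing R] (I : Ideal R) [IsPrecomplete I R]
    (ι : Type*) [Finite ι] : IsPrecomplete I (ι → R) := by
  classical
  have := Fintype.ofFinite ι
  refine ⟨fun f hf => ?_⟩
  have hproj : ∀ (n : ℕ) (i : ι) (x : ι → R), x ∈ (I ^ n • ⊤ : Submodule R (ι → R)) →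
      x i ∈ (I ^ n • ⊤ : Submodule R R) := by
    intro n i x hx
    have := Submodule.mem_map_of_mem (f := LinearMap.proj (R := R) (φ := fun _ : ι => R) i) hx
    rw [Submodule.map_smul''] at this
    exact Submodule.smul_mono le_rfl le_top this
  have h1 : ∀ i, ∃ L : R, ∀ n, f n i ≡ L [SMOD (I ^ n • ⊤ : Submodule R R)] := fun i =>
    IsPrecomplete.prec' (I := I) (fun n => f n i) fun {m n} hmn => by
      have := hf hmn
      rw [SModEq.sub_mem] at this ⊢
      exact hproj m i _ this
  choose L hL using h1
  refine ⟨L, fun n => ?_⟩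
  rw [SModEq.sub_mem, pi_eq_sum_univ' (f n - L)]
  refine Submodule.sum_mem _ fun i _ => Submodule.smul_mem_smul ?_ trivial
  have := hL i n
  rw [SModEq.sub_mem] at this
  simpa using this

/-! ### Complete local rings with normalization a product of power series rings -/

section Normalization

variable {k : Type u} [Field k] {O : Type u} [CommRing O] [Algebra k O] {d : ℕ}
  (e : BranchCoordinates k O d)

/-- The embedding of `O` into `k⟦t₁⟧ × ⋯ × k⟦t_d⟧`. -/
def branchHom : O →ₐ[k] (Fin d → k⟦X⟧) :=
  e.toAlgHom.comp (IsScalarTower.toAlgHom k O (NormalizationRing O))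

lemma branchHom_apply (x : O) : branchHom e x = e (algebraMap O (NormalizationRing O) x) := rfl

lemma mem_branchImage {z : Fin d → k⟦X⟧} : z ∈ branchImage e ↔ ∃ x, branchHom e x = z :=
  Iff.rfl

lemma branch_count_pos [Nontrivial O] (e : BranchCoordinates k O d) : 0 < d := by
  rcases Nat.eq_zero_or_pos d with rfl | h
  · exact absurd (e.symm.toEquiv.subsingleton_congr.1 inferInstance)
      (not_subsingleton (NormalizationRing O))
  · exact h

lemma branchHom_isIntegral : (branchHom e).toRingHom.IsIntegral := by
  intro z
  have h : IsIntegral O (e.symm z) := Algebra.IsIntegral.isIntegral _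
  obtain ⟨p, hp, h0⟩ := h
  refine ⟨p, hp, ?_⟩
  have h1 := Polynomial.hom_eval₂ p (algebraMap O (NormalizationRing O))
    e.toRingEquiv.toRingHom (e.symm z)
  rw [h0, map_zero] at h1
  rw [h1]
  conv_lhs => rw [← e.apply_symm_apply z]
  rfl

/-- Evaluation at the closed point of the `i`-th branch. -/
def branchEval (k : Type u) [Field k] {d : ℕ} (i : Fin d) : (Fin d → k⟦X⟧) →+* k :=
  PowerSeries.constantCoeff.comp (Pi.evalRingHom (fun _ => k⟦X⟧) i)

/-- Maximal ideals contract to maximal ideals along an integral homomorphism, and `O` has only one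
maximal ideal. -/
lemma ker_branchEval_comap [IsLocalRing O] (i : Fin d) :
    (RingHom.ker (branchEval k i)).comap (branchHom e).toRingHom = IsLocalRing.maximalIdeal O := by
  have hmax : (RingHom.ker (branchEval k i)).IsMaximal :=
    RingHom.ker_isMaximal_of_surjective _ fun a => ⟨fun _ => PowerSeries.C a, by simp [branchEval]⟩
  exact IsLocalRing.eq_maximalIdeal
    (Ideal.isMaximal_comap_of_isIntegral_of_isMaximal' _ (branchHom_isIntegral e) _)

lemma constantCoeff_branchHom [IsLocalRing O] {x : O} (hx : x ∈ IsLocalRing.maximalIdeal O)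
    (i : Fin d) : PowerSeries.constantCoeff (branchHom e x i) = 0 := by
  rw [← ker_branchEval_comap e i] at hx
  exact hx

/-- After subtracting its constant term on branch `i`, an element lies in the maximal ideal of `O`,
hence vanishes at the closed point of every other branch as well. -/
lemma constantCoeff_eq_of_mem_branchImage [IsLocalRing O] {z : Fin d → k⟦X⟧}
    (hz : z ∈ branchImage e) (i j : Fin d) :
    PowerSeries.constantCoeff (z i) = PowerSeries.constantCoeff (z j) := by
  obtain ⟨x, rfl⟩ := (mem_branchImage e).1 hz
  set a := PowerSeries.constantCoeff (branchHom e x i) with ha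
  have hx : x - algebraMap k O a ∈ IsLocalRing.maximalIdeal O := by
    rw [← ker_branchEval_comap e i]
    change branchEval k i (branchHom e (x - algebraMap k O a)) = 0
    simp [branchEval, ha, Algebra.algebraMap_eq_smul_one]
  have := constantCoeff_branchHom e hx j
  rw [map_sub, AlgHom.commutes] at this
  simp [Algebra.algebraMap_eq_smul_one] at this
  exact (sub_eq_zero.1 this).symm

/-- If the `i`-th component vanished, the idempotent of branch `i` would be annihilated by `x`,
which is a unit in the total ring of fractions. -/
lemma branchHom_ne_zero {x : O} (hx : x ∈ nonZeroDivisors O) (i : Fin d) :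
    branchHom e x i ≠ 0 := by
  classical
  intro h
  have h1 : branchHom e x * Pi.single i 1 = 0 := by
    ext1 j
    by_cases hj : j = i
    · subst hj; simp [h]
    · simp [hj]
  have h2 : algebraMap O (NormalizationRing O) x * e.symm (Pi.single i 1) = 0 := by
    apply e.injective
    rw [map_mul, AlgEquiv.apply_symm_apply, map_zero, ← branchHom_apply, h1]
  have h3 := congrArg (Subtype.val) h2
  have hu : IsUnit (algebraMap O (FractionRing O) x) :=
    IsLocalization.map_units (FractionRing O) (⟨x, hx⟩ : nonZeroDivisors O)
  have h4 : algebraMap O (FractionRing O) x * (e.symm (Pi.single i 1) : FractionRing O) = 0 := h3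
  rw [hu.mul_right_eq_zero] at h4
  have h5 : e.symm (Pi.single i (1 : k⟦X⟧)) = 0 := Subtype.ext h4
  rw [map_eq_zero_iff _ e.symm.injective] at h5
  simpa using congrFun h5 i

lemma branchImage_eq_top_of_forall_isUnit (h : ∀ x ∈ nonZeroDivisors O, IsUnit x) :
    branchImage e = ⊤ := by
  rw [eq_top_iff]
  rintro z -
  obtain ⟨x, hx⟩ := (IsLocalization.atUnits O (nonZeroDivisors O) (S := FractionRing O)
    (fun x hx => h x hx)).surjective (e.symm z : FractionRing O)
  refine (mem_branchImage e).2 ⟨x, ?_⟩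
  rw [branchHom_apply, ← e.apply_symm_apply z]
  congr 1
  exact Subtype.ext hx

/-- The monomial `t_i^a`, extended by zero to the other branches. -/
def branchMonomial (k : Type u) [Field k] {d : ℕ} (i : Fin d) (a : ℕ) : Fin d → k⟦X⟧ :=
  Pi.single i (PowerSeries.X ^ a)

lemma coeff_branchMonomial (i : Fin d) (a : ℕ) (j : Fin d) (b : ℕ) :
    PowerSeries.coeff b (branchMonomial k i a j) = if j = i ∧ b = a then 1 else 0 := by
  classical
  by_cases hj : j = i
  · subst hj; simp [branchMonomial, PowerSeries.coeff_X_pow]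
  · simp [branchMonomial, hj]

/-- The truncation of `z` in orders below `a`, as a combination of monomials. -/
def branchTrunc (a : Fin d → ℕ) (z : Fin d → k⟦X⟧) : Fin d → k⟦X⟧ :=
  ∑ p : Σ i, Fin (a i), PowerSeries.coeff p.2 (z p.1) • branchMonomial k p.1 p.2

lemma coeff_branchTrunc (a : Fin d → ℕ) (z : Fin d → k⟦X⟧) (i : Fin d) (b : ℕ) (hb : b < a i) :
    PowerSeries.coeff b (branchTrunc a z i) = PowerSeries.coeff b (z i) := by
  classical
  rw [branchTrunc, Finset.sum_apply, map_sum, Finset.sum_eq_single ⟨i, ⟨b, hb⟩⟩]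
  · simp [coeff_branchMonomial]
  · rintro ⟨j, c⟩ - hne
    rw [Pi.smul_apply, map_smul, coeff_branchMonomial, if_neg, smul_zero]
    rintro ⟨rfl, rfl⟩
    exact hne rfl
  · simp

/-- The conductor of `O` in its normalization is not contained in any branch. -/
theorem exists_conductor_branchImage [IsLocalRing O]
    [IsAdicComplete (IsLocalRing.maximalIdeal O) O] :
    ∃ c : Fin d → ℕ, ∀ z : Fin d → k⟦X⟧, (∀ i, (c i : ℕ∞) ≤ (z i).order) → z ∈ branchImage e := by
  classical
  -- If every non-zero-divisor is a unit, `O` is its own total ring of fractions, and the conductor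
  -- can be taken to be `0`. Otherwise some non-zero-divisor `x` lies in the maximal ideal, and
  -- `Õ/xÕ` is spanned over `k` by finitely many monomials.
  by_cases hunit : ∀ x ∈ nonZeroDivisors O, IsUnit x
  · exact ⟨0, fun z _ => by rw [branchImage_eq_top_of_forall_isUnit e hunit]; trivial⟩
  push Not at hunit
  obtain ⟨x, hx, hxu⟩ := hunit
  let _ : Algebra O (Fin d → k⟦X⟧) := (branchHom e).toRingHom.toAlgebra
  have hsmul : ∀ (a : O) (z : Fin d → k⟦X⟧), a • z = branchHom e a * z := fun _ _ => rfl
  set m := IsLocalRing.maximalIdeal O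
  have hxm : x ∈ m := hxu
  have hne : ∀ i, branchHom e x i ≠ 0 := branchHom_ne_zero e hx
  choose a ha using fun i => show ∃ n : ℕ, (branchHom e x i).order = n from
    ⟨_, (ENat.natCast_toNat (PowerSeries.order_eq_top.not.2 (hne i))).symm⟩
  -- Elements of `m` have zero constant term on each branch, so `m^n Õ` lies in `t^n Õ`. Hence `Õ`
  -- is `m`-adically separated.
  have hmX : ∀ (n : ℕ) (z : Fin d → k⟦X⟧), z ∈ (m ^ n • ⊤ : Submodule O (Fin d → k⟦X⟧)) →
      ∀ i, PowerSeries.X ^ n ∣ z i := by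
    intro n z hz i
    rw [Ideal.smul_top_eq_map, Submodule.restrictScalars_mem, Ideal.map_pow] at hz
    have h1 := Ideal.mem_map_of_mem (Pi.evalRingHom (fun _ => k⟦X⟧) i) hz
    rw [Ideal.map_pow, Ideal.map_map] at h1
    have h2 : m.map ((Pi.evalRingHom (fun _ => k⟦X⟧) i).comp (algebraMap O (Fin d → k⟦X⟧))) ≤
        Ideal.span {PowerSeries.X} := by
      rw [Ideal.map_le_iff_le_comap]
      intro y hy
      rw [Ideal.mem_comap, Ideal.mem_span_singleton, PowerSeries.X_dvd_iff]
      exact constantCoeff_branchHom e hy i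
    have h3 := Ideal.pow_right_mono h2 n h1
    rw [Ideal.span_singleton_pow, Ideal.mem_span_singleton] at h3
    exact h3
  have : IsHausdorff m (Fin d → k⟦X⟧) := by
    refine ⟨fun z hz => ?_⟩
    ext i b
    have h1 := hz (b + 1)
    rw [SModEq.sub_mem, sub_zero] at h1
    simpa using PowerSeries.X_pow_dvd_iff.1 (hmX _ _ h1 i) b (Nat.lt_succ_self b)
  have := IsPrecomplete.pi_fintype m (Σ i, Fin (a i))
  let f : ((Σ i, Fin (a i)) → O) →ₗ[O] (Fin d → k⟦X⟧) :=
    Fintype.linearCombination O (fun p => branchMonomial k p.1 p.2)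
  -- Nakayama's lemma for a complete source and a separated target: the monomials of order below
  -- `ord x` generate `Õ` modulo `xÕ ⊆ mÕ`, so they generate `Õ` over `O`.
  have hf : Function.Surjective f := by
    refine surjective_of_mkQ_comp_surjective (I := m) fun y => ?_
    obtain ⟨z, rfl⟩ := Submodule.mkQ_surjective _ y
    refine ⟨fun p => algebraMap k O (PowerSeries.coeff p.2 (z p.1)), ?_⟩
    have hfz : f (fun p => algebraMap k O (PowerSeries.coeff p.2 (z p.1))) = branchTrunc a z := by
      rw [Fintype.linearCombination_apply, branchTrunc]
      refine Finset.sum_congr rfl fun p _ => ?_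
      rw [hsmul, AlgHom.commutes, ← Algebra.smul_def]
    rw [LinearMap.comp_apply, hfz, Submodule.mkQ_apply, Submodule.mkQ_apply,
      Submodule.Quotient.eq]
    have hdvd : ∀ i, branchHom e x i ∣ (branchTrunc a z - z) i := fun i => by
      apply PowerSeries.dvd_of_order_le (hne i)
      rw [ha, PowerSeries.natCast_le_order_iff]
      intro b hb
      rw [Pi.sub_apply, map_sub, coeff_branchTrunc a z i b hb, sub_self]
    choose w hw using hdvd
    have : branchTrunc a z - z = x • w := by
      rw [hsmul]; ext1 i; rw [hw i]; rfl
    rw [this]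
    exact Submodule.smul_mem_smul hxm trivial
  -- A common denominator `q` of the finitely many generators satisfies `qÕ ⊆ O`, so the orders of
  -- `q` on the branches serve as a conductor exponent.
  obtain ⟨q, hq⟩ := IsLocalization.exist_integer_multiples_of_finite (nonZeroDivisors O)
    (fun p : Σ i, Fin (a i) => (e.symm (branchMonomial k p.1 p.2) : FractionRing O))
  have hq' : ∀ z : Fin d → k⟦X⟧, branchHom e q * z ∈ branchImage e := by
    intro z
    obtain ⟨v, rfl⟩ := hf z
    rw [Fintype.linearCombination_apply, Finset.mul_sum]
    refine Subalgebra.sum_mem _ fun p _ => ?_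
    rw [hsmul, mul_left_comm]
    refine Subalgebra.mul_mem _ ⟨_, rfl⟩ ?_
    obtain ⟨o, ho⟩ := hq p
    refine (mem_branchImage e).2 ⟨o, ?_⟩
    rw [branchHom_apply, branchHom_apply,
      ← e.apply_symm_apply (branchMonomial k p.1 p.2), ← map_mul]
    congr 1
    refine Subtype.ext ?_
    have h2 : algebraMap O (FractionRing O) o =
      algebraMap O (FractionRing O) q * (e.symm (branchMonomial k p.1 p.2) : FractionRing O) := by
      rw [ho, Algebra.smul_def]
    simpa using h2
  refine ⟨fun i => (branchHom e q i).order.toNat, fun z hz => ?_⟩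
  have hdvd : ∀ i, branchHom e q i ∣ z i := fun i => by
    apply PowerSeries.dvd_of_order_le (branchHom_ne_zero e q.2 i)
    have := hz i
    rwa [ENat.natCast_toNat (PowerSeries.order_eq_top.not.2 (branchHom_ne_zero e q.2 i))] at this
  choose w hw using hdvd
  have : z = branchHom e q * w := by ext1 i; rw [hw i]; rfl
  rw [this]
  exact hq' w

end Normalization

/-! ### Completed local rings of curves -/

section Curves

variable {k : Type u} [Field k] {Y : Over (Spec (CommRingCat.of k))} (P : Y.left)

lemma isNoetherianRing_localRingAt (hY : IsAlgebraicCurve Y) :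
    IsNoetherianRing (LocalRingAt Y P) := by
  have := hY.proper
  have := LocallyOfFiniteType.isLocallyNoetherian Y.hom
  exact inferInstanceAs (IsNoetherianRing (Y.left.presheaf.stalk P))

lemma isLocalRing_completedLocalRing (hY : IsAlgebraicCurve Y) :
    IsLocalRing (CompletedLocalRing Y P) := by
  have := isNoetherianRing_localRingAt P hY
  exact inferInstanceAs (IsLocalRing
    (AdicCompletion (IsLocalRing.maximalIdeal (LocalRingAt Y P)) (LocalRingAt Y P)))

lemma isAdicComplete_completedLocalRing (hY : IsAlgebraicCurve Y) :
    haveI := isLocalRing_completedLocalRing P hY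
    IsAdicComplete (IsLocalRing.maximalIdeal (CompletedLocalRing Y P))
      (CompletedLocalRing Y P) := by
  have := isNoetherianRing_localRingAt P hY
  exact inferInstanceAs (IsAdicComplete (IsLocalRing.maximalIdeal
    (AdicCompletion (IsLocalRing.maximalIdeal (LocalRingAt Y P)) (LocalRingAt Y P)))
    (AdicCompletion (IsLocalRing.maximalIdeal (LocalRingAt Y P)) (LocalRingAt Y P)))

end Curves

/-! ### Codimensions of subspaces -/

section Codimension

variable {k V : Type*} [Field k] [AddCommGroup V] [Module k V]

lemma Submodule.finrank_quotient_of_le {A B : Submodule k V} (h : A ≤ B)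
    [FiniteDimensional k (V ⧸ A)] :
    Module.finrank k (V ⧸ A) =
      Module.finrank k (V ⧸ B) + Module.finrank k (B ⧸ A.comap B.subtype) := by
  have h1 := Submodule.finrank_quotient_add_finrank (B.map A.mkQ)
  rw [(Submodule.quotientQuotientEquivQuotient A B h).finrank_eq] at h1
  have h2 : LinearMap.ker (A.mkQ.comp B.subtype) = A.comap B.subtype := by
    rw [LinearMap.ker_comp, Submodule.ker_mkQ]
  have h3 : LinearMap.range (A.mkQ.comp B.subtype) = B.map A.mkQ := by
    rw [LinearMap.range_comp, Submodule.range_subtype]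
  rw [← h1, ← h2, (A.mkQ.comp B.subtype).quotKerEquivRange.finrank_eq, h3]

/-- If `φ` does not vanish on `B`, then `v ↦ ([v], φ v)` identifies `V ⧸ (B ⊓ ker φ)` with
`(V ⧸ B) × k`. -/
lemma Submodule.exists_quotient_inf_ker_equiv {B : Submodule k V} {φ : V →ₗ[k] k} {x : V}
    (hx : x ∈ B) (hφ : φ x ≠ 0) :
    Nonempty ((V ⧸ (B ⊓ LinearMap.ker φ)) ≃ₗ[k] (V ⧸ B) × k) := by
  have hker : LinearMap.ker (B.mkQ.prod φ) = B ⊓ LinearMap.ker φ := by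
    rw [LinearMap.ker_prod, Submodule.ker_mkQ]
  have hsurj : Function.Surjective (B.mkQ.prod φ) := by
    rintro ⟨a, b⟩
    obtain ⟨v, rfl⟩ := B.mkQ_surjective a
    refine ⟨v + ((b - φ v) / φ x) • x, Prod.ext ?_ ?_⟩
    · simp [(Submodule.Quotient.mk_eq_zero B).2 hx]
    · simp [hφ]
  rw [← hker]
  exact ⟨LinearMap.quotKerEquivOfSurjective _ hsurj⟩

lemma Submodule.inf_ker_eq_self {B : Submodule k V} {φ : V →ₗ[k] k}
    (h : ¬ ∃ x ∈ B, φ x ≠ 0) : B ⊓ LinearMap.ker φ = B := by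
  push Not at h
  exact inf_eq_left.2 h

lemma Submodule.finiteDimensional_quotient_inf_ker (B : Submodule k V) (φ : V →ₗ[k] k)
    [FiniteDimensional k (V ⧸ B)] : FiniteDimensional k (V ⧸ (B ⊓ LinearMap.ker φ)) := by
  by_cases h : ∃ x ∈ B, φ x ≠ 0
  · obtain ⟨x, hx, hφ⟩ := h
    obtain ⟨e⟩ := Submodule.exists_quotient_inf_ker_equiv hx hφ
    exact e.symm.finiteDimensional
  · rw [Submodule.inf_ker_eq_self h]; infer_instance

-- The basic step of the dimension counts: raising one order by one imposes a single linear
-- condition, so the codimension grows by one or stays the same.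
open Classical in
lemma Submodule.finrank_quotient_inf_ker (B : Submodule k V) (φ : V →ₗ[k] k)
    [FiniteDimensional k (V ⧸ B)] :
    Module.finrank k (V ⧸ (B ⊓ LinearMap.ker φ)) =
      Module.finrank k (V ⧸ B) + if ∃ x ∈ B, φ x ≠ 0 then 1 else 0 := by
  by_cases h : ∃ x ∈ B, φ x ≠ 0
  · obtain ⟨x, hx, hφ⟩ := id h
    obtain ⟨e⟩ := Submodule.exists_quotient_inf_ker_equiv hx hφ
    rw [e.finrank_eq, Module.finrank_prod, Module.finrank_self, if_pos h]
  · rw [Submodule.inf_ker_eq_self h, if_neg h, add_zero]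

end Codimension

/-! ### Semigroups of values -/

/-- `O` is the ring of a curve singularity with `d` rational branches: it is local and
contains an ideal `t^c Õ`. -/
structure IsBranchRing {k : Type u} [Field k] {d : ℕ} (O : Subalgebra k (Fin d → k⟦X⟧)) :
    Prop where
  constantCoeff_eq : ∀ z ∈ O, ∀ i j,
    PowerSeries.constantCoeff (z i) = PowerSeries.constantCoeff (z j)
  exists_conductor : ∃ c : Fin d → ℕ, ∀ z : Fin d → k⟦X⟧, (∀ i, (c i : ℕ∞) ≤ (z i).order) → z ∈ O

/-- The geometry of the curve enters here. The later study of values, colengths and `𝓘_n` uses only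
these two properties and `0 < d`. -/
lemma isBranchRing_completedLocalRing {k : Type u} [Field k] {Y : Over (Spec (CommRingCat.of k))}
    (hY : IsAlgebraicCurve Y) (P : Y.left) {d : ℕ}
    (e : BranchCoordinates k (CompletedLocalRing Y P) d) : IsBranchRing (branchImage e) := by
  have := isLocalRing_completedLocalRing P hY
  have := isAdicComplete_completedLocalRing P hY
  exact ⟨fun z hz => constantCoeff_eq_of_mem_branchImage e hz, exists_conductor_branchImage e⟩

section Values

variable {k : Type u} [Field k] {d : ℕ}

/-- The coefficient of `t_i^a`. -/
def branchCoeff (k : Type u) [Field k] {d : ℕ} (i : Fin d) (a : ℕ) : (Fin d → k⟦X⟧) →ₗ[k] k :=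
  (PowerSeries.coeff a).comp (LinearMap.proj i)

@[simp] lemma branchCoeff_apply (i : Fin d) (a : ℕ) (z : Fin d → k⟦X⟧) :
    branchCoeff k i a z = PowerSeries.coeff a (z i) := rfl

/-- The ideal `t^n Õ`, as a subspace. -/
def orderSubmodule (k : Type u) [Field k] {d : ℕ} (n : Fin d → ℕ) :
    Submodule k (Fin d → k⟦X⟧) where
  carrier := {z | ∀ i, (n i : ℕ∞) ≤ (z i).order}
  add_mem' {a b} ha hb i := (le_min (ha i) (hb i)).trans (PowerSeries.min_order_le_order_add _ _)
  zero_mem' i := by simp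
  smul_mem' a b hb i := (hb i).trans PowerSeries.le_order_smul

lemma mem_orderSubmodule_iff_coeff {n : Fin d → ℕ} {z : Fin d → k⟦X⟧} :
    z ∈ orderSubmodule k n ↔ ∀ i, ∀ a < n i, PowerSeries.coeff a (z i) = 0 :=
  forall_congr' fun _ => PowerSeries.natCast_le_order_iff _ _

lemma mem_orderSubmodule_iff_dvd {n : Fin d → ℕ} {z : Fin d → k⟦X⟧} :
    z ∈ orderSubmodule k n ↔ ∃ w, z = tPow k n * w := by
  rw [mem_orderSubmodule_iff_coeff]
  constructor
  · intro h
    choose w hw using fun i => PowerSeries.X_pow_dvd_iff.2 (h i)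
    exact ⟨w, funext hw⟩
  · rintro ⟨w, rfl⟩ i
    exact PowerSeries.X_pow_dvd_iff.1 ⟨w i, rfl⟩

lemma orderSubmodule_mono {m n : Fin d → ℕ} (h : m ≤ n) :
    orderSubmodule k n ≤ orderSubmodule k m :=
  fun _ hz i => le_trans (by exact_mod_cast h i) (hz i)

lemma orderSubmodule_zero : orderSubmodule k (0 : Fin d → ℕ) = ⊤ := by
  rw [eq_top_iff]
  intro z _ i
  simp

lemma orderSubmodule_add_single (n : Fin d → ℕ) (i : Fin d) :
    orderSubmodule k (n + Pi.single i 1) =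
      orderSubmodule k n ⊓ LinearMap.ker (branchCoeff k i (n i)) := by
  classical
  ext z
  rw [Submodule.mem_inf, LinearMap.mem_ker, mem_orderSubmodule_iff_coeff,
    mem_orderSubmodule_iff_coeff]
  constructor
  · refine fun h => ⟨fun j a ha => h j a ?_, h i (n i) ?_⟩
    · exact lt_of_lt_of_le ha (Nat.le_add_right _ _)
    · simp
  · rintro ⟨h1, h2⟩ j a ha
    by_cases hj : j = i
    · subst hj
      rw [Pi.add_apply, Pi.single_eq_same, Nat.lt_succ_iff_lt_or_eq] at ha
      rcases ha with ha | rfl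
      · exact h1 j a ha
      · exact h2
    · rw [Pi.add_apply, Pi.single_eq_of_ne hj, add_zero] at ha
      exact h1 j a ha

lemma induction_add_single {p : (Fin d → ℕ) → Prop} (h0 : p 0)
    (h1 : ∀ n i, p n → p (n + Pi.single i 1)) (n : Fin d → ℕ) : p n := by
  classical
  induction h : ∑ i, n i generalizing n with
  | zero =>
    have : n = 0 := by
      funext i
      exact Finset.sum_eq_zero_iff.1 h i (Finset.mem_univ i)
    rwa [this]
  | succ N ih =>
    obtain ⟨i, -, hi⟩ := Finset.exists_ne_zero_of_sum_ne_zero (h.trans_ne N.succ_ne_zero)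
    have hn : n = (n - Pi.single i 1) + Pi.single i 1 := by
      funext j
      by_cases hj : j = i
      · subst hj; simp; omega
      · simp [hj]
    rw [hn]
    apply h1
    apply ih
    rw [hn] at h
    simp only [Pi.add_apply, Finset.sum_add_distrib, Finset.sum_pi_single', Finset.mem_univ,
      if_true] at h
    omega

lemma tPow_mem_orderSubmodule (n : Fin d → ℕ) : tPow k n ∈ orderSubmodule k n :=
  mem_orderSubmodule_iff_dvd.2 ⟨1, (mul_one _).symm⟩

lemma order_tPow (n : Fin d → ℕ) (i : Fin d) : (tPow k n i).order = n i := by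
  simp [tPow, PowerSeries.order_X_pow]

lemma branchMonomial_mem_orderSubmodule {n : Fin d → ℕ} {i : Fin d} {a : ℕ} (h : n i ≤ a) :
    branchMonomial k i a ∈ orderSubmodule k n := by
  rw [mem_orderSubmodule_iff_coeff]
  intro j b hb
  rw [coeff_branchMonomial, if_neg]
  rintro ⟨rfl, rfl⟩
  omega

lemma finrank_quotient_orderSubmodule_and_finite (n : Fin d → ℕ) :
    FiniteDimensional k ((Fin d → k⟦X⟧) ⧸ orderSubmodule k n) ∧
      Module.finrank k ((Fin d → k⟦X⟧) ⧸ orderSubmodule k n) = vecNorm n := by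
  induction n using induction_add_single with
  | h0 =>
    rw [orderSubmodule_zero]
    refine ⟨inferInstance, ?_⟩
    rw [Module.finrank_zero_of_subsingleton]
    simp [vecNorm]
  | h1 n i ih =>
    have := ih.1
    rw [orderSubmodule_add_single]
    refine ⟨Submodule.finiteDimensional_quotient_inf_ker _ _, ?_⟩
    rw [Submodule.finrank_quotient_inf_ker, if_pos, ih.2]
    · simp [vecNorm, Finset.sum_add_distrib]
    · exact ⟨branchMonomial k i (n i), branchMonomial_mem_orderSubmodule le_rfl, by
        simp [coeff_branchMonomial]⟩

instance (n : Fin d → ℕ) : FiniteDimensional k ((Fin d → k⟦X⟧) ⧸ orderSubmodule k n) :=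
  (finrank_quotient_orderSubmodule_and_finite n).1

lemma finrank_quotient_orderSubmodule (n : Fin d → ℕ) :
    Module.finrank k ((Fin d → k⟦X⟧) ⧸ orderSubmodule k n) = vecNorm n :=
  (finrank_quotient_orderSubmodule_and_finite n).2

variable (O : Subalgebra k (Fin d → k⟦X⟧))

/-- The conductor `c` of the semigroup of values of `O`. -/
abbrev valueConductor : Fin d → ℕ := semigroupConductor (valueSemigroup O)

/-- Successive approximation: an element of `O` with value exactly `n` removes the coefficient of
`t_i^{n_i}` from `z`, which raises the order on branch `i`. The process ends once all orders reach
some exponent `c₀` with `t^{c₀} Õ ⊆ O`. -/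
lemma orderSubmodule_le_of_forall_mem (hO : IsBranchRing O) {c : Fin d → ℕ}
    (hc : ∀ n, c ≤ n → n ∈ valueSemigroup O) :
    orderSubmodule k c ≤ Subalgebra.toSubmodule O := by
  classical
  obtain ⟨c₀, hc₀⟩ := hO.exists_conductor
  suffices h : ∀ N n, c ≤ n → ∑ i, (c₀ i - n i) = N →
      orderSubmodule k n ≤ Subalgebra.toSubmodule O from h _ c le_rfl rfl
  intro N
  induction N using Nat.strong_induction_on with
  | h N ih =>
    intro n hn hN z hz
    by_cases hle : ∀ i, c₀ i ≤ n i
    · exact hc₀ z (orderSubmodule_mono hle hz)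
    push Not at hle
    obtain ⟨i, hi⟩ := hle
    obtain ⟨s, hs, hsn⟩ := hc n hn
    have hb : PowerSeries.coeff (n i) (s i) ≠ 0 := (PowerSeries.order_eq_nat.1 (hsn i)).1
    set a := PowerSeries.coeff (n i) (z i) / PowerSeries.coeff (n i) (s i) with ha
    have hs' : s ∈ orderSubmodule k n := fun j => (hsn j).ge
    have hmem : z - a • s ∈ orderSubmodule k (n + Pi.single i 1) := by
      rw [orderSubmodule_add_single]
      refine ⟨Submodule.sub_mem _ hz (Submodule.smul_mem _ _ hs'), ?_⟩
      simp [ha, hb]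
    have h1 := ih (∑ j, (c₀ j - (n + Pi.single i 1 : Fin d → ℕ) j)) (by
      rw [← hN]
      refine Finset.sum_lt_sum (fun j _ => ?_) ⟨i, Finset.mem_univ i, ?_⟩
      · exact Nat.sub_le_sub_left (Nat.le_add_right _ _) _
      · simp; omega) (n + Pi.single i 1) (hn.trans (by intro j; simp)) rfl hmem
    have := Submodule.add_mem _ h1 (Submodule.smul_mem (Subalgebra.toSubmodule O) a hs)
    rwa [sub_add_cancel] at this

/-- The ideal `t^c Õ` defined by the conductor of the semigroup lies in `O`. -/
theorem orderSubmodule_valueConductor_le (hO : IsBranchRing O) :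
    orderSubmodule k (valueConductor O) ≤ Subalgebra.toSubmodule O := by
  classical
  set C := {c | ∀ n, c ≤ n → n ∈ valueSemigroup O} with hC
  have hne : C.Nonempty := by
    obtain ⟨c₀, hc₀⟩ := hO.exists_conductor
    exact ⟨c₀, fun n hn => ⟨tPow k n, hc₀ _ fun i => by
      rw [order_tPow]; exact_mod_cast hn i, order_tPow n⟩⟩
  -- The infimum is coordinatewise, so a priori different elements of `C` attain its different
  -- components.
  have hatt : ∀ i, ∃ c ∈ C, valueConductor O i = c i := by
    intro i
    have h1 : valueConductor O i = sInf ((fun c : Fin d → ℕ => c i) '' C) := by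
      rw [valueConductor, semigroupConductor, sInf_apply, iInf, Set.image_eq_range]
    obtain ⟨c, hc, hci⟩ := Nat.sInf_mem (hne.image fun c : Fin d → ℕ => c i)
    exact ⟨c, hc, h1.trans hci.symm⟩
  intro z hz
  -- The part of `z` on branch `i` has infinite order on the other branches, so only the `i`-th
  -- component of an element of `C` constrains it; one attaining the infimum there can be used.
  have hsum : z = ∑ i, Pi.single i (z i) := (Finset.univ_sum_single z).symm
  rw [hsum]
  refine Submodule.sum_mem _ fun i _ => ?_
  obtain ⟨c, hc, hci⟩ := hatt i
  refine orderSubmodule_le_of_forall_mem O hO hc fun j => ?_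
  by_cases hj : j = i
  · subst hj
    rw [Pi.single_eq_same, ← hci]
    exact hz j
  · simp [hj]

lemma mem_valueSemigroup_of_conductor_le (hO : IsBranchRing O) {n : Fin d → ℕ}
    (hn : valueConductor O ≤ n) : n ∈ valueSemigroup O :=
  ⟨tPow k n, orderSubmodule_valueConductor_le O hO
    (orderSubmodule_mono hn (tPow_mem_orderSubmodule n)), order_tPow n⟩

/-- Membership in the semigroup only depends on the components below the conductor. -/
lemma mem_valueSemigroup_of_agree (hO : IsBranchRing O) {n m : Fin d → ℕ}
    (hn : n ∈ valueSemigroup O)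
    (h : ∀ i, n i = m i ∨ (valueConductor O i ≤ n i ∧ valueConductor O i ≤ m i)) :
    m ∈ valueSemigroup O := by
  classical
  obtain ⟨z, hz, hzn⟩ := hn
  -- Components are altered only where both orders are beyond the conductor, so `w` and `z` differ
  -- by an element of `t^c Õ ⊆ O`.
  let w : Fin d → k⟦X⟧ := fun i => if n i = m i then z i else PowerSeries.X ^ m i
  refine ⟨w, ?_, fun i => ?_⟩
  · have h1 : w - z ∈ orderSubmodule k (valueConductor O) := by
      intro i
      by_cases hi : n i = m i
      · simp [w, hi]
      · obtain ⟨h1, h2⟩ := (h i).resolve_left hi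
        have hw : w i = PowerSeries.X ^ m i := if_neg hi
        rw [Pi.sub_apply, hw, sub_eq_add_neg]
        refine le_trans (le_min ?_ ?_) (PowerSeries.min_order_le_order_add _ _)
        · rw [PowerSeries.order_X_pow]; exact_mod_cast h2
        · rw [PowerSeries.order_neg, hzn]; exact_mod_cast h1
    have := Submodule.add_mem _ (orderSubmodule_valueConductor_le O hO h1) hz
    rwa [sub_add_cancel] at this
  · by_cases hi : n i = m i
    · have : w i = z i := if_pos hi
      rw [this, hzn, hi]
    · have : w i = PowerSeries.X ^ m i := if_neg hi
      rw [this, PowerSeries.order_X_pow]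

/-- The left side is the condition for `l` to jump from `n` to `n + 1_i`; the right side mentions
only the semigroup. This is why the colengths depend on the semigroup alone. -/
lemma exists_mem_valueSemigroup_iff (hO : IsBranchRing O) (n : Fin d → ℕ) (i : Fin d) :
    (∃ z ∈ O, z ∈ orderSubmodule k n ∧ PowerSeries.coeff (n i) (z i) ≠ 0) ↔
      ∃ s ∈ valueSemigroup O, n ≤ s ∧ s i = n i := by
  classical
  constructor
  · rintro ⟨z, hz, hzn, hzi⟩
    -- An element of `S` needs all components non-zero. Vanishing components of `z` are replaced by
    -- powers beyond the conductor, to remain in `O`, and of order at least `n_j`.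
    set m : Fin d → ℕ := fun j => max (valueConductor O j) (n j)
    let w : Fin d → k⟦X⟧ := fun j => if z j = 0 then PowerSeries.X ^ m j else z j
    have hw0 : ∀ j, w j ≠ 0 := fun j => by
      by_cases hj : z j = 0
      · simp [w, hj]
      · simp [w, hj]
    have hwn : ∀ j, (n j : ℕ∞) ≤ (w j).order := fun j => by
      by_cases hj : z j = 0
      · have : w j = PowerSeries.X ^ m j := if_pos hj
        rw [this, PowerSeries.order_X_pow]
        exact_mod_cast le_max_right _ _
      · have : w j = z j := if_neg hj
        rw [this]; exact hzn j
    have hzi0 : z i ≠ 0 := fun h0 => hzi (by simp [h0])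
    have hwi : w i = z i := if_neg hzi0
    choose s hs using fun j => show ∃ a : ℕ, (w j).order = a from
      ⟨_, (ENat.natCast_toNat (PowerSeries.order_eq_top.not.2 (hw0 j))).symm⟩
    refine ⟨s, ⟨w, ?_, hs⟩, fun j => ?_, ?_⟩
    · have h1 : w - z ∈ orderSubmodule k (valueConductor O) := by
        intro j
        by_cases hj : z j = 0
        · have : w j = PowerSeries.X ^ m j := if_pos hj
          rw [Pi.sub_apply, hj, sub_zero, this, PowerSeries.order_X_pow]
          exact_mod_cast le_max_left _ _
        · simp [w, hj]
      have := Submodule.add_mem _ (orderSubmodule_valueConductor_le O hO h1) hz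
      rwa [sub_add_cancel] at this
    · have := hwn j
      rw [hs j] at this
      exact_mod_cast this
    · have h1 := hs i
      have h2 : (w i).order ≤ n i := by
        rw [hwi]; exact PowerSeries.order_le _ hzi
      have h3 := hwn i
      rw [h1] at h2 h3
      exact le_antisymm (by exact_mod_cast h2) (by exact_mod_cast h3)
  · rintro ⟨s, ⟨z, hz, hzs⟩, hns, hsi⟩
    refine ⟨z, hz, fun j => ?_, ?_⟩
    · rw [hzs]; exact_mod_cast hns j
    · rw [← hsi]
      exact (PowerSeries.order_eq_nat.1 (hzs i)).1

/-- The subspace `J_n(O)` of `O`. -/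
abbrev valuationSubmodule (n : Fin d → ℕ) : Submodule k O :=
  (orderSubmodule k n).comap (Subalgebra.toSubmodule O).subtype

lemma valuationColength_eq (n : Fin d → ℕ) :
    valuationColength O n = Module.finrank k (O ⧸ valuationSubmodule O n) :=
  ((Submodule.Quotient.restrictScalarsEquiv k (valuationIdeal O n)).finrank_eq).symm

lemma valuationColength_zero : valuationColength O 0 = 0 := by
  rw [valuationColength_eq, valuationSubmodule, orderSubmodule_zero, Submodule.comap_top]
  exact Module.finrank_zero_of_subsingleton

lemma valuationSubmodule_add_single (n : Fin d → ℕ) (i : Fin d) :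
    valuationSubmodule O (n + Pi.single i 1) = valuationSubmodule O n ⊓
      LinearMap.ker ((branchCoeff k i (n i)).comp (Subalgebra.toSubmodule O).subtype) := by
  rw [valuationSubmodule, orderSubmodule_add_single, Submodule.comap_inf, LinearMap.ker_comp]

lemma finiteDimensional_quotient_valuationSubmodule (n : Fin d → ℕ) :
    FiniteDimensional k (O ⧸ valuationSubmodule O n) := by
  induction n using induction_add_single with
  | h0 =>
    rw [valuationSubmodule, orderSubmodule_zero, Submodule.comap_top]
    infer_instance
  | h1 n i ih =>
    rw [valuationSubmodule_add_single]
    exact Submodule.finiteDimensional_quotient_inf_ker _ _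

open Classical in
lemma valuationColength_add_single (n : Fin d → ℕ) (i : Fin d) :
    valuationColength O (n + Pi.single i 1) = valuationColength O n +
      if ∃ z ∈ O, z ∈ orderSubmodule k n ∧ PowerSeries.coeff (n i) (z i) ≠ 0 then 1 else 0 := by
  have := finiteDimensional_quotient_valuationSubmodule O n
  rw [valuationColength_eq, valuationSubmodule_add_single, Submodule.finrank_quotient_inf_ker,
    valuationColength_eq]
  congr 1
  refine if_congr ⟨?_, ?_⟩ rfl rfl
  · rintro ⟨x, hx, hx'⟩
    exact ⟨x, x.2, hx, hx'⟩
  · rintro ⟨x, hx, hxn, hx'⟩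
    exact ⟨⟨x, hx⟩, hxn, hx'⟩

lemma valuationColength_add_single_of_conductor_le (hO : IsBranchRing O) {n : Fin d → ℕ}
    {i : Fin d} (h : valueConductor O i ≤ n i) :
    valuationColength O (n + Pi.single i 1) = valuationColength O n + 1 := by
  rw [valuationColength_add_single, if_pos]
  exact ⟨branchMonomial k i (n i), orderSubmodule_valueConductor_le O hO
    (branchMonomial_mem_orderSubmodule h), branchMonomial_mem_orderSubmodule le_rfl, by
      simp [coeff_branchMonomial]⟩

/-- The colengths `l(n)` only depend on the semigroup of values. -/
theorem valuationColength_congr {k' : Type*} [Field k'] (hO : IsBranchRing O)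
    {O' : Subalgebra k' (Fin d → k'⟦X⟧)} (hO' : IsBranchRing O')
    (hS : valueSemigroup O' = valueSemigroup O) (n : Fin d → ℕ) :
    valuationColength O' n = valuationColength O n := by
  classical
  induction n using induction_add_single with
  | h0 => rw [valuationColength_zero, valuationColength_zero]
  | h1 n i ih =>
    rw [valuationColength_add_single, valuationColength_add_single, ih,
      if_congr (exists_mem_valueSemigroup_iff O' hO' n i) rfl rfl,
      if_congr (exists_mem_valueSemigroup_iff O hO n i) rfl rfl, hS]

lemma finiteDimensional_quotient_inf_orderSubmodule (hO : IsBranchRing O) (n : Fin d → ℕ) :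
    FiniteDimensional k
      ((Fin d → k⟦X⟧) ⧸ (Subalgebra.toSubmodule O ⊓ orderSubmodule k n)) := by
  have hle : orderSubmodule k (valueConductor O ⊔ n) ≤
      Subalgebra.toSubmodule O ⊓ orderSubmodule k n :=
    le_inf ((orderSubmodule_mono le_sup_left).trans (orderSubmodule_valueConductor_le O hO))
      (orderSubmodule_mono le_sup_right)
  exact Module.Finite.of_surjective (Submodule.factor hle) (Submodule.factor_surjective hle)

/-- Additivity along `J_n(O) ⊆ O ⊆ Õ`. It turns colengths in `O` into codimensions in `Õ`, where
`t^n Õ` has codimension `‖n‖`. -/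
lemma singularityDegree_add_valuationColength (hO : IsBranchRing O) (n : Fin d → ℕ) :
    singularityDegree O + valuationColength O n = Module.finrank k
      ((Fin d → k⟦X⟧) ⧸ (Subalgebra.toSubmodule O ⊓ orderSubmodule k n)) := by
  have := finiteDimensional_quotient_inf_orderSubmodule O hO n
  rw [Submodule.finrank_quotient_of_le (inf_le_left : Subalgebra.toSubmodule O ⊓
    orderSubmodule k n ≤ Subalgebra.toSubmodule O), valuationColength_eq, Submodule.comap_inf,
    Submodule.comap_subtype_self, top_inf_eq]
  rfl

lemma singularityDegree_add_valuationColength_conductor (hO : IsBranchRing O) :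
    singularityDegree O + valuationColength O (valueConductor O) = vecNorm (valueConductor O) := by
  rw [singularityDegree_add_valuationColength O hO,
    inf_eq_right.2 (orderSubmodule_valueConductor_le O hO), finrank_quotient_orderSubmodule]

/-- A conductor with a vanishing component only occurs for one branch. -/
lemma eq_of_valueConductor_eq_zero (hO : IsBranchRing O) {i : Fin d}
    (hi : valueConductor O i = 0) (j : Fin d) : j = i := by
  by_contra hj
  -- With `c_i = 0` the idempotent of branch `i` lies in `O`; its constant terms are `1` on branch
  -- `i` and `0` elsewhere.
  have h1 : branchMonomial k i 0 ∈ O := orderSubmodule_valueConductor_le O hO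
    (branchMonomial_mem_orderSubmodule hi.le)
  have h2 := hO.constantCoeff_eq _ h1 i j
  rw [← PowerSeries.coeff_zero_eq_constantCoeff_apply,
    ← PowerSeries.coeff_zero_eq_constantCoeff_apply, coeff_branchMonomial,
    coeff_branchMonomial] at h2
  simp [hj] at h2

end Values

/-! ### Classes of affine varieties -/

section Classes

variable (k : Type u) [Field k]

/-- The class of `Spec R` in the Grothendieck ring. -/
abbrev affineClass (R : Type u) [CommRing R] [Algebra k R] [Algebra.FiniteType k R] :
    GrothendieckRing k :=
  (AlgVariety.affine k R).grothendieckClass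

lemma grothendieckRing_mk_eq {p q : MvPolynomial (AlgVariety k) ℤ} (h : GrothendieckRel k p q) :
    (Ideal.Quotient.mk _ p : GrothendieckRing k) = Ideal.Quotient.mk _ q :=
  Ideal.Quotient.eq.2 (Ideal.subset_span ⟨p, q, h, rfl⟩)

variable {k}

variable {R S : Type u} [CommRing R] [Algebra k R] [CommRing S] [Algebra k S]

/-- The morphism of `k`-schemes given by a homomorphism of `k`-algebras. -/
def specOverMap (f : R →ₐ[k] S) :
    Over.mk (Spec.map (CommRingCat.ofHom (algebraMap k S))) ⟶
      Over.mk (Spec.map (CommRingCat.ofHom (algebraMap k R))) :=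
  Over.homMk (Spec.map (CommRingCat.ofHom f.toRingHom)) (by
    dsimp
    rw [← Spec.map_comp, ← CommRingCat.ofHom_comp]
    congr 2
    exact f.comp_algebraMap)

variable [Algebra.FiniteType k R] [Algebra.FiniteType k S]

lemma affineClass_congr (e : R ≃ₐ[k] S) : affineClass k R = affineClass k S := by
  refine grothendieckRing_mk_eq k (GrothendieckRel.iso _ _ ?_)
  refine ⟨specOverMap e.symm.toAlgHom, specOverMap e.toAlgHom, ?_, ?_⟩
  · ext1
    change Spec.map _ ≫ Spec.map _ = 𝟙 _
    rw [← Spec.map_comp, ← CommRingCat.ofHom_comp, ← Spec.map_id]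
    congr 1
    ext x
    exact e.symm_apply_apply x
  · ext1
    change Spec.map _ ≫ Spec.map _ = 𝟙 _
    rw [← Spec.map_comp, ← CommRingCat.ofHom_comp, ← Spec.map_id]
    congr 1
    ext x
    exact e.apply_symm_apply x

instance finiteType_localizationAway (a : R) : Algebra.FiniteType k (Localization.Away a) :=
  have : Algebra.FiniteType R (Localization.Away a) :=
    IsLocalization.finiteType_of_monoid_fg (Submonoid.powers a) _
  Algebra.FiniteType.trans (S := R) ‹_› ‹_›

/-- The scissor relation for the basic open set `D(a)` and its closed complement `V(a)`. -/
lemma affineClass_eq_localization_add_quotient (a : R) :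
    affineClass k R =
      affineClass k (Localization.Away a) + affineClass k (R ⧸ Ideal.span {a}) := by
  refine (grothendieckRing_mk_eq k (GrothendieckRel.scissor _ _ _
    (specOverMap (Ideal.Quotient.mkₐ k (Ideal.span {a})))
    (specOverMap (IsScalarTower.toAlgHom k R (Localization.Away a))) ?_ ?_ ?_)).trans (map_add _ _ _)
  · exact IsClosedImmersion.spec_of_surjective _ Ideal.Quotient.mk_surjective
  · exact IsOpenImmersion.of_isLocalization a
  · change Set.range (PrimeSpectrum.comap (algebraMap R (Localization.Away a))) =
      (Set.range (PrimeSpectrum.comap (Ideal.Quotient.mk (Ideal.span {a}))))ᶜ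
    rw [PrimeSpectrum.localization_away_comap_range (Localization.Away a) a,
      range_comap_of_surjective _ _ Ideal.Quotient.mk_surjective, Ideal.mk_ker,
      PrimeSpectrum.zeroLocus_span, PrimeSpectrum.basicOpen_eq_zeroLocus_compl]

/-- Cutting the empty scheme along `a = 0` gives two empty pieces, so its class equals twice itself.
-/
lemma affineClass_eq_zero [Subsingleton R] : affineClass k R = 0 := by
  have h := affineClass_eq_localization_add_quotient (k := k) (0 : R)
  have h1 : Subsingleton (Localization.Away (0 : R)) :=
    (algebraMap R (Localization.Away (0 : R))).codomain_trivial
  have e1 : Localization.Away (0 : R) ≃ₐ[k] R :=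
    AlgEquiv.ofBijective (AlgHom.ofLinearMap 0 (Subsingleton.elim _ _) fun _ _ =>
      Subsingleton.elim _ _) ⟨fun _ _ _ => Subsingleton.elim _ _, fun y => ⟨0, Subsingleton.elim _ _⟩⟩
  have h2 : Subsingleton (R ⧸ Ideal.span {(0 : R)}) := inferInstance
  have e2 : (R ⧸ Ideal.span {(0 : R)}) ≃ₐ[k] R :=
    AlgEquiv.ofBijective (AlgHom.ofLinearMap 0 (Subsingleton.elim _ _) fun _ _ =>
      Subsingleton.elim _ _) ⟨fun _ _ _ => Subsingleton.elim _ _, fun y => ⟨0, Subsingleton.elim _ _⟩⟩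
  rw [affineClass_congr e1, affineClass_congr e2] at h
  exact left_eq_add.1 h

instance finiteType_tensorProduct : Algebra.FiniteType k (R ⊗[k] S) :=
  have : Algebra.FiniteType R (R ⊗[k] S) := Algebra.FiniteType.baseChange R
  Algebra.FiniteType.trans (S := R) ‹_› ‹_›

/-- The product of affine varieties is the spectrum of the tensor product. -/
def affineProdIso : ((AlgVariety.affine k R).prod (AlgVariety.affine k S)).toOver ≅
    (AlgVariety.affine k (R ⊗[k] S)).toOver :=
  Over.isoMk (pullbackSpecIso k R S) (pullbackSpecIso_hom_base k R S)

lemma affineClass_tensorProduct :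
    affineClass k (R ⊗[k] S) = affineClass k R * affineClass k S :=
  (grothendieckRing_mk_eq k (GrothendieckRel.iso _ _ affineProdIso)).symm.trans
    ((grothendieckRing_mk_eq k (GrothendieckRel.prod _ _)).trans (map_mul _ _ _))

lemma specMap_algebraMap_self :
    Spec.map (CommRingCat.ofHom (algebraMap k k)) = 𝟙 (Spec (CommRingCat.of k)) := by
  rw [Algebra.algebraMap_self, CommRingCat.ofHom_id, Spec.map_id]

/-- `Spec k` is the one-point variety. -/
def affineSelfIso : (AlgVariety.affine k k).toOver ≅ (AlgVariety.point k).toOver :=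
  eqToIso (congrArg Over.mk specMap_algebraMap_self)

lemma affineClass_self : affineClass k k = 1 :=
  (grothendieckRing_mk_eq k (GrothendieckRel.iso _ _ affineSelfIso)).trans
    ((grothendieckRing_mk_eq k GrothendieckRel.point).trans (map_one _))

lemma affineClass_mvPolynomial (m : ℕ) :
    affineClass k (MvPolynomial (Fin m) k) = lefschetzClass k ^ m := by
  induction m with
  | zero =>
    rw [pow_zero, ← affineClass_self]
    exact affineClass_congr (MvPolynomial.isEmptyAlgEquiv k (Fin 0))
  | succ m ih =>
    rw [pow_succ', ← ih, lefschetzClass]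
    refine Eq.trans ?_ affineClass_tensorProduct
    refine affineClass_congr ((MvPolynomial.finSuccEquiv k m).trans ?_)
    exact (polyEquivTensor k (MvPolynomial (Fin m) k)).trans
      (Algebra.TensorProduct.comm k _ _)

end Classes

/-! ### Complements of hyperplane arrangements -/

section Arrangements

variable {k : Type u} [Field k] {M : Type*} [AddCommGroup M] [Module k M] {ι : Type*}

/-- `R` is the coordinate ring of the complement of the hyperplanes `ell i = 0`, `i ∈ s`, in the
affine space cut out by `N = 0` and `lam = 1` in the space with coordinates `M`, and `η` is its
universal point. -/
structure IsArrangementRing (N : Submodule k M) (lam : M) (ell : ι → M) (s : Finset ι)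
    (R : Type u) [CommRing R] [Algebra k R] (η : M →ₗ[k] R) : Prop where
  vanish : ∀ x ∈ N, η x = 0
  one : η lam = 1
  unit : ∀ i ∈ s, IsUnit (η (ell i))
  desc : ∀ (A : Type u) [CommRing A] [Algebra k A] (g : M →ₗ[k] A), (∀ x ∈ N, g x = 0) →
    g lam = 1 → (∀ i ∈ s, IsUnit (g (ell i))) → ∃! f : R →ₐ[k] A, ∀ x, f (η x) = g x

variable {N : Submodule k M} {lam : M} {ell : ι → M} {s : Finset ι}

/-- Uniqueness from the universal property. It identifies the restriction of an arrangement to a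
hyperplane with the ring supplied by induction for the enlarged system of equations. -/
lemma IsArrangementRing.nonempty_algEquiv {R R' : Type u} [CommRing R] [Algebra k R]
    [CommRing R'] [Algebra k R'] {η : M →ₗ[k] R} {η' : M →ₗ[k] R'}
    (h : IsArrangementRing N lam ell s R η) (h' : IsArrangementRing N lam ell s R' η') :
    Nonempty (R ≃ₐ[k] R') := by
  obtain ⟨f, hf, -⟩ := h.desc R' η' h'.vanish h'.one h'.unit
  obtain ⟨g, hg, -⟩ := h'.desc R η h.vanish h.one h.unit
  refine ⟨AlgEquiv.ofAlgHom f g ?_ ?_⟩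
  · exact (h'.desc R' η' h'.vanish h'.one h'.unit).unique (fun x => by simp [hf, hg])
      (fun x => by simp)
  · exact (h.desc R η h.vanish h.one h.unit).unique (fun x => by simp [hf, hg])
      (fun x => by simp)

/-- This and `IsArrangementRing.quotient` are the two halves of deletion and restriction: removing a
further hyperplane is a localization, restricting to it is a quotient. -/
lemma IsArrangementRing.localization [DecidableEq ι] {R : Type u} [CommRing R] [Algebra k R]
    {η : M →ₗ[k] R} (h : IsArrangementRing N lam ell s R η) (i : ι) :
    IsArrangementRing N lam ell (insert i s) (Localization.Away (η (ell i)))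
      ((IsScalarTower.toAlgHom k R (Localization.Away (η (ell i)))).toLinearMap.comp η) := by
  refine ⟨fun x hx => ?_, ?_, fun j hj => ?_, fun A _ _ g hN h1 hu => ?_⟩
  · simp [h.vanish x hx]
  · simp [h.one]
  · rcases Finset.mem_insert.1 hj with rfl | hj
    · exact IsLocalization.Away.algebraMap_isUnit (η (ell j))
    · exact (h.unit j hj).map (IsScalarTower.toAlgHom k R (Localization.Away (η (ell i))))
  · obtain ⟨f, hf, hf'⟩ := h.desc A g hN h1 fun j hj => hu j (Finset.mem_insert_of_mem hj)
    have hfu : IsUnit (f (η (ell i))) := by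
      rw [hf]; exact hu i (Finset.mem_insert_self _ _)
    have hpow : ∀ y : Submonoid.powers (η (ell i)), IsUnit (f y) := by
      rintro ⟨_, n, rfl⟩
      simpa using hfu.pow n
    refine ⟨IsLocalization.liftAlgHom (M := Submonoid.powers (η (ell i))) hpow, fun x => ?_,
      fun f' hf'' => ?_⟩
    · simp [hf]
    · have h2 : f'.comp (IsScalarTower.toAlgHom k R (Localization.Away (η (ell i)))) = f :=
        hf' _ fun x => hf'' x
      refine IsLocalization.algHom_ext (W := Submonoid.powers (η (ell i))) ?_
      ext x
      refine (DFunLike.congr_fun h2 x).trans ?_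
      exact (IsLocalization.lift_eq (M := Submonoid.powers (η (ell i))) hpow x).symm

lemma IsArrangementRing.quotient {R : Type u} [CommRing R] [Algebra k R] {η : M →ₗ[k] R}
    (h : IsArrangementRing N lam ell s R η) (y : M) :
    IsArrangementRing (N ⊔ Submodule.span k {y}) lam ell s (R ⧸ Ideal.span {η y})
      ((Ideal.Quotient.mkₐ k (Ideal.span {η y})).toLinearMap.comp η) := by
  refine ⟨fun x hx => ?_, ?_, fun j hj => ?_, fun A _ _ g hN h1 hu => ?_⟩
  · obtain ⟨a, ha, b, hb, rfl⟩ := Submodule.mem_sup.1 hx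
    obtain ⟨c, rfl⟩ := Submodule.mem_span_singleton.1 hb
    have hy : Ideal.Quotient.mk (Ideal.span {η y}) (η y) = 0 :=
      Ideal.Quotient.eq_zero_iff_mem.2 (Ideal.mem_span_singleton_self _)
    have hc : Ideal.Quotient.mkₐ k (Ideal.span {η y}) (c • η y) = 0 := by
      rw [map_smul, Ideal.Quotient.mkₐ_eq_mk, hy, smul_zero]
    rw [LinearMap.comp_apply, map_add, h.vanish a ha, zero_add, map_smul]
    exact hc
  · simp [h.one]
  · exact (h.unit j hj).map (Ideal.Quotient.mkₐ k (Ideal.span {η y}))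
  · obtain ⟨f, hf, hf'⟩ := h.desc A g (fun x hx => hN x (Submodule.mem_sup_left hx)) h1 hu
    have hfy : ∀ a ∈ Ideal.span {η y}, f a = 0 := by
      intro a ha
      obtain ⟨b, rfl⟩ := Ideal.mem_span_singleton.1 ha
      rw [map_mul, hf, hN y (Submodule.mem_sup_right (Submodule.mem_span_singleton_self y)),
        zero_mul]
    refine ⟨Ideal.Quotient.liftₐ _ f hfy, fun x => ?_, fun f' hf'' => ?_⟩
    · exact hf x
    · have h2 : f'.comp (Ideal.Quotient.mkₐ k (Ideal.span {η y})) = f := hf' _ fun x => hf'' x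
      refine Ideal.Quotient.algHom_ext _ ?_
      rw [h2]
      ext x
      rfl

/-- The class of the affine space cut out by `N = 0` and `lam = 1`. -/
def flatClass (N : Submodule k M) (lam : M) : GrothendieckRing k :=
  open Classical in
  if lam ∈ N then 0 else lefschetzClass k ^ (Module.finrank k (M ⧸ N) - 1)

/-- The classes of `lam` and the `y j` form a basis of `M ⧸ N`, with dual basis `χ`, `β j`. A linear
map killing `N` and sending `lam` to `1` is therefore freely determined by its values on the `y j`,
so the flat is an affine space of dimension `dim (M ⧸ N) - 1`. -/
lemma exists_affine_coordinates [FiniteDimensional k M] (hlam : lam ∉ N) :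
    ∃ (m : ℕ) (χ : M →ₗ[k] k) (β : Fin m → M →ₗ[k] k) (y : Fin m → M),
      Module.finrank k (M ⧸ N) = m + 1 ∧ χ lam = 1 ∧ (∀ x ∈ N, χ x = 0) ∧
      (∀ j, ∀ x ∈ N, β j x = 0) ∧ (∀ j, β j lam = 0) ∧ (∀ j, χ (y j) = 0) ∧
      (∀ i j, β i (y j) = if i = j then 1 else 0) ∧
      ∀ x, x - χ x • lam - ∑ j, β j x • y j ∈ N := by
  obtain ⟨χ', hχ'1, hχ'N⟩ := Submodule.exists_dual_map_eq_bot_of_notMem hlam inferInstance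
  obtain ⟨χ, hχ1, hχN⟩ : ∃ χ : M →ₗ[k] k, χ lam = 1 ∧ ∀ x ∈ N, χ x = 0 := by
    refine ⟨(χ' lam)⁻¹ • χ', by simp [hχ'1], fun x hx => ?_⟩
    have : χ' x ∈ N.map χ' := Submodule.mem_map_of_mem hx
    rw [hχ'N, Submodule.mem_bot] at this
    simp [this]
  -- A basis of `M ⧸ K` is lifted to `M` and corrected by multiples of `lam` so as to lie in the
  -- kernel of `χ`.
  obtain ⟨K, hK⟩ : ∃ K, K = N ⊔ Submodule.span k {lam} := ⟨_, rfl⟩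
  have hlamK : K.mkQ lam = 0 := by
    rw [← LinearMap.mem_ker, Submodule.ker_mkQ, hK]
    exact Submodule.mem_sup_right (Submodule.mem_span_singleton_self lam)
  have hNK : ∀ x ∈ N, K.mkQ x = 0 := fun x hx => by
    rw [← LinearMap.mem_ker, Submodule.ker_mkQ, hK]
    exact Submodule.mem_sup_left hx
  let b := Module.finBasis k (M ⧸ K)
  choose y hy using fun j => K.mkQ_surjective (b j)
  refine ⟨_, χ, fun j => (b.coord j).comp K.mkQ, fun j => y j - χ (y j) • lam, ?_, hχ1, hχN,
    fun j x hx => by simp only [LinearMap.comp_apply, hNK x hx, map_zero],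
    fun j => by simp only [LinearMap.comp_apply, hlamK, map_zero], fun j => by simp [hχ1],
    fun i j => ?_, fun x => ?_⟩
  · have e1 := K.finrank_quotient_add_finrank
    have e2 := N.finrank_quotient_add_finrank
    have hdisj : N ⊓ Submodule.span k {lam} = ⊥ := by
      rw [eq_bot_iff]
      rintro x ⟨hx1, hx2⟩
      obtain ⟨t, rfl⟩ := Submodule.mem_span_singleton.1 hx2
      have := hχN _ hx1
      rw [map_smul, hχ1, smul_eq_mul, mul_one] at this
      simp [this]
    have h4 := Submodule.finrank_sup_add_finrank_inf_eq N (Submodule.span k {lam})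
    rw [hdisj, finrank_bot, add_zero, finrank_span_singleton
      (fun h : lam = 0 => hlam (h ▸ N.zero_mem)), ← hK] at h4
    omega
  · rw [LinearMap.comp_apply, map_sub, map_smul, hy, hlamK, smul_zero, sub_zero]
    simp [Finsupp.single_apply, eq_comm]
  · set v := x - χ x • lam - ∑ j, (b.coord j).comp K.mkQ x • (y j - χ (y j) • lam) with hv
    have h1 : K.mkQ v = 0 := by
      rw [hv, map_sub, map_sub, map_smul, map_sum, hlamK]
      simp only [map_smul, map_sub, hy, hlamK, smul_zero, sub_zero, LinearMap.comp_apply,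
        Module.Basis.coord_apply]
      rw [b.sum_repr, sub_self]
    have h2 : χ v = 0 := by simp [hv, hχ1]
    rw [← LinearMap.mem_ker, Submodule.ker_mkQ, hK] at h1
    obtain ⟨a, ha, c, hc, hac⟩ := Submodule.mem_sup.1 h1
    obtain ⟨t, rfl⟩ := Submodule.mem_span_singleton.1 hc
    rw [← hac, map_add, hχN a ha, map_smul, hχ1, zero_add, smul_eq_mul, mul_one] at h2
    rw [← hac, h2, zero_smul, add_zero]
    exact ha

lemma exists_isArrangementRing_empty [FiniteDimensional k M] (N : Submodule k M) (lam : M)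
    (ell : ι → M) :
    ∃ (R : CommAlgCat.{u} k) (_ : Algebra.FiniteType k R) (η : M →ₗ[k] R),
      IsArrangementRing N lam ell ∅ R η ∧ affineClass k R = flatClass N lam := by
  by_cases hlam : lam ∈ N
  -- The equations force `0 = 1`: the flat is empty and its coordinate ring is the zero ring.
  · refine ⟨CommAlgCat.of k PUnit, inferInstanceAs (Algebra.FiniteType k PUnit), 0,
      ⟨fun _ _ => rfl, rfl, by simp, fun A _ _ g hN h1 _ => ?_⟩, ?_⟩
    · have h01 : (0 : A) = 1 := by rw [← h1, hN _ hlam]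
      have : Subsingleton A := subsingleton_of_zero_eq_one h01
      exact ⟨AlgHom.ofLinearMap 0 (Subsingleton.elim _ _) fun _ _ => Subsingleton.elim _ _,
        fun x => Subsingleton.elim _ _, fun f _ => AlgHom.ext fun x => Subsingleton.elim _ _⟩
    · rw [flatClass, if_pos hlam]
      exact affineClass_eq_zero (R := PUnit)
  · obtain ⟨m, χ, β, y, hm, hχ1, hχN, hβN, hβ1, hχy, hβy, hdec⟩ := exists_affine_coordinates hlam
    obtain ⟨η, hη⟩ : ∃ η : M →ₗ[k] MvPolynomial (Fin m) k, ∀ x, η x = χ x • 1 +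
        ∑ j, β j x • (MvPolynomial.X j : MvPolynomial (Fin m) k) :=
      ⟨χ.smulRight 1 + ∑ j, (β j).smulRight (MvPolynomial.X j), fun x => by simp⟩
    have hηy : ∀ j, η (y j) = MvPolynomial.X j := fun j => by
      rw [hη, hχy]
      simp [hβy]
    refine ⟨CommAlgCat.of k (MvPolynomial (Fin m) k),
      inferInstanceAs (Algebra.FiniteType k (MvPolynomial (Fin m) k)), η,
      ⟨fun x hx => ?_, ?_, by simp, fun A _ _ g hN h1 _ => ?_⟩, ?_⟩
    · rw [hη, hχN x hx]
      simp [hβN _ x hx]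
    · rw [hη, hχ1]
      simp [hβ1]
    · refine ⟨(MvPolynomial.aeval fun j => g (y j) : MvPolynomial (Fin m) k →ₐ[k] A),
        fun x => ?_, fun f hf => ?_⟩
      · have h2 := hN _ (hdec x)
        simp only [map_sub, sub_sub, sub_eq_zero] at h2
        rw [h2, hη]
        simp only [map_add, map_smul, map_one, map_sum, MvPolynomial.aeval_X, h1]
      · refine MvPolynomial.algHom_ext fun j => ?_
        rw [← hηy j]
        refine (hf _).trans ?_
        rw [hηy, MvPolynomial.aeval_X]
    · rw [flatClass, if_neg hlam, hm, Nat.add_sub_cancel]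
      exact affineClass_mvPolynomial m

/-- The coordinate ring of the complement of an arrangement exists, and its class is obtained from
those of the flats by inclusion and exclusion. -/
theorem exists_isArrangementRing [FiniteDimensional k M] (N : Submodule k M) (lam : M)
    (ell : ι → M) (s : Finset ι) :
    ∃ (R : CommAlgCat.{u} k) (_ : Algebra.FiniteType k R) (η : M →ₗ[k] R),
      IsArrangementRing N lam ell s R η ∧ affineClass k R =
        ∑ I ∈ s.powerset, (-1) ^ I.card * flatClass (N ⊔ Submodule.span k (ell '' I)) lam := by
  classical
  induction s using Finset.induction_on generalizing N with
  | empty =>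
    obtain ⟨R, hR, η, h, hc⟩ := exists_isArrangementRing_empty N lam ell
    exact ⟨R, hR, η, h, by simp [hc]⟩
  | insert i s hi ih =>
    obtain ⟨R, hR, η, h, hc⟩ := ih N
    obtain ⟨R', hR', η', h', hc'⟩ := ih (N ⊔ Submodule.span k {ell i})
    obtain ⟨e⟩ := (h.quotient (ell i)).nonempty_algEquiv h'
    refine ⟨CommAlgCat.of k (Localization.Away (η (ell i))),
      inferInstanceAs (Algebra.FiniteType k (Localization.Away (η (ell i)))), _,
      h.localization i, ?_⟩
    have h1 := affineClass_eq_localization_add_quotient (k := k) (η (ell i))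
    rw [affineClass_congr e, hc, hc', ← sub_eq_iff_eq_add] at h1
    refine h1.symm.trans ?_
    -- The subsets containing `i` account for the hyperplane removed: its equation joins `N` and the
    -- sign changes.
    rw [Finset.sum_powerset_insert hi, sub_eq_add_neg, ← Finset.sum_neg_distrib]
    congr 1
    refine Finset.sum_congr rfl fun I hI => ?_
    have hiI : i ∉ I := fun h => hi (Finset.mem_powerset.1 hI h)
    rw [Finset.card_insert_of_notMem hiI, Finset.coe_insert, Set.image_insert_eq,
      Submodule.span_insert, sup_assoc]
    ring

end Arrangements

/-! ### Triangular systems -/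

section Triangular

lemma Matrix.mulVec_bijective_of_triangular {A ι : Type*} [CommRing A] [Fintype ι] [LinearOrder ι]
    {M : Matrix ι ι A} (h0 : ∀ p q, q < p → M q p = 0) (h1 : ∀ p, IsUnit (M p p)) :
    Function.Bijective M.mulVec := by
  have hdet : IsUnit M.det := by
    rw [Matrix.det_of_isLowerTriangular M fun q p h => h0 p q (OrderDual.toDual_lt_toDual.1 h)]
    exact (IsUnit.prod_univ_iff).2 h1
  have hM : IsUnit M := (Matrix.isUnit_iff_isUnit_det M).2 hdet
  exact ⟨Matrix.mulVec_injective_of_isUnit hM, Matrix.mulVec_surjective_iff_isUnit.2 hM⟩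

/-- A subspace `B` of a space with coordinates indexed by a linear order has a basis in row echelon
form, whose first element may be prescribed. -/
lemma exists_echelon_basis {k T P : Type*} [Field k] [AddCommGroup T] [Module k T]
    [FiniteDimensional k T] [Fintype P] [LinearOrder P] (φ : P → T →ₗ[k] k)
    (hφ : ∀ x, (∀ p, φ p x = 0) → x = 0) (B : Submodule k T) {p₀ : P} (hp₀ : ∀ p, p₀ ≤ p)
    {b₀ : T} (hb₀ : b₀ ∈ B) (hφb₀ : φ p₀ b₀ = 1) :
    ∃ (G : Finset P) (h : P → T), p₀ ∈ G ∧ h p₀ = b₀ ∧ (∀ p ∈ G, h p ∈ B) ∧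
      (∀ p ∈ G, φ p (h p) = 1) ∧ (∀ p ∈ G, ∀ q < p, φ q (h p) = 0) ∧
      B = Submodule.span k (h '' G) ∧ Module.finrank k B = G.card := by
  classical
  -- `G` consists of the pivots, the positions at which some element of `B` has its first non-zero
  -- coordinate.
  let G : Finset P := Finset.univ.filter fun p => ∃ b ∈ B, φ p b = 1 ∧ ∀ q < p, φ q b = 0
  have hG : ∀ p, ∃ b, p ∈ G → b ∈ B ∧ φ p b = 1 ∧ ∀ q < p, φ q b = 0 := by
    intro p
    by_cases hp : p ∈ G
    · obtain ⟨b, hb⟩ := (Finset.mem_filter.1 hp).2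
      exact ⟨b, fun _ => hb⟩
    · exact ⟨0, fun h => absurd h hp⟩
  choose h' hh' using hG
  -- At the least position the condition on earlier coordinates is vacuous, so any vector of `B`
  -- with coordinate `1` there may be used.
  let h : P → T := Function.update h' p₀ b₀
  have hh : ∀ p ∈ G, h p ∈ B ∧ φ p (h p) = 1 ∧ ∀ q < p, φ q (h p) = 0 := by
    intro p hp
    by_cases hpp : p = p₀
    · subst hpp
      simp only [h, Function.update_self]
      exact ⟨hb₀, hφb₀, fun q hq => absurd (hp₀ q) (not_le.2 hq)⟩
    · simp only [h, Function.update_of_ne hpp]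
      exact hh' p hp
  have hp₀G : p₀ ∈ G := Finset.mem_filter.2 ⟨Finset.mem_univ _, b₀, hb₀, hφb₀,
    fun q hq => absurd (hp₀ q) (not_le.2 hq)⟩
  -- The first non-zero coordinate of an element of `B` sits at a pivot, so the pivot coordinates
  -- separate `B` and `dim B ≤ #G`. The reverse inequality comes from the triangular shape of the `h
  -- p`.
  have hinj : Function.Injective
      ((LinearMap.pi fun g : G => φ g).comp B.subtype) := by
    rw [← LinearMap.ker_eq_bot, eq_bot_iff]
    rintro ⟨x, hx⟩ hx0
    rw [Submodule.mem_bot]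
    by_contra hne
    have hne' : (Finset.univ.filter fun p => φ p x ≠ 0).Nonempty := by
      by_contra hemp
      rw [Finset.not_nonempty_iff_eq_empty, Finset.filter_eq_empty_iff] at hemp
      exact hne (Subtype.ext (hφ x fun p => not_not.1 (hemp (Finset.mem_univ p))))
    set p := (Finset.univ.filter fun p => φ p x ≠ 0).min' hne' with hp
    have hpx : φ p x ≠ 0 := (Finset.mem_filter.1 (Finset.min'_mem _ hne')).2
    have hlt : ∀ q < p, φ q x = 0 := fun q hq => by
      by_contra hq0
      exact absurd (Finset.min'_le _ q (Finset.mem_filter.2 ⟨Finset.mem_univ q, hq0⟩))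
        (not_le.2 hq)
    have hpG : p ∈ G := Finset.mem_filter.2 ⟨Finset.mem_univ _, (φ p x)⁻¹ • x,
      B.smul_mem _ hx, by simp [hpx], fun q hq => by simp [hlt q hq]⟩
    exact hpx (congrFun hx0 ⟨p, hpG⟩)
  have hle1 : Module.finrank k B ≤ G.card := by
    have := LinearMap.finrank_le_finrank_of_injective hinj
    simpa using this
  have hli : LinearIndependent k fun g : G => h g := by
    rw [Fintype.linearIndependent_iff]
    intro a ha
    have hM := Matrix.mulVec_bijective_of_triangular
      (M := Matrix.of fun q p : G => φ q (h p)) (fun p q hqp => (hh p p.2).2.2 q hqp)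
      (fun p => by simp [(hh p p.2).2.1])
    have : a = 0 := hM.1 (by
      rw [Matrix.mulVec_zero]
      funext q
      have := congrArg (φ q) ha
      rw [map_sum, map_zero] at this
      simpa [Matrix.mulVec, dotProduct, mul_comm] using this)
    exact fun i => congrFun this i
  have hspan : Submodule.span k (Set.range fun g : G => h g) ≤ B :=
    Submodule.span_le.2 (by rintro _ ⟨g, rfl⟩; exact (hh g g.2).1)
  have hcard := finrank_span_eq_card hli
  rw [Fintype.card_coe] at hcard
  have himg : h '' G = Set.range fun g : G => h g := by
    ext x; simp
  have hle2 := Submodule.finrank_mono hspan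
  refine ⟨G, h, hp₀G, Function.update_self _ _ _, fun p hp => (hh p hp).1,
    fun p hp => (hh p hp).2.1, fun p hp => (hh p hp).2.2, ?_, by omega⟩
  rw [himg]
  exact (Submodule.eq_of_le_of_finrank_eq hspan (by omega)).symm

end Triangular

/-! ### Points of a vector space with values in an algebra -/

section DualEval

variable {k : Type u} [Field k] (A : Type u) [CommRing A] [Algebra k A] {T : Type u} [CommRing T]
  [Algebra k T]

/-- The `A`-linear extension of a linear form on `T`. -/
def dualEval (f : T →ₗ[k] k) : A ⊗[k] T →ₗ[A] A :=
  (TensorProduct.AlgebraTensorModule.rid k A A).toLinearMap.comp (f.baseChange A)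

variable {A}

@[simp] lemma dualEval_tmul (f : T →ₗ[k] k) (a : A) (t : T) :
    dualEval A f (a ⊗ₜ t) = f t • a := by
  simp [dualEval]

lemma dualEval_add (f g : T →ₗ[k] k) (x : A ⊗[k] T) :
    dualEval A (f + g) x = dualEval A f x + dualEval A g x := by
  simp [dualEval, LinearMap.baseChange_add]

lemma dualEval_smul (c : k) (f : T →ₗ[k] k) (x : A ⊗[k] T) :
    dualEval A (c • f) x = c • dualEval A f x := by
  induction x with
  | zero => simp
  | tmul a t => simp [mul_smul]
  | add x y hx hy => rw [map_add, map_add, hx, hy, smul_add]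

/-- The linear map `f ↦ f_A(x)` given by a point `x`. -/
def pointFunctional (x : A ⊗[k] T) : Module.Dual k T →ₗ[k] A where
  toFun f := dualEval A f x
  map_add' f g := dualEval_add f g x
  map_smul' c f := dualEval_smul c f x

lemma pointFunctional_apply (x : A ⊗[k] T) (f : Module.Dual k T) :
    pointFunctional x f = dualEval A f x := rfl

lemma dualEval_mul_tmul (f : T →ₗ[k] k) (x : A ⊗[k] T) (a : A) (t : T) :
    dualEval A f (x * a ⊗ₜ t) = a * dualEval A (f.comp (LinearMap.mulLeft k t)) x := by
  induction x with
  | zero => simp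
  | tmul b s => simp [mul_comm]
  | add x y hx hy => rw [add_mul, map_add, map_add, hx, hy, mul_add]

lemma dualEval_baseChange {B : Type u} [CommRing B] [Algebra k B] (g : A →ₐ[k] B) (f : T →ₗ[k] k)
    (x : A ⊗[k] T) :
    dualEval B f (Algebra.TensorProduct.map g (AlgHom.id k T) x) = g (dualEval A f x) := by
  induction x with
  | zero => simp
  | tmul a t => simp
  | add x y hx hy => rw [map_add, map_add, map_add, hx, hy, map_add]

/-- The `A`-linear extension of a character of `T` is multiplicative. -/
lemma dualEval_mul (ℓ : T →ₐ[k] k) (x y : A ⊗[k] T) :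
    dualEval A ℓ.toLinearMap (x * y) = dualEval A ℓ.toLinearMap x * dualEval A ℓ.toLinearMap y := by
  induction y with
  | zero => simp
  | tmul a t =>
    rw [dualEval_mul_tmul]
    have : ℓ.toLinearMap.comp (LinearMap.mulLeft k t) = ℓ t • ℓ.toLinearMap := by
      ext s; simp
    rw [this, dualEval_smul, dualEval_tmul]
    simp [mul_comm]
  | add x y hx hy => rw [mul_add, map_add, map_add, hx, hy, mul_add]

lemma dualEval_one (ℓ : T →ₐ[k] k) : dualEval A ℓ.toLinearMap 1 = 1 := by
  rw [Algebra.TensorProduct.one_def, dualEval_tmul]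
  simp

lemma isUnit_dualEval (ℓ : T →ₐ[k] k) {x : A ⊗[k] T} (hx : IsUnit x) :
    IsUnit (dualEval A ℓ.toLinearMap x) := by
  obtain ⟨u, rfl⟩ := hx
  refine IsUnit.of_mul_eq_one (dualEval A ℓ.toLinearMap (u⁻¹ : (A ⊗[k] T)ˣ)) ?_
  rw [← dualEval_mul, Units.mul_inv, dualEval_one]

lemma eq_sum_dualEval {ι : Type*} [Fintype ι] (b : Module.Basis ι k T) (x : A ⊗[k] T) :
    x = ∑ i, dualEval A (b.coord i) x ⊗ₜ b i := by
  induction x with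
  | zero => simp
  | tmul a t =>
    simp only [dualEval_tmul, Module.Basis.coord_apply, TensorProduct.smul_tmul]
    rw [← TensorProduct.tmul_sum, b.sum_repr]
  | add x y hx hy =>
    conv_lhs => rw [hx, hy]
    simp [TensorProduct.add_tmul, Finset.sum_add_distrib]

lemma dualEval_eq_zero_of_mem_range {B : Subalgebra k T} {y : A ⊗[k] T}
    (hy : y ∈ (Algebra.TensorProduct.map (AlgHom.id k A) B.val).range) (f : T →ₗ[k] k)
    (hf : ∀ b ∈ B, f b = 0) : dualEval A f y = 0 := by
  obtain ⟨z, rfl⟩ := hy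
  induction z with
  | zero => simp
  | tmul a t => simp [hf t t.2]
  | add x y hx hy => simp only [map_add] at hx hy ⊢; rw [hx, hy, add_zero]

variable [FiniteDimensional k T]

lemma eq_of_dualEval_eq {x y : A ⊗[k] T} (h : ∀ f : T →ₗ[k] k, dualEval A f x = dualEval A f y) :
    x = y := by
  rw [eq_sum_dualEval (Module.finBasis k T) x, eq_sum_dualEval (Module.finBasis k T) y]
  exact Finset.sum_congr rfl fun i _ => by rw [h]

/-- For `T` of finite dimension, `A`-points of `T` are the same as linear maps from the dual of `T`
to `A`. This matches points of `𝓘_n` with the universal property of an arrangement in the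
coordinates `M = T*`. -/
lemma exists_pointFunctional_eq (g : Module.Dual k T →ₗ[k] A) :
    ∃ x : A ⊗[k] T, pointFunctional x = g := by
  let b := Module.finBasis k T
  refine ⟨∑ i, g (b.coord i) ⊗ₜ b i, LinearMap.ext fun f => ?_⟩
  have hf : f = ∑ i, f (b i) • b.coord i := by
    refine b.ext fun j => ?_
    simp
  rw [pointFunctional_apply, map_sum]
  conv_rhs => rw [hf, map_sum]
  exact Finset.sum_congr rfl fun i _ => by rw [dualEval_tmul, map_smul]

/-- A point lies in a subspace as soon as the linear forms vanishing on the subspace vanish at the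
point. -/
lemma exists_of_dualEval_eq_zero (W : Submodule k T) {y : A ⊗[k] T}
    (h : ∀ f : T →ₗ[k] k, (∀ b ∈ W, f b = 0) → dualEval A f y = 0) :
    ∃ z : A ⊗[k] W, TensorProduct.map LinearMap.id W.subtype z = y := by
  -- With a projection `ρ` onto `W`, every form `f - f ∘ ρ` vanishes on `W`; applied to `y`, these
  -- forms show that `y` equals its projection.
  obtain ⟨π, hπ⟩ := LinearMap.exists_leftInverse_of_injective W.subtype (Submodule.ker_subtype _)
  set ρ : T →ₗ[k] T := W.subtype.comp π with hρ
  have hρB : ∀ b ∈ W, ρ b = b := fun b hb =>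
    congrArg Subtype.val (DFunLike.congr_fun hπ (⟨b, hb⟩ : W))
  refine ⟨TensorProduct.map LinearMap.id π y, ?_⟩
  have hcomp : TensorProduct.map (LinearMap.id (M := A)) W.subtype
      (TensorProduct.map LinearMap.id π y) = TensorProduct.map LinearMap.id ρ y := by
    rw [← LinearMap.comp_apply, ← TensorProduct.map_comp, LinearMap.id_comp]
  rw [hcomp]
  refine eq_of_dualEval_eq fun f => ?_
  have h1 := h (f - f.comp ρ) fun b hb => by simp [hρB b hb]
  have h2 : ∀ z : A ⊗[k] T, dualEval A (f - f.comp ρ) z =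
      dualEval A f z - dualEval A f (TensorProduct.map LinearMap.id ρ z) := by
    intro z
    induction z with
    | zero => simp
    | tmul a t => simp [sub_smul]
    | add x y hx hy => simp only [map_add, hx, hy]; ring
  rw [h2, sub_eq_zero] at h1
  exact h1.symm

lemma mem_range_of_dualEval_eq_zero (B : Subalgebra k T) {y : A ⊗[k] T}
    (h : ∀ f : T →ₗ[k] k, (∀ b ∈ B, f b = 0) → dualEval A f y = 0) :
    y ∈ (Algebra.TensorProduct.map (AlgHom.id k A) B.val).range := by
  obtain ⟨z, rfl⟩ := exists_of_dualEval_eq_zero (Subalgebra.toSubmodule B) h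
  exact ⟨z, rfl⟩

end DualEval

/-! ### Slices for the action of the units of a subalgebra -/

section Slice

variable {k : Type u} [Field k] {T : Type u} [CommRing T] [Algebra k T] {d : ℕ}
  {ι : Type*} [Fintype ι] [LinearOrder ι]

/-- A basis `h` of the subalgebra `B` of `T` and linear forms `φ` on `T` that are triangular for
the multiplication by elements of `T`, up to the characters `ℓ` of `T`. -/
structure IsSlice (B : Subalgebra k T) (ℓ : Fin d → T →ₐ[k] k) (br : ι → Fin d) (h : ι → T)
    (φ : ι → T →ₗ[k] k) (p₀ : ι) : Prop where
  isNilpotent : ∀ x : T, (∀ i, ℓ i x = 0) → IsNilpotent x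
  span_eq : Subalgebra.toSubmodule B = Submodule.span k (Set.range h)
  bot_le : ∀ p, p₀ ≤ p
  h_bot : h p₀ = 1
  apply_of_lt : ∀ p q, q < p → ∀ x, φ q (h p * x) = 0
  apply_self : ∀ p x, φ p (h p * x) = ℓ (br p) x
  char_h : ∀ p, p ≠ p₀ → ∀ i, ℓ i (h p) = 0

namespace IsSlice

variable {B : Subalgebra k T} {ℓ : Fin d → T →ₐ[k] k} {br : ι → Fin d} {h : ι → T}
  {φ : ι → T →ₗ[k] k} {p₀ : ι} {A : Type u} [CommRing A] [Algebra k A]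

omit [Fintype ι] in
lemma h_mem (hs : IsSlice B ℓ br h φ p₀) (p : ι) : h p ∈ B := by
  rw [← Subalgebra.mem_toSubmodule, hs.span_eq]
  exact Submodule.subset_span ⟨p, rfl⟩

omit [Fintype ι] in
lemma φ_bot (hs : IsSlice B ℓ br h φ p₀) : φ p₀ = (ℓ (br p₀)).toLinearMap := by
  ext x
  have := hs.apply_self p₀ x
  rwa [hs.h_bot, one_mul] at this

/-- The matrix of `a ↦ (φ_q(μ ∑ a_p h_p))_q`. -/
def sliceMatrix (A : Type u) [CommRing A] [Algebra k A] (h : ι → T) (φ : ι → T →ₗ[k] k)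
    (x : A ⊗[k] T) : Matrix ι ι A :=
  Matrix.of fun q p => dualEval A ((φ q).comp (LinearMap.mulLeft k (h p))) x

omit [LinearOrder ι] in
lemma dualEval_mul_sum (h : ι → T) (φ : ι → T →ₗ[k] k) (x : A ⊗[k] T) (a : ι → A) (q : ι) :
    dualEval A (φ q) (x * ∑ p, a p ⊗ₜ h p) = (sliceMatrix A h φ x).mulVec a q := by
  rw [Finset.mul_sum, map_sum]
  exact Finset.sum_congr rfl fun p _ => by
    rw [dualEval_mul_tmul, mul_comm]; rfl

omit [Fintype ι] in
lemma sliceMatrix_of_lt (hs : IsSlice B ℓ br h φ p₀) (x : A ⊗[k] T) {p q : ι} (hqp : q < p) :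
    sliceMatrix A h φ x q p = 0 := by
  have h0 : (φ q).comp (LinearMap.mulLeft k (h p)) = (0 : k) • (φ q) := by
    ext y; simpa using hs.apply_of_lt p q hqp y
  rw [sliceMatrix, Matrix.of_apply, h0, dualEval_smul, zero_smul]

omit [Fintype ι] in
lemma sliceMatrix_self (hs : IsSlice B ℓ br h φ p₀) (x : A ⊗[k] T) (p : ι) :
    sliceMatrix A h φ x p p = dualEval A (ℓ (br p)).toLinearMap x := by
  have h0 : (φ p).comp (LinearMap.mulLeft k (h p)) = (ℓ (br p)).toLinearMap :=
    LinearMap.ext fun y => hs.apply_self p y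
  rw [sliceMatrix, Matrix.of_apply, h0]

/-- The matrix is triangular with values of the characters on the diagonal, so moving `x` into the
slice amounts to solving a triangular system, over any `A`. -/
lemma bijective_sliceMatrix (hs : IsSlice B ℓ br h φ p₀) {x : A ⊗[k] T}
    (hx : ∀ i, IsUnit (dualEval A (ℓ i).toLinearMap x)) :
    Function.Bijective (sliceMatrix A h φ x).mulVec :=
  Matrix.mulVec_bijective_of_triangular (fun _ _ hqp => hs.sliceMatrix_of_lt x hqp)
    fun p => by rw [hs.sliceMatrix_self]; exact hx _

lemma exists_eq_sum (hs : IsSlice B ℓ br h φ p₀) {y : A ⊗[k] T}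
    (hy : y ∈ (Algebra.TensorProduct.map (AlgHom.id k A) B.val).range) :
    ∃ a : ι → A, y = ∑ p, a p ⊗ₜ h p := by
  obtain ⟨z, rfl⟩ := hy
  induction z with
  | zero => exact ⟨0, by simp⟩
  | tmul a t =>
    have ht : (t : T) ∈ Submodule.span k (Set.range h) := by
      rw [← hs.span_eq]; exact t.2
    obtain ⟨c, hc⟩ := (Submodule.mem_span_range_iff_exists_fun k).1 ht
    refine ⟨fun p => c p • a, ?_⟩
    change a ⊗ₜ (t : T) = _
    rw [← hc, TensorProduct.tmul_sum]
    simp only [TensorProduct.smul_tmul]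
  | add x y hx hy =>
    obtain ⟨a, ha⟩ := hx
    obtain ⟨b, hb⟩ := hy
    refine ⟨a + b, ?_⟩
    change Algebra.TensorProduct.map (AlgHom.id k A) B.val (x + y) = _
    rw [map_add]
    refine (congrArg₂ (· + ·) ha hb).trans ?_
    simp [TensorProduct.add_tmul, Finset.sum_add_distrib]

/-- The slice meets each orbit in at most one point. -/
lemma eq_of_dualEval_eq (hs : IsSlice B ℓ br h φ p₀) {x : A ⊗[k] T} (hx : IsUnit x)
    {y y' : A ⊗[k] T} (hy : y ∈ (Algebra.TensorProduct.map (AlgHom.id k A) B.val).range)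
    (hy' : y' ∈ (Algebra.TensorProduct.map (AlgHom.id k A) B.val).range)
    (hyy' : ∀ q, dualEval A (φ q) (x * y) = dualEval A (φ q) (x * y')) : y = y' := by
  obtain ⟨a, rfl⟩ := hs.exists_eq_sum hy
  obtain ⟨a', rfl⟩ := hs.exists_eq_sum hy'
  have : a = a' := (hs.bijective_sliceMatrix fun i => isUnit_dualEval (ℓ i) hx).1 (by
    funext q
    rw [← dualEval_mul_sum, ← dualEval_mul_sum, hyy'])
  rw [this]

/-- The slice meets each orbit. -/
lemma exists_unit (hs : IsSlice B ℓ br h φ p₀) {x : A ⊗[k] T} (hx : IsUnit x) :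
    ∃ u : (A ⊗[k] B)ˣ, ∀ q, dualEval A (φ q)
      (x * Algebra.TensorProduct.map (AlgHom.id k A) B.val u) = if q = p₀ then 1 else 0 := by
  classical
  have hℓ := fun i => isUnit_dualEval (A := A) (ℓ i) hx
  obtain ⟨a, ha⟩ := (hs.bijective_sliceMatrix hℓ).2 fun q => if q = p₀ then 1 else 0
  set w : A ⊗[k] B := ∑ p, a p ⊗ₜ (⟨h p, hs.h_mem p⟩ : B) with hw
  have hww : Algebra.TensorProduct.map (AlgHom.id k A) B.val w = ∑ p, a p ⊗ₜ h p := by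
    simp [hw]
  -- The row of the least index has a single non-zero entry and reads `ℓ(x) a_{p₀} = 1`.
  have ha0 : IsUnit (a p₀) := by
    have h1 := congrFun ha p₀
    rw [if_pos rfl, Matrix.mulVec, dotProduct, Finset.sum_eq_single p₀] at h1
    · exact IsUnit.of_mul_eq_one_right _ h1
    · intro p _ hp
      rw [hs.sliceMatrix_of_lt x (lt_of_le_of_ne (hs.bot_le p) (Ne.symm hp)), zero_mul]
    · simp
  -- Since `h p₀ = 1` and the other `h p` are killed by all characters, `w` is the unit `a p₀` plus
  -- a nilpotent element.
  have hwu : IsUnit w := by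
    rw [hw, ← Finset.add_sum_erase _ _ (Finset.mem_univ p₀), add_comm]
    have hnil : IsNilpotent (∑ p ∈ Finset.univ.erase p₀, a p ⊗ₜ[k] (⟨h p, hs.h_mem p⟩ : B)) := by
      refine isNilpotent_sum fun p hp => ?_
      obtain ⟨N, hN⟩ := hs.isNilpotent (h p) (hs.char_h p (Finset.ne_of_mem_erase hp))
      refine ⟨N, ?_⟩
      have : (⟨h p, hs.h_mem p⟩ : B) ^ N = 0 := Subtype.ext hN
      rw [Algebra.TensorProduct.tmul_pow, this, TensorProduct.tmul_zero]
    refine hnil.isUnit_add_right_of_commute ?_ (Commute.all _ _)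
    have h1 : (⟨h p₀, hs.h_mem p₀⟩ : B) = 1 := Subtype.ext hs.h_bot
    rw [h1]
    exact ha0.map (Algebra.TensorProduct.includeLeft : A →ₐ[k] A ⊗[k] B)
  obtain ⟨u, hu⟩ := hwu
  refine ⟨u, fun q => ?_⟩
  rw [hu, hww, dualEval_mul_sum, ha]

variable [FiniteDimensional k T]

-- The forms vanishing on the common kernel `W` of the characters are combinations of the
-- characters. So `x` comes from `A ⊗ W`, where every pure tensor is nilpotent.
omit [Fintype ι] in
lemma isNilpotent_of_dualEval (hs : IsSlice B ℓ br h φ p₀) {x : A ⊗[k] T}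
    (hx : ∀ i, dualEval A (ℓ i).toLinearMap x = 0) : IsNilpotent x := by
  let W : Submodule k T := ⨅ i, LinearMap.ker (ℓ i).toLinearMap
  obtain ⟨z, rfl⟩ := exists_of_dualEval_eq_zero W (y := x) fun f hf => by
    have h1 : f ∈ Submodule.span k (Set.range fun i => (ℓ i).toLinearMap) :=
      mem_span_of_iInf_ker_le_ker fun y hy => hf y hy
    obtain ⟨c, rfl⟩ := (Submodule.mem_span_range_iff_exists_fun k).1 h1
    rw [← pointFunctional_apply, map_sum]
    refine Finset.sum_eq_zero fun i _ => ?_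
    rw [map_smul, pointFunctional_apply, hx, smul_zero]
  clear hx
  induction z with
  | zero => rw [map_zero]; exact IsNilpotent.zero
  | tmul a t =>
    obtain ⟨N, hN⟩ := hs.isNilpotent t fun i => by
      have := (Submodule.mem_iInf _).1 t.2 i
      exact this
    refine ⟨N, ?_⟩
    rw [TensorProduct.map_tmul, Algebra.TensorProduct.tmul_pow, Submodule.subtype_apply, hN,
      TensorProduct.tmul_zero]
  | add x y hx hy => rw [map_add]; exact (Commute.all _ _).isNilpotent_add hx hy

omit [Fintype ι] in
/-- Units are detected by the characters. -/
lemma isUnit_of_dualEval (hs : IsSlice B ℓ br h φ p₀) {x : A ⊗[k] T}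
    (hx : ∀ i, IsUnit (dualEval A (ℓ i).toLinearMap x)) : IsUnit x := by
  let a : Fin d → A ⊗[k] T := fun i => (dualEval A (ℓ i).toLinearMap x) ⊗ₜ 1
  -- As in the Cayley-Hamilton theorem, for `p = ∏ (X - ℓ_i(x))` the element `p(x)` is killed by all
  -- characters, hence nilpotent, while `p(0)` is a unit. So `x` divides the unit `p(x) - p(0)`.
  let p : Polynomial (A ⊗[k] T) := ∏ i, (Polynomial.X - Polynomial.C (a i))
  have ha : ∀ i, IsUnit (a i) := fun i =>
    (hx i).map (Algebra.TensorProduct.includeLeft : A →ₐ[k] A ⊗[k] T)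
  have hnil : IsNilpotent (p.eval x) := by
    refine hs.isNilpotent_of_dualEval fun i => ?_
    rw [Polynomial.eval_prod, ← Finset.mul_prod_erase _ _ (Finset.mem_univ i), dualEval_mul]
    simp [a]
  have hu0 : IsUnit (p.eval 0) := by
    rw [Polynomial.eval_prod]
    refine IsUnit.prod_univ_iff.2 fun i => ?_
    simpa using (ha i)
  have h1 := Polynomial.sub_dvd_eval_sub x 0 p
  rw [sub_zero] at h1
  refine isUnit_of_dvd_unit h1 ?_
  rw [sub_eq_add_neg, add_comm]
  exact hnil.isUnit_add_left_of_commute hu0.neg (Commute.all _ _)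

end IsSlice

end Slice

/-! ### The coordinate rings of the varieties of principal ideals -/

section CoordinateRing

variable {k : Type u} [Field k] {d : ℕ} (O : Subalgebra k (Fin d → k⟦X⟧))

/-- The class of `t^n` in `Õ / 𝓕`. -/
abbrev truncatedPow (n : Fin d → ℕ) : TruncatedNormalization O :=
  Ideal.Quotient.mk (conductorIdeal O) (tPow k n)

/-- The linear equations of the slice of `𝓘_n`. -/
def sliceRelations (n : Fin d → ℕ) {ι : Type*} (φ : ι → TruncatedNormalization O →ₗ[k] k)
    (p₀ : ι) : Submodule k (Module.Dual k (TruncatedNormalization O)) :=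
  Submodule.span k ({g | ∃ f : TruncatedNormalization O →ₗ[k] k, (∀ b ∈ truncatedRing O, f b = 0) ∧
    g = f.comp (LinearMap.mulLeft k (truncatedPow O n))} ∪ {g | ∃ q, q ≠ p₀ ∧ g = φ q})

variable {O} {A : Type u} [CommRing A] [Algebra k A]

lemma mk_mul_truncatedUnit (μ : (A ⊗[k] TruncatedNormalization O)ˣ)
    (u : (A ⊗[k] truncatedRing O)ˣ) :
    (QuotientGroup.mk (μ * Units.map (truncatedInclusion O A).toRingHom.toMonoidHom u) :
      JacobianPoints O A) = QuotientGroup.mk μ :=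
  QuotientGroup.mk_mul_of_mem μ ⟨u, rfl⟩

lemma exists_of_mk_eq {μ μ' : (A ⊗[k] TruncatedNormalization O)ˣ}
    (h : (QuotientGroup.mk μ : JacobianPoints O A) = QuotientGroup.mk μ') :
    ∃ u : (A ⊗[k] truncatedRing O)ˣ,
      (μ' : A ⊗[k] TruncatedNormalization O) = μ * truncatedInclusion O A u := by
  obtain ⟨u, hu⟩ := QuotientGroup.eq.1 h
  refine ⟨u, ?_⟩
  have h1 : μ' = μ * Units.map (truncatedInclusion O A).toRingHom.toMonoidHom u := by
    rw [hu, mul_inv_cancel_left]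
  exact congrArg Units.val h1

/-- The condition does not depend on the representative, since two of them differ by a unit of `O`.
-/
lemma mem_principalIdealLocus_mk {n : Fin d → ℕ} {μ : (A ⊗[k] TruncatedNormalization O)ˣ} :
    (QuotientGroup.mk μ : JacobianPoints O A) ∈ principalIdealLocus O n A ↔
      (1 ⊗ₜ[k] truncatedPow O n) * (μ : A ⊗[k] TruncatedNormalization O) ∈
        (truncatedInclusion O A).range := by
  constructor
  · rintro ⟨μ', hμ', hmem⟩
    obtain ⟨u, hu⟩ := exists_of_mk_eq hμ'
    have e : (1 ⊗ₜ[k] truncatedPow O n) * (μ : A ⊗[k] TruncatedNormalization O) =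
        ((1 ⊗ₜ[k] truncatedPow O n) * (μ' : A ⊗[k] TruncatedNormalization O)) *
          truncatedInclusion O A u := by
      rw [hu]; exact (mul_assoc (1 ⊗ₜ[k] truncatedPow O n : A ⊗[k] TruncatedNormalization O) _ _).symm
    rw [e]
    exact Subalgebra.mul_mem _ hmem ⟨_, rfl⟩
  · exact fun h => ⟨μ, rfl, h⟩

variable {ι : Type*} [Fintype ι] [LinearOrder ι]
  {ℓ : Fin d → TruncatedNormalization O →ₐ[k] k} {br : ι → Fin d}
  {h : ι → TruncatedNormalization O} {φ : ι → TruncatedNormalization O →ₗ[k] k} {p₀ : ι}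

/-- With `IsSlice.eq_of_mk_eq`, the slice contains exactly one representative of each `A`-point of
`𝒥`, for every `A`. -/
lemma IsSlice.exists_mk_eq (hs : IsSlice (truncatedRing O) ℓ br h φ p₀) (x : JacobianPoints O A) :
    ∃ μ : (A ⊗[k] TruncatedNormalization O)ˣ, (QuotientGroup.mk μ : JacobianPoints O A) = x ∧
      ∀ q, dualEval A (φ q) (μ : A ⊗[k] TruncatedNormalization O) = if q = p₀ then 1 else 0 := by
  obtain ⟨μ, rfl⟩ := QuotientGroup.mk_surjective x
  obtain ⟨u, hu⟩ := hs.exists_unit μ.isUnit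
  exact ⟨_, mk_mul_truncatedUnit μ u, hu⟩

lemma IsSlice.eq_of_mk_eq (hs : IsSlice (truncatedRing O) ℓ br h φ p₀)
    {μ μ' : (A ⊗[k] TruncatedNormalization O)ˣ}
    (hmk : (QuotientGroup.mk μ : JacobianPoints O A) = QuotientGroup.mk μ')
    (hμ : ∀ q, dualEval A (φ q) (μ : A ⊗[k] TruncatedNormalization O) = if q = p₀ then 1 else 0)
    (hμ' : ∀ q, dualEval A (φ q) (μ' : A ⊗[k] TruncatedNormalization O) =
      if q = p₀ then 1 else 0) : μ = μ' := by
  obtain ⟨u, hu⟩ := exists_of_mk_eq hmk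
  have h1 := hs.eq_of_dualEval_eq μ.isUnit (y := 1) (y' := truncatedInclusion O A u)
    (Subalgebra.one_mem _) ⟨_, rfl⟩ fun q => by rw [mul_one, ← hu, hμ, hμ']
  ext
  rw [hu, ← h1]
  exact (mul_one (μ : A ⊗[k] TruncatedNormalization O)).symm

lemma dualEval_mul_truncatedPow (n : Fin d → ℕ) (f : TruncatedNormalization O →ₗ[k] k)
    (x : A ⊗[k] TruncatedNormalization O) :
    dualEval A f ((1 ⊗ₜ[k] truncatedPow O n) * x) =
      dualEval A (f.comp (LinearMap.mulLeft k (truncatedPow O n))) x := by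
  have e : (1 ⊗ₜ[k] truncatedPow O n) * x = x * (1 ⊗ₜ[k] truncatedPow O n) :=
    mul_comm (1 ⊗ₜ[k] truncatedPow O n : A ⊗[k] TruncatedNormalization O) x
  rw [e]
  exact (dualEval_mul_tmul f x 1 _).trans (one_mul _)

omit [Fintype ι] [LinearOrder ι] in
lemma pointFunctional_eq_zero_iff [FiniteDimensional k (TruncatedNormalization O)] {n : Fin d → ℕ}
    {x : A ⊗[k] TruncatedNormalization O} :
    (∀ g ∈ sliceRelations O n φ p₀, pointFunctional x g = 0) ↔
      (1 ⊗ₜ[k] truncatedPow O n) * x ∈ (truncatedInclusion O A).range ∧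
        ∀ q, q ≠ p₀ → dualEval A (φ q) x = 0 := by
  constructor
  · intro hx
    refine ⟨mem_range_of_dualEval_eq_zero _ fun f hf => ?_, fun q hq => ?_⟩
    · rw [dualEval_mul_truncatedPow]
      exact hx _ (Submodule.subset_span (Or.inl ⟨f, hf, rfl⟩))
    · exact hx _ (Submodule.subset_span (Or.inr ⟨q, hq, rfl⟩))
  · rintro ⟨h1, h2⟩ g hg
    induction hg using Submodule.span_induction with
    | mem g hg =>
      rcases hg with ⟨f, hf, rfl⟩ | ⟨q, hq, rfl⟩
      · rw [pointFunctional_apply, ← dualEval_mul_truncatedPow]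
        exact dualEval_eq_zero_of_mem_range h1 f hf
      · exact h2 q hq
    | zero => exact map_zero _
    | add g g' _ _ hg hg' => rw [map_add, hg, hg', add_zero]
    | smul c g _ hg => rw [map_smul, hg, smul_zero]

/-- The complement of the arrangement in the slice represents `𝓘_n`. -/
theorem IsSlice.exists_isCoordinateRing [FiniteDimensional k (TruncatedNormalization O)]
    (hs : IsSlice (truncatedRing O) ℓ br h φ p₀) {n : Fin d → ℕ} {R : Type u} [CommRing R]
    [Algebra k R] {η : Module.Dual k (TruncatedNormalization O) →ₗ[k] R}
    (hR : IsArrangementRing (sliceRelations O n φ p₀) (φ p₀) (fun i => (ℓ i).toLinearMap)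
      Finset.univ R η) : ∃ ξ, IsCoordinateRing O n R ξ := by
  -- The universal point of the arrangement is read as an `R`-point of `Õ/𝓕`. The characters are
  -- invertible on it, so it is a unit, and its class is the universal point of `𝓘_n`.
  obtain ⟨x, hx⟩ := exists_pointFunctional_eq η
  have hxη : ∀ f, dualEval R f x = η f := fun f => DFunLike.congr_fun hx f
  have hxu : IsUnit x := hs.isUnit_of_dualEval fun i => by
    rw [hxη]; exact hR.unit i (Finset.mem_univ i)
  obtain ⟨μ, rfl⟩ := hxu
  have hμ := pointFunctional_eq_zero_iff (x := (μ : R ⊗[k] TruncatedNormalization O)).1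
    (fun g hg => (hxη g).trans (hR.vanish g hg))
  have hμq : ∀ q, dualEval R (φ q) (μ : R ⊗[k] TruncatedNormalization O) =
      if q = p₀ then 1 else 0 := by
    intro q
    by_cases hq : q = p₀
    · rw [if_pos hq, hq, hxη, hR.one]
    · rw [if_neg hq, hμ.2 q hq]
  refine ⟨QuotientGroup.mk μ, mem_principalIdealLocus_mk.2 hμ.1, fun A _ _ y hy => ?_⟩
  obtain ⟨ν, rfl, hν⟩ := hs.exists_mk_eq y
  have hνmem := mem_principalIdealLocus_mk.1 hy
  have hbase : ∀ (f : R →ₐ[k] A) (g : Module.Dual k (TruncatedNormalization O)),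
      dualEval A g (unitsBaseChange O f μ : (A ⊗[k] TruncatedNormalization O)ˣ) = f (η g) :=
    fun f g => (dualEval_baseChange f g _).trans (congrArg f (hxη g))
  obtain ⟨f, hf, hf'⟩ := hR.desc A (pointFunctional (ν : A ⊗[k] TruncatedNormalization O))
    (pointFunctional_eq_zero_iff.2 ⟨hνmem, fun q hq => by rw [hν, if_neg hq]⟩)
    (by rw [pointFunctional_apply, hν, if_pos rfl])
    (fun i _ => isUnit_dualEval (ℓ i) ν.isUnit)
  refine ⟨f, ?_, fun f' hf'' => hf' f' fun g => ?_⟩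
  · have h1 : unitsBaseChange O f μ = ν := by
      ext
      exact _root_.eq_of_dualEval_eq fun g => (hbase f g).trans (hf g)
    change (QuotientGroup.mk (unitsBaseChange O f μ) : JacobianPoints O A) = QuotientGroup.mk ν
    rw [h1]
  -- Base change keeps `μ` in the slice, so any `f'` inducing the class of `ν` takes `μ` to `ν`
  -- itself, which determines `f'`.
  · have h1 : (QuotientGroup.mk (unitsBaseChange O f' μ) : JacobianPoints O A) =
      QuotientGroup.mk ν := hf''
    have h2 := hs.eq_of_mk_eq h1 (fun q => by
      rw [hbase, ← hxη, hμq]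
      split_ifs
      · exact map_one f'
      · exact map_zero f') hν
    rw [← hbase, h2]
    rfl

/-- The class of `𝓘_n` can be computed from any coordinate ring. -/
lemma principalIdealClass_eq {n : Fin d → ℕ} {R : Type u} [CommRing R] [Algebra k R]
    [hR : Algebra.FiniteType k R] {ξ : JacobianPoints O R} (h : IsCoordinateRing O n R ξ) :
    principalIdealClass O n = affineClass k R := by
  have hvar : LocusIsVariety O n := ⟨CommAlgCat.of k R, hR, ξ, h⟩
  rw [principalIdealClass, dif_pos hvar]
  have hR' : Algebra.FiniteType k hvar.choose := hvar.choose_spec.1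
  obtain ⟨ξ', h'⟩ := hvar.choose_spec.2
  have hcomp : ∀ {A B C : Type u} [CommRing A] [Algebra k A] [CommRing B] [Algebra k B]
      [CommRing C] [Algebra k C] (f : A →ₐ[k] B) (g : B →ₐ[k] C) (x : JacobianPoints O A),
      jacobianMap O (g.comp f) x = jacobianMap O g (jacobianMap O f x) := by
    intro A B C _ _ _ _ _ _ f g x
    obtain ⟨μ, rfl⟩ := QuotientGroup.mk_surjective x
    refine congrArg (QuotientGroup.mk (s := truncatedUnits O C)) ?_
    ext
    change Algebra.TensorProduct.map (g.comp f) (AlgHom.id k _) _ =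
      Algebra.TensorProduct.map g (AlgHom.id k _) (Algebra.TensorProduct.map f (AlgHom.id k _) _)
    rw [← AlgHom.comp_apply, ← Algebra.TensorProduct.map_comp, AlgHom.id_comp]
  have hid : ∀ {A : Type u} [CommRing A] [Algebra k A] (x : JacobianPoints O A),
      jacobianMap O (AlgHom.id k A) x = x := by
    intro A _ _ x
    obtain ⟨μ, rfl⟩ := QuotientGroup.mk_surjective x
    refine congrArg (QuotientGroup.mk (s := truncatedUnits O A)) ?_
    ext
    change Algebra.TensorProduct.map (AlgHom.id k A) (AlgHom.id k _) _ = _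
    rw [Algebra.TensorProduct.map_id, AlgHom.id_apply]
  -- The definition of the class uses a chosen coordinate ring; as both rings represent the same
  -- functor, they are isomorphic.
  obtain ⟨f, hf, -⟩ := h.2 _ ξ' h'.1
  obtain ⟨g, hg, -⟩ := h'.2 _ ξ h.1
  refine (affineClass_congr (AlgEquiv.ofAlgHom f g ?_ ?_)).symm
  · exact (h'.2 _ ξ' h'.1).unique (by rw [hcomp, hg, hf]) (hid ξ')
  · exact (h.2 _ ξ h.1).unique (by rw [hcomp, hf, hg]) (hid ξ)

end CoordinateRing

/-! ### The slice for a branch ring -/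

section Truncation

variable {k : Type u} [Field k] {d : ℕ} (O : Subalgebra k (Fin d → k⟦X⟧))

lemma mem_conductorIdeal {z : Fin d → k⟦X⟧} :
    z ∈ conductorIdeal O ↔ z ∈ orderSubmodule k (valueConductor O) := by
  rw [conductorIdeal, Ideal.mem_span_singleton, mem_orderSubmodule_iff_dvd]
  rfl

lemma conductorIdeal_restrictScalars :
    (conductorIdeal O).restrictScalars k = orderSubmodule k (valueConductor O) :=
  Submodule.ext fun _ => mem_conductorIdeal O

/-- `Õ / 𝓕` as a quotient vector space. -/
def truncationEquiv : ((Fin d → k⟦X⟧) ⧸ orderSubmodule k (valueConductor O)) ≃ₗ[k]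
    TruncatedNormalization O :=
  (Submodule.quotEquivOfEq _ _ (conductorIdeal_restrictScalars O).symm).trans
    (Submodule.Quotient.restrictScalarsEquiv k (conductorIdeal O))

instance finiteDimensional_truncatedNormalization :
    FiniteDimensional k (TruncatedNormalization O) :=
  (truncationEquiv O).finiteDimensional

lemma finrank_truncatedNormalization :
    Module.finrank k (TruncatedNormalization O) = vecNorm (valueConductor O) := by
  rw [← (truncationEquiv O).finrank_eq, finrank_quotient_orderSubmodule]

/-- The projection `Õ → Õ / 𝓕`. -/
abbrev truncationMap : (Fin d → k⟦X⟧) →ₐ[k] TruncatedNormalization O :=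
  Ideal.Quotient.mkₐ k (conductorIdeal O)

lemma truncationMap_surjective : Function.Surjective (truncationMap O) :=
  Ideal.Quotient.mk_surjective

lemma truncationMap_eq_zero {z : Fin d → k⟦X⟧} :
    truncationMap O z = 0 ↔ z ∈ orderSubmodule k (valueConductor O) :=
  Ideal.Quotient.eq_zero_iff_mem.trans (mem_conductorIdeal O)

lemma orderSubmodule_le_ker_branchCoeff {n : Fin d → ℕ} {i : Fin d} {a : ℕ} (ha : a < n i) :
    orderSubmodule k n ≤ LinearMap.ker (branchCoeff k i a) :=
  fun _ hz => mem_orderSubmodule_iff_coeff.1 hz i a ha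

/-- The coefficient of `t_i^a` on `Õ / 𝓕`, for `a < c_i`. -/
def truncatedCoeff (i : Fin d) (a : Fin (valueConductor O i)) :
    TruncatedNormalization O →ₗ[k] k :=
  ((orderSubmodule k (valueConductor O)).liftQ (branchCoeff k i a)
    (orderSubmodule_le_ker_branchCoeff a.2)).comp (truncationEquiv O).symm.toLinearMap

@[simp] lemma truncatedCoeff_truncationMap (i : Fin d) (a : Fin (valueConductor O i))
    (z : Fin d → k⟦X⟧) :
    truncatedCoeff O i a (truncationMap O z) = PowerSeries.coeff a (z i) := by
  have h : (truncationEquiv O).symm (truncationMap O z) = Submodule.Quotient.mk z := by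
    rw [LinearEquiv.symm_apply_eq]; rfl
  rw [truncatedCoeff, LinearMap.comp_apply, LinearEquiv.coe_coe, h, Submodule.liftQ_apply,
    branchCoeff_apply]

/-- Evaluation at the closed point of the `i`-th branch, as a character of `Õ`. -/
def branchCharacter (k : Type u) [Field k] {d : ℕ} (i : Fin d) : (Fin d → k⟦X⟧) →ₐ[k] k :=
  { branchEval k i with
    commutes' := fun a => by simp [branchEval, Algebra.algebraMap_eq_smul_one] }

lemma branchCharacter_apply (i : Fin d) (z : Fin d → k⟦X⟧) :
    branchCharacter k i z = PowerSeries.coeff 0 (z i) := by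
  rw [PowerSeries.coeff_zero_eq_constantCoeff_apply]; rfl

variable {O} in
/-- Evaluation at the closed point of the `i`-th branch, as a character of `Õ / 𝓕`. -/
def truncatedCharacter (hc : ∀ i, 0 < valueConductor O i) (i : Fin d) :
    TruncatedNormalization O →ₐ[k] k :=
  Ideal.Quotient.liftₐ (conductorIdeal O) (branchCharacter k i) fun z hz => by
    rw [branchCharacter_apply]
    exact mem_orderSubmodule_iff_coeff.1 ((mem_conductorIdeal O).1 hz) i 0 (hc i)

variable {O}

lemma truncatedCharacter_truncationMap (hc : ∀ i, 0 < valueConductor O i) (i : Fin d)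
    (z : Fin d → k⟦X⟧) :
    truncatedCharacter hc i (truncationMap O z) = PowerSeries.coeff 0 (z i) :=
  branchCharacter_apply i z

/-- Because `𝓕 ⊆ O`, the ring `O` is the full preimage of `O/𝓕`. -/
lemma truncationMap_mem_truncatedRing (hO : IsBranchRing O) {z : Fin d → k⟦X⟧} :
    truncationMap O z ∈ truncatedRing O ↔ z ∈ O := by
  constructor
  · rintro ⟨y, hy, hyz⟩
    have h1 : truncationMap O (z - y) = 0 := by
      rw [map_sub, sub_eq_zero]; exact hyz.symm
    have h2 := orderSubmodule_valueConductor_le O hO ((truncationMap_eq_zero O).1 h1)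
    have := Submodule.add_mem _ h2 hy
    rwa [sub_add_cancel] at this
  · exact fun hz => ⟨z, hz, rfl⟩

lemma finrank_truncatedRing_add (hO : IsBranchRing O) :
    Module.finrank k (Subalgebra.toSubmodule (truncatedRing O)) + singularityDegree O =
      vecNorm (valueConductor O) := by
  rw [← finrank_truncatedNormalization O,
    ← (Subalgebra.toSubmodule (truncatedRing O)).finrank_quotient_add_finrank, add_comm]
  congr 1
  set f := (Subalgebra.toSubmodule (truncatedRing O)).mkQ.comp (truncationMap O).toLinearMap
    with hf
  have hker : LinearMap.ker f = Subalgebra.toSubmodule O := by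
    rw [hf, LinearMap.ker_comp, Submodule.ker_mkQ]
    exact Submodule.ext fun z => truncationMap_mem_truncatedRing hO
  have hsurj : Function.Surjective f :=
    (Submodule.mkQ_surjective _).comp (truncationMap_surjective O)
  rw [singularityDegree, ← (LinearMap.quotKerEquivOfSurjective f hsurj).finrank_eq, hker]

lemma coeff_mul_of_forall_lt {R : Type*} [CommRing R] {a b : R⟦X⟧} {e : ℕ}
    (ha : ∀ e' < e, PowerSeries.coeff e' a = 0) :
    PowerSeries.coeff e (a * b) = PowerSeries.coeff e a * PowerSeries.coeff 0 b := by
  rw [PowerSeries.coeff_mul, Finset.sum_eq_single (e, 0)]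
  · rintro ⟨x, y⟩ hxy hne
    have hxy' : x + y = e := Finset.HasAntidiagonal.mem_antidiagonal.1 hxy
    have hx : x < e := by
      rcases Nat.eq_zero_or_pos y with rfl | hy
      · exact (hne (by rw [← hxy', add_zero])).elim
      · omega
    rw [ha x hx, zero_mul]
  · simp

/-- The slice provided by a basis of `O / 𝓕` in row echelon form. -/
theorem exists_isSlice (hO : IsBranchRing O) (hd : 0 < d) (hc : ∀ i, 0 < valueConductor O i) :
    ∃ (G : Finset (Σₗ i, Fin (valueConductor O i))) (br : G → Fin d)
      (h : G → TruncatedNormalization O) (φ : G → TruncatedNormalization O →ₗ[k] k) (p₀ : G),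
      IsSlice (truncatedRing O) (truncatedCharacter hc) br h φ p₀ ∧
        Fintype.card G = Module.finrank k (Subalgebra.toSubmodule (truncatedRing O)) := by
  -- The coordinates on `Õ/𝓕` are the coefficients of `t_i^a`, `a < c_i`, ordered lexicographically:
  -- first by branch, then by exponent. The least one, `p₀`, is the constant term on the first
  -- branch.
  let φ : (Σₗ i, Fin (valueConductor O i)) → TruncatedNormalization O →ₗ[k] k :=
    fun p => truncatedCoeff O p.1 p.2
  have hφz : ∀ p z, φ p (truncationMap O z) = PowerSeries.coeff p.2 (z p.1) :=
    fun p z => truncatedCoeff_truncationMap O p.1 p.2 z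
  let p₀ : Σₗ i, Fin (valueConductor O i) := ⟨⟨0, hd⟩, ⟨0, hc _⟩⟩
  have hp₀ : ∀ p, p₀ ≤ p := by
    rintro ⟨i, a⟩
    refine Sigma.Lex.le_def.2 ?_
    rcases Nat.eq_zero_or_pos i.1 with hi | hi
    · obtain rfl : i = ⟨0, hd⟩ := Fin.ext hi
      exact Or.inr ⟨rfl, Nat.zero_le _⟩
    · exact Or.inl hi
  obtain ⟨G, h, hp₀G, hh0, hB, hdiag, hlt, hspan, hcard⟩ := exists_echelon_basis φ (by
    intro x hx
    obtain ⟨z, rfl⟩ := truncationMap_surjective O x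
    refine (truncationMap_eq_zero O).2 (mem_orderSubmodule_iff_coeff.2 fun i a ha => ?_)
    exact (hφz ⟨i, ⟨a, ha⟩⟩ z).symm.trans (hx _))
    (Subalgebra.toSubmodule (truncatedRing O)) hp₀ (b₀ := 1) (Subalgebra.one_mem _) (by
      have h1 := hφz p₀ 1
      rw [map_one] at h1
      rw [h1]
      simp [p₀])
  have hbelow : ∀ (q : Σₗ i, Fin (valueConductor O i)) (e : ℕ) (he : e < q.2),
      @LT.lt (Σₗ i, Fin (valueConductor O i)) _ ⟨q.1, ⟨e, he.trans q.2.2⟩⟩ q := by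
    rintro ⟨j, b⟩ e he
    exact Sigma.Lex.lt_def.2 (Or.inr ⟨rfl, he⟩)
  -- The coefficients of `h p` before `q` on the branch of `q` vanish, so in the product with `x`
  -- only the constant term of `x` on that branch contributes at `q`.
  have hmul : ∀ p ∈ G, ∀ q ≤ p, ∀ x, φ q (h p * x) =
      φ q (h p) * truncatedCharacter hc q.1 x := by
    intro p hp q hqp x
    obtain ⟨a, ha⟩ := truncationMap_surjective O (h p)
    obtain ⟨b, rfl⟩ := truncationMap_surjective O x
    rw [← ha, ← map_mul, hφz, hφz, truncatedCharacter_truncationMap]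
    refine coeff_mul_of_forall_lt fun e he => ?_
    have h2 := hlt p hp _ (lt_of_lt_of_le (hbelow q e he) hqp)
    rw [← ha] at h2
    exact (hφz _ a).symm.trans h2
  refine ⟨G, fun p => p.1.1, fun p => h p, fun p => φ p, ⟨p₀, hp₀G⟩, ⟨?_, ?_, fun p => hp₀ p, hh0,
    ?_, ?_, ?_⟩, by rw [hcard, Fintype.card_coe]⟩
  · intro x hx
    obtain ⟨z, rfl⟩ := truncationMap_surjective O x
    refine ⟨∑ i, valueConductor O i, ?_⟩
    rw [← map_pow]
    refine (truncationMap_eq_zero O).2 (mem_orderSubmodule_iff_coeff.2 fun i => ?_)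
    have h1 : PowerSeries.X ∣ z i := by
      rw [PowerSeries.X_dvd_iff, ← PowerSeries.coeff_zero_eq_constantCoeff_apply,
        ← truncatedCharacter_truncationMap hc i z, hx]
    exact PowerSeries.X_pow_dvd_iff.1 ((pow_dvd_pow _ (Finset.single_le_sum
      (fun j _ => Nat.zero_le _) (Finset.mem_univ i))).trans (pow_dvd_pow_of_dvd h1 _))
  · rw [hspan]
    congr 1
    ext x; simp
  · intro p q hqp x
    rw [hmul p p.2 q (le_of_lt hqp), hlt p p.2 q hqp, zero_mul]
  · intro p x
    rw [hmul p p.2 p le_rfl, hdiag p p.2, one_mul]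
  -- For `p ≠ p₀` the constant term of `h p` on the first branch is zero; elements of `O` have equal
  -- constant terms on all branches.
  · intro p hp i
    obtain ⟨z, hz, hzp⟩ := hB p p.2
    have hzp' : truncationMap O z = h p := hzp
    have h1 := hlt p p.2 p₀ (lt_of_le_of_ne (hp₀ p) fun h => hp (Subtype.ext h.symm))
    rw [← hzp', hφz] at h1
    change truncatedCharacter hc i (h p) = 0
    rw [← hzp', truncatedCharacter_truncationMap, PowerSeries.coeff_zero_eq_constantCoeff_apply,
      hO.constantCoeff_eq z hz i ⟨0, hd⟩, ← PowerSeries.coeff_zero_eq_constantCoeff_apply]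
    exact h1

/-! ### Dimensions of the flats -/

/-- The subspace of all `x ∈ Õ / 𝓕` with `t^n x ∈ O / 𝓕` and `ℓ_i(x) = 0` for `i ∈ I`. -/
def flatSubmodule (hc : ∀ i, 0 < valueConductor O i) (n : Fin d → ℕ) (I : Finset (Fin d)) :
    Submodule k (TruncatedNormalization O) :=
  (Subalgebra.toSubmodule (truncatedRing O)).comap (LinearMap.mulLeft k (truncatedPow O n)) ⊓
    ⨅ i ∈ I, LinearMap.ker (truncatedCharacter hc i).toLinearMap

lemma mem_flatSubmodule {hc : ∀ i, 0 < valueConductor O i} {n : Fin d → ℕ} {I : Finset (Fin d)}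
    {x : TruncatedNormalization O} :
    x ∈ flatSubmodule hc n I ↔ truncatedPow O n * x ∈ truncatedRing O ∧
      ∀ i ∈ I, truncatedCharacter hc i x = 0 := by
  simp only [flatSubmodule, Submodule.mem_inf, Submodule.mem_iInf]
  rfl

/-- The indicator vector of `I`. -/
abbrev indicatorVec (I : Finset (Fin d)) : Fin d → ℕ := fun i => if i ∈ I then 1 else 0

lemma tPow_mul_mem_orderSubmodule {n : Fin d → ℕ} {I : Finset (Fin d)} {y : Fin d → k⟦X⟧} :
    tPow k n * y ∈ orderSubmodule k (n + indicatorVec I) ↔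
      ∀ i ∈ I, PowerSeries.coeff 0 (y i) = 0 := by
  rw [mem_orderSubmodule_iff_coeff]
  have hcoeff : ∀ i a, PowerSeries.coeff a ((tPow k n * y) i) =
      if n i ≤ a then PowerSeries.coeff (a - n i) (y i) else 0 := fun i a => by
    rw [Pi.mul_apply, tPow, PowerSeries.coeff_X_pow_mul']
  constructor
  · intro h i hi
    have := h i (n i) (by simp [indicatorVec, hi])
    rwa [hcoeff, if_pos le_rfl, Nat.sub_self] at this
  · intro h i a ha
    rw [hcoeff]
    split_ifs with hna
    · by_cases hi : i ∈ I
      · rw [Pi.add_apply, indicatorVec, if_pos hi] at ha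
        have : a - n i = 0 := by omega
        rw [this, h i hi]
      · rw [Pi.add_apply, indicatorVec, if_neg hi] at ha
        omega
    · rfl

/-- Multiplication by `t^n` carries the condition `ℓ_i = 0` to the order condition `n_i + 1`, so it
identifies the preimage of the flat in `Õ` with `J_{n + 1_I}(O)`. -/
lemma truncationMap_mem_flatSubmodule (hO : IsBranchRing O) (hc : ∀ i, 0 < valueConductor O i)
    {n : Fin d → ℕ} {I : Finset (Fin d)} {y : Fin d → k⟦X⟧} :
    truncationMap O y ∈ flatSubmodule hc n I ↔
      tPow k n * y ∈ Subalgebra.toSubmodule O ⊓ orderSubmodule k (n + indicatorVec I) := by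
  rw [mem_flatSubmodule, Submodule.mem_inf, tPow_mul_mem_orderSubmodule]
  refine and_congr ?_ (forall₂_congr fun i _ => by rw [truncatedCharacter_truncationMap])
  rw [Subalgebra.mem_toSubmodule, ← truncationMap_mem_truncatedRing hO, map_mul]
  rfl

/-- The codimension in `Õ/𝓕` equals that of `J_{n + 1_I}(O)` in `t^n Õ`, which is `δ + l(n + 1_I) -
‖n‖`; the ambient dimension is `‖c‖`. -/
lemma finrank_flatSubmodule (hO : IsBranchRing O) (hc : ∀ i, 0 < valueConductor O i)
    (n : Fin d → ℕ) (I : Finset (Fin d)) :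
    Module.finrank k (flatSubmodule hc n I) + singularityDegree O +
        valuationColength O (n + indicatorVec I) =
      vecNorm (valueConductor O) + vecNorm n := by
  set A := Subalgebra.toSubmodule O ⊓ orderSubmodule k (n + indicatorVec I) with hA
  have hAle : A ≤ orderSubmodule k n :=
    inf_le_right.trans (orderSubmodule_mono fun i => Nat.le_add_right _ _)
  have hfin : FiniteDimensional k ((Fin d → k⟦X⟧) ⧸ A) :=
    finiteDimensional_quotient_inf_orderSubmodule O hO _
  have h1 := Submodule.finrank_quotient_of_le hAle
  have h0 := singularityDegree_add_valuationColength O hO (n + indicatorVec I)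
  rw [← hA] at h0
  rw [← h0, finrank_quotient_orderSubmodule] at h1
  have h2 := (flatSubmodule hc n I).finrank_quotient_add_finrank
  rw [finrank_truncatedNormalization] at h2
  set U := (flatSubmodule hc n I).comap (truncationMap O).toLinearMap with hU
  have e1 : Module.finrank k ((Fin d → k⟦X⟧) ⧸ U) =
      Module.finrank k (TruncatedNormalization O ⧸ flatSubmodule hc n I) := by
    set f := (flatSubmodule hc n I).mkQ.comp (truncationMap O).toLinearMap with hf
    have hker : LinearMap.ker f = U := by rw [hf, LinearMap.ker_comp, Submodule.ker_mkQ]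
    rw [← hker]
    exact (LinearMap.quotKerEquivOfSurjective f
      ((Submodule.mkQ_surjective _).comp (truncationMap_surjective O))).finrank_eq
  have e2 : Module.finrank k ((Fin d → k⟦X⟧) ⧸ U) =
      Module.finrank k (orderSubmodule k n ⧸ A.comap (orderSubmodule k n).subtype) := by
    let τ : (Fin d → k⟦X⟧) →ₗ[k] orderSubmodule k n :=
      (LinearMap.mulLeft k (tPow k n)).codRestrict _ fun y =>
        mem_orderSubmodule_iff_dvd.2 ⟨y, rfl⟩
    have hτ : Function.Surjective τ := by
      rintro ⟨z, hz⟩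
      obtain ⟨w, rfl⟩ := mem_orderSubmodule_iff_dvd.1 hz
      exact ⟨w, rfl⟩
    set f := (A.comap (orderSubmodule k n).subtype).mkQ.comp τ with hf
    have hker : LinearMap.ker f = U := by
      rw [hf, LinearMap.ker_comp, Submodule.ker_mkQ]
      exact Submodule.ext fun y => (truncationMap_mem_flatSubmodule hO hc).symm
    rw [← hker]
    exact (LinearMap.quotKerEquivOfSurjective f ((Submodule.mkQ_surjective _).comp hτ)).finrank_eq
  omega

lemma mem_dualCoannihilator_sliceRelations {ι : Type*} (hc : ∀ i, 0 < valueConductor O i)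
    {φ : ι → TruncatedNormalization O →ₗ[k] k} {p₀ : ι} {n : Fin d → ℕ} {I : Finset (Fin d)}
    {x : TruncatedNormalization O} :
    x ∈ (sliceRelations O n φ p₀ ⊔ Submodule.span k
        ((fun i => (truncatedCharacter hc i).toLinearMap) '' I)).dualCoannihilator ↔
      x ∈ flatSubmodule hc n I ∧ ∀ q, q ≠ p₀ → φ q x = 0 := by
  rw [Submodule.mem_dualCoannihilator, mem_flatSubmodule, sliceRelations, ← Submodule.span_union]
  constructor
  · intro h
    refine ⟨⟨?_, fun i hi => ?_⟩, fun q hq => ?_⟩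
    · rw [← Subalgebra.mem_toSubmodule, ← Subspace.forall_mem_dualAnnihilator_apply_eq_zero_iff]
      intro f hf
      exact h _ (Submodule.subset_span (Or.inl (Or.inl
        ⟨f, fun b hb => (Submodule.mem_dualAnnihilator f).1 hf b hb, rfl⟩)))
    · exact h _ (Submodule.subset_span (Or.inr ⟨i, hi, rfl⟩))
    · exact h _ (Submodule.subset_span (Or.inl (Or.inr ⟨q, hq, rfl⟩)))
  · rintro ⟨⟨h1, h2⟩, h3⟩ g hg
    induction hg using Submodule.span_induction with
    | mem g hg =>
      rcases hg with (⟨f, hf, rfl⟩ | ⟨q, hq, rfl⟩) | ⟨i, hi, rfl⟩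
      · exact hf _ h1
      · exact h3 q hq
      · exact h2 i hi
    | zero => rfl
    | add g g' _ _ hg hg' => rw [LinearMap.add_apply, hg, hg', add_zero]
    | smul c g _ hg => rw [LinearMap.smul_apply, hg, smul_zero]

variable {ι : Type*} [Fintype ι] [LinearOrder ι] {br : ι → Fin d}
  {h : ι → TruncatedNormalization O} {φ : ι → TruncatedNormalization O →ₗ[k] k} {p₀ : ι}

/-- The flats of the arrangement in the slice of `𝓘_n` have the expected dimension. -/
theorem IsSlice.finrank_flat (hO : IsBranchRing O) {hc : ∀ i, 0 < valueConductor O i}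
    (hs : IsSlice (truncatedRing O) (truncatedCharacter hc) br h φ p₀)
    (hcard : Fintype.card ι = Module.finrank k (Subalgebra.toSubmodule (truncatedRing O)))
    {n : Fin d → ℕ} (hn : n ∈ valueSemigroup O) (I : Finset (Fin d)) :
    Module.finrank k (Module.Dual k (TruncatedNormalization O) ⧸ (sliceRelations O n φ p₀ ⊔
        Submodule.span k ((fun i => (truncatedCharacter hc i).toLinearMap) '' I))) +
      valuationColength O (n + indicatorVec I) = vecNorm n + 1 := by
  set N := sliceRelations O n φ p₀ ⊔
    Submodule.span k ((fun i => (truncatedCharacter hc i).toLinearMap) '' I) with hN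
  -- By duality the quotient by `N` has the dimension of the common zeros of `N`. These form the
  -- kernel of the map `ψ` from `V` to the pivot coordinates other than `p₀`, of which there are
  -- `‖c‖ - δ - 1`.
  have h1 := Subspace.finrank_add_finrank_dualCoannihilator_eq N
  have h2 := N.finrank_quotient_add_finrank
  rw [Subspace.dual_finrank_eq] at h2
  have h3 := finrank_flatSubmodule hO hc n I
  have h4 := finrank_truncatedRing_add hO
  set V := flatSubmodule hc n I with hV
  let ι' := {q : ι // q ≠ p₀}
  let ψ : V →ₗ[k] (ι' → k) := (LinearMap.pi fun q : ι' => φ q).comp V.subtype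
  have hle : N.dualCoannihilator ≤ V :=
    fun x hx => ((mem_dualCoannihilator_sliceRelations hc).1 hx).1
  have hker : LinearMap.ker ψ = N.dualCoannihilator.comap V.subtype := by
    ext ⟨x, hx⟩
    rw [LinearMap.mem_ker, Submodule.mem_comap, hN, mem_dualCoannihilator_sliceRelations hc]
    constructor
    · exact fun h => ⟨hx, fun q hq => congrFun h ⟨q, hq⟩⟩
    · exact fun h => funext fun q => h.2 q q.2
  -- Here `n ∈ S` matters: it provides a unit `x` with `t^n x ∈ O`. For `p ≠ p₀` the elements `h p *
  -- x` lie in `V`, since the characters kill `h p`, and their pivot coordinates form an invertible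
  -- triangular matrix.
  have hsurj : LinearMap.range ψ = ⊤ := by
    rw [LinearMap.range_eq_top]
    obtain ⟨z, hz, hzn⟩ := hn
    obtain ⟨w, rfl⟩ := mem_orderSubmodule_iff_dvd.1
      (fun i => (hzn i).ge : z ∈ orderSubmodule k n)
    set x := truncationMap O w with hx
    have hxu : ∀ i, truncatedCharacter hc i x ≠ 0 := fun i => by
      rw [hx, truncatedCharacter_truncationMap]
      have h5 := (PowerSeries.order_eq_nat.1 (hzn i)).1
      rwa [Pi.mul_apply, tPow, PowerSeries.coeff_X_pow_mul', if_pos le_rfl, Nat.sub_self] at h5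
    have hxB : truncatedPow O n * x ∈ truncatedRing O := ⟨_, hz, map_mul (truncationMap O) _ _⟩
    intro b
    obtain ⟨a, ha⟩ := (Matrix.mulVec_bijective_of_triangular
      (M := Matrix.of fun q p : ι' => φ q (h p * x)) (fun p q hqp => hs.apply_of_lt p q hqp x)
      (fun p => by
        rw [Matrix.of_apply, hs.apply_self]
        exact isUnit_iff_ne_zero.2 (hxu _))).2 b
    refine ⟨⟨∑ p : ι', a p • (h p * x), V.sum_mem fun p _ => V.smul_mem _ ?_⟩, ?_⟩
    · rw [hV, mem_flatSubmodule]
      refine ⟨?_, fun i _ => ?_⟩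
      · rw [mul_left_comm]
        exact Subalgebra.mul_mem _ (hs.h_mem _) hxB
      · rw [map_mul, hs.char_h p p.2, zero_mul]
    · rw [← ha]
      funext q
      change φ q (∑ p : ι', a p • (h p * x)) = _
      rw [map_sum]
      exact Finset.sum_congr rfl fun p _ => by
        rw [map_smul, smul_eq_mul, mul_comm]; rfl
  have h5 := LinearMap.finrank_range_add_finrank_ker ψ
  rw [hsurj, hker, finrank_top, (Submodule.comapSubtypeEquivOfLe hle).finrank_eq,
    Module.finrank_fintype_fun_eq_card, Fintype.card_subtype_compl, Fintype.card_subtype_eq] at h5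
  have h6 : 0 < Fintype.card ι := Fintype.card_pos_iff.2 ⟨p₀⟩
  omega

end Truncation

/-! ### The classes of the varieties of principal ideals -/

section LocusClass

variable {k : Type u} [Field k] {d : ℕ} {O : Subalgebra k (Fin d → k⟦X⟧)}

/-- The class of `𝓘_n`, for a system of colengths `l`, as a Laurent polynomial in `𝕃`. -/
def locusPolynomial (l : (Fin d → ℕ) → ℕ) (n : Fin d → ℕ) (i₀ : Fin d) : ℤ[T;T⁻¹] :=
  ∑ I : Finset (Fin d), (-1) ^ I.card *
    if l (n + indicatorVec (insert i₀ I)) = l (n + indicatorVec I) then 0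
    else LaurentPolynomial.T ((vecNorm n : ℤ) - l (n + indicatorVec I))

lemma substituteU_T {R : Type*} [CommRing R] (u : Rˣ) (m : ℤ) :
    substituteU u (LaurentPolynomial.T m) = ((u ^ m : Rˣ) : R) :=
  LaurentPolynomial.eval₂_T _ _ _

lemma substituteU_locusPolynomial {R : Type*} [CommRing R] (u : Rˣ) (l : (Fin d → ℕ) → ℕ)
    (n : Fin d → ℕ) (i₀ : Fin d) :
    substituteU u (locusPolynomial l n i₀) = ∑ I : Finset (Fin d), (-1) ^ I.card *
      if l (n + indicatorVec (insert i₀ I)) = l (n + indicatorVec I) then 0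
      else ((u ^ ((vecNorm n : ℤ) - l (n + indicatorVec I)) : Rˣ) : R) := by
  rw [locusPolynomial, map_sum]
  refine Finset.sum_congr rfl fun I _ => ?_
  rw [map_mul, map_pow, map_neg, map_one]
  congr 1
  split_ifs
  · exact map_zero _
  · exact substituteU_T u _

lemma coe_lefschetzUnit (k : Type u) [Field k] :
    ((lefschetzUnit k : (MotivicRing k)ˣ) : MotivicRing k) =
      algebraMap (GrothendieckRing k) (MotivicRing k) (lefschetzClass k) := rfl

/-- Since `φ p₀` is the character of the branch `br p₀`, adjoining it to the equations of the flat
of `I` gives those of the flat of `insert (br p₀) I`. It was already among them iff the dimension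
does not drop. -/
lemma IsSlice.mem_flat_iff (hO : IsBranchRing O) {hc : ∀ i, 0 < valueConductor O i}
    {ι : Type*} [Fintype ι] [LinearOrder ι] {br : ι → Fin d}
    {h : ι → TruncatedNormalization O} {φ : ι → TruncatedNormalization O →ₗ[k] k} {p₀ : ι}
    (hs : IsSlice (truncatedRing O) (truncatedCharacter hc) br h φ p₀)
    (hcard : Fintype.card ι = Module.finrank k (Subalgebra.toSubmodule (truncatedRing O)))
    {n : Fin d → ℕ} (hn : n ∈ valueSemigroup O) (I : Finset (Fin d)) :
    φ p₀ ∈ sliceRelations O n φ p₀ ⊔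
        Submodule.span k ((fun i => (truncatedCharacter hc i).toLinearMap) '' I) ↔
      valuationColength O (n + indicatorVec (insert (br p₀) I)) =
        valuationColength O (n + indicatorVec I) := by
  classical
  have h1 := hs.finrank_flat hO hcard hn I
  have h2 := hs.finrank_flat hO hcard hn (insert (br p₀) I)
  set N := sliceRelations O n φ p₀ ⊔
    Submodule.span k ((fun i => (truncatedCharacter hc i).toLinearMap) '' I) with hN
  have hins : sliceRelations O n φ p₀ ⊔ Submodule.span k
      ((fun i => (truncatedCharacter hc i).toLinearMap) '' (insert (br p₀) I : Finset (Fin d))) =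
      N ⊔ Submodule.span k {φ p₀} := by
    rw [Finset.coe_insert, Set.image_insert_eq, Submodule.span_insert, hs.φ_bot, hN]
    ac_rfl
  rw [hins] at h2
  constructor
  · intro hmem
    rw [sup_eq_left.2 ((Submodule.span_singleton_le_iff_mem _ _).2 hmem)] at h2
    omega
  · intro hl
    have h3 := N.finrank_quotient_add_finrank
    have h4 := (N ⊔ Submodule.span k {φ p₀}).finrank_quotient_add_finrank
    have h5 : N = N ⊔ Submodule.span k {φ p₀} :=
      Submodule.eq_of_le_of_finrank_eq le_sup_left (by omega)
    rw [h5]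
    exact Submodule.mem_sup_right (Submodule.mem_span_singleton_self _)

/-- The class of `𝓘_n` when all components of the conductor are positive. -/
lemma locus_of_conductor_pos (hO : IsBranchRing O) (hd : 0 < d)
    (hc : ∀ i, 0 < valueConductor O i) {n : Fin d → ℕ} (hn : n ∈ valueSemigroup O) :
    LocusIsVariety O n ∧ ∃ i₀, algebraMap (GrothendieckRing k) (MotivicRing k)
      (principalIdealClass O n) =
        substituteU (lefschetzUnit k) (locusPolynomial (valuationColength O) n i₀) := by
  obtain ⟨G, br, h, φ, p₀, hs, hcard⟩ := exists_isSlice hO hd hc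
  obtain ⟨R, hR, η, hη, hclass⟩ := exists_isArrangementRing (sliceRelations O n φ p₀) (φ p₀)
    (fun i => (truncatedCharacter hc i).toLinearMap) Finset.univ
  obtain ⟨ξ, hξ⟩ := hs.exists_isCoordinateRing hη
  refine ⟨⟨R, hR, ξ, hξ⟩, br p₀, ?_⟩
  rw [principalIdealClass_eq hξ, hclass, substituteU_locusPolynomial, Finset.powerset_univ, map_sum]
  refine Finset.sum_congr rfl fun I _ => ?_
  rw [map_mul, map_pow, map_neg, map_one, flatClass]
  congr 1
  have hmem := hs.mem_flat_iff hO hcard hn I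
  have hdim := hs.finrank_flat hO hcard hn I
  by_cases hl : valuationColength O (n + indicatorVec (insert (br p₀) I)) =
      valuationColength O (n + indicatorVec I)
  · rw [if_pos (hmem.2 hl), if_pos hl, map_zero]
  · have hnot := fun h' => hl (hmem.1 h')
    rw [if_neg hnot, if_neg hl, map_pow, ← coe_lefschetzUnit, ← Units.val_pow_eq_pow_val,
      ← zpow_natCast]
    -- The exponent in `flatClass` is a truncated difference; a non-empty flat makes it the true
    -- `‖n‖ - l(n + 1_I)`.
    have hpos : 0 < Module.finrank k (Module.Dual k (TruncatedNormalization O) ⧸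
        (sliceRelations O n φ p₀ ⊔ Submodule.span k
          ((fun i => (truncatedCharacter hc i).toLinearMap) '' I))) := by
      rw [Module.finrank_pos_iff, Submodule.Quotient.nontrivial_iff]
      exact fun h' => hnot (h' ▸ Submodule.mem_top)
    congr 2
    omega

lemma subsingleton_truncatedNormalization (hc : valueConductor O = 0) :
    Subsingleton (TruncatedNormalization O) := by
  refine Ideal.Quotient.subsingleton_iff.2 ?_
  rw [Ideal.eq_top_iff_one, mem_conductorIdeal, hc, orderSubmodule_zero]
  trivial

/-- The class of `𝓘_n` in the regular case. -/
lemma locus_of_conductor_eq_zero (hO : IsBranchRing O) {i₀ : Fin d}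
    (hc : valueConductor O i₀ = 0) (n : Fin d → ℕ) :
    LocusIsVariety O n ∧ algebraMap (GrothendieckRing k) (MotivicRing k)
      (principalIdealClass O n) =
        substituteU (lefschetzUnit k) (locusPolynomial (valuationColength O) n i₀) := by
  -- There is a single branch and `O = Õ`. Then `Õ/𝓕` is the zero ring, which has no characters, so
  -- the slice is unavailable; but `𝒥` is trivial and `𝓘_n` is a point.
  have hsub : ∀ j, j = i₀ := eq_of_valueConductor_eq_zero O hO hc
  have hc0 : valueConductor O = 0 := funext fun j => by rw [hsub j, hc]; rfl
  have := subsingleton_truncatedNormalization hc0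
  have hA : ∀ (A : Type u) [CommRing A] [Algebra k A],
      Subsingleton (A ⊗[k] TruncatedNormalization O) := fun A _ _ =>
    ⟨fun x y => by
      have hz : ∀ z : A ⊗[k] TruncatedNormalization O, z = 0 := fun z => by
        induction z with
        | zero => rfl
        | tmul a t => rw [Subsingleton.elim t 0, TensorProduct.tmul_zero]
        | add x y hx hy => rw [hx, hy, add_zero]
      rw [hz x, hz y]⟩
  have hJ : ∀ (A : Type u) [CommRing A] [Algebra k A], Subsingleton (JacobianPoints O A) :=
    fun A _ _ => ⟨fun x y => by
      have := hA A
      obtain ⟨μ, rfl⟩ := QuotientGroup.mk_surjective x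
      obtain ⟨ν, rfl⟩ := QuotientGroup.mk_surjective y
      rw [Units.ext (Subsingleton.elim (μ : A ⊗[k] TruncatedNormalization O) ν)]⟩
  have hcoord : IsCoordinateRing O n k (1 : JacobianPoints O k) := by
    refine ⟨⟨1, rfl, ?_⟩, fun A _ _ x _ => ⟨Algebra.ofId k A, ?_, fun f _ => ?_⟩⟩
    · have := hA k
      rw [Subsingleton.elim (_ * _) (0 : k ⊗[k] TruncatedNormalization O)]
      exact Subalgebra.zero_mem _
    · have := hJ A
      exact Subsingleton.elim _ _
    · exact Subsingleton.elim _ _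
  refine ⟨⟨CommAlgCat.of k k, inferInstanceAs (Algebra.FiniteType k k), 1, hcoord⟩, ?_⟩
  -- Only `I = ∅` contributes: every other `I` contains `i₀`. Its exponent is zero because `l(n) =
  -- ‖n‖`.
  rw [principalIdealClass_eq hcoord, affineClass_self, map_one, substituteU_locusPolynomial,
    Finset.sum_eq_single ∅]
  · have hl1 : valuationColength O (n + indicatorVec (insert i₀ ∅)) = valuationColength O n + 1 := by
      rw [← valuationColength_add_single_of_conductor_le O hO (n := n) (i := i₀)
        (by rw [hc]; exact Nat.zero_le _)]
      congr 2
      funext j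
      rw [hsub j]
      simp [indicatorVec]
    have hl0 : n + indicatorVec (∅ : Finset (Fin d)) = n := by
      funext j; simp [indicatorVec]
    have hle : orderSubmodule k (0 : Fin d → ℕ) ≤ Subalgebra.toSubmodule O := by
      have := orderSubmodule_valueConductor_le O hO
      rwa [hc0] at this
    have h1 := singularityDegree_add_valuationColength_conductor O hO
    have h2 := singularityDegree_add_valuationColength O hO n
    rw [inf_eq_right.2 ((orderSubmodule_mono (fun _ => Nat.zero_le _)).trans hle),
      finrank_quotient_orderSubmodule] at h2
    rw [hc0] at h1
    have h0 : vecNorm (0 : Fin d → ℕ) = 0 := by simp [vecNorm]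
    have hln : valuationColength O n = vecNorm n := by omega
    rw [hl1, hl0, if_neg (by omega), hln, sub_self]
    simp
  · intro I _ hI
    obtain ⟨j, hj⟩ := Finset.nonempty_iff_ne_empty.2 hI
    rw [hsub j] at hj
    rw [Finset.insert_eq_self.2 hj, if_pos rfl, mul_zero]
  · simp

/-- The varieties `𝓘_n` exist and their classes are determined by the colengths. -/
theorem locus_class (hO : IsBranchRing O) (hd : 0 < d) {n : Fin d → ℕ}
    (hn : n ∈ valueSemigroup O) :
    LocusIsVariety O n ∧ ∃ i₀, algebraMap (GrothendieckRing k) (MotivicRing k)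
      (principalIdealClass O n) =
        substituteU (lefschetzUnit k) (locusPolynomial (valuationColength O) n i₀) := by
  by_cases hc : ∀ i, 0 < valueConductor O i
  · exact locus_of_conductor_pos hO hd hc hn
  · push Not at hc
    obtain ⟨i₀, hi₀⟩ := hc
    obtain ⟨h1, h2⟩ := locus_of_conductor_eq_zero hO (Nat.le_zero.1 hi₀) n
    exact ⟨h1, i₀, h2⟩

end LocusClass

/-! ### The universal zeta function -/

section Universal

variable {d : ℕ}

lemma indetU_ne_zero : indetU ≠ 0 := RatFunc.X_ne_zero

lemma indetU_sub_one_ne_zero : indetU - 1 ≠ 0 := by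
  rw [sub_ne_zero, indetU, ← RatFunc.algebraMap_X, ← map_one (algebraMap (Polynomial ℚ) _)]
  exact fun h => by
    simpa [Polynomial.coeff_one] using
      congrArg (fun p => Polynomial.coeff p 1) (RatFunc.algebraMap_injective ℚ h)

lemma indicatorVec_insert {i : Fin d} {I : Finset (Fin d)} (hi : i ∉ I) :
    indicatorVec (insert i I) = indicatorVec I + Pi.single i 1 := by
  funext j
  by_cases hj : j = i
  · subst hj; simp [indicatorVec, hi]
  · simp [indicatorVec, hj]

/-- The coefficients of the geometric series `∏_{i ∈ J} (1 - U⁻¹ T_i)⁻¹`. -/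
lemma coeff_geometricFactor (J : Finset (Fin d)) (m : Fin d →₀ ℕ) :
    MvPowerSeries.coeff m (geometricFactor J) =
      if ∀ i ∉ J, m i = 0 then indetU⁻¹ ^ vecNorm m else 0 := by
  classical
  let g : Finset (Fin d) → MvPowerSeries (Fin d) (RatFunc ℚ) := fun J m =>
    if ∀ i ∉ J, m i = 0 then indetU⁻¹ ^ vecNorm m else 0
  have hg : ∀ J m, MvPowerSeries.coeff m (g J) =
      if ∀ i ∉ J, m i = 0 then indetU⁻¹ ^ vecNorm m else 0 := fun _ _ => rfl
  suffices h : geometricFactor J = g J by rw [h, hg]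
  induction J using Finset.induction_on with
  | empty =>
    ext m
    rw [geometricFactor, Finset.prod_empty, MvPowerSeries.coeff_one, hg]
    refine if_ctx_congr ⟨fun h => by simp [h], fun h => Finsupp.ext fun i => by
      simpa using h i⟩ (fun h => ?_) fun _ => rfl
    have hm : m = 0 := Finsupp.ext fun i => by simpa using h i
    simp [hm, vecNorm]
  | insert i J hi ih =>
    have hX : MvPowerSeries.C indetU⁻¹ * (MvPowerSeries.X i : MvPowerSeries (Fin d) (RatFunc ℚ)) =
        MvPowerSeries.monomial (Finsupp.single i 1) indetU⁻¹ := by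
      rw [MvPowerSeries.X_def, ← MvPowerSeries.monomial_zero_eq_C_apply,
        MvPowerSeries.monomial_mul_monomial, zero_add, mul_one]
    -- The proposed coefficients are checked by multiplying back by `1 - U⁻¹ T_i`, which avoids
    -- products of infinite series.
    have hmul : g J = (1 - MvPowerSeries.C indetU⁻¹ * MvPowerSeries.X i) * g (insert i J) := by
      ext m
      rw [hX, sub_mul, one_mul, map_sub, MvPowerSeries.coeff_monomial_mul, hg, hg, hg]
      have hle : Finsupp.single i 1 ≤ m ↔ 1 ≤ m i := Finsupp.single_le_iff
      by_cases hm : m i = 0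
      · have hnle : ¬ Finsupp.single i 1 ≤ m := fun h => by have := hle.1 h; omega
        rw [if_neg hnle, sub_zero]
        refine if_congr ⟨fun h j hj => h j fun hj' => hj (Finset.mem_insert_of_mem hj'),
          fun h j hj => ?_⟩ rfl rfl
        by_cases hji : j = i
        · rw [hji, hm]
        · exact h j fun hj' => (Finset.mem_insert.1 hj').elim hji hj
      · rw [if_neg (fun h : ∀ j ∉ J, m j = 0 => hm (h i hi)), if_pos (hle.2 (by omega))]
        have hcond : (∀ j ∉ insert i J, (m - Finsupp.single i 1 : Fin d →₀ ℕ) j = 0) ↔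
            ∀ j ∉ insert i J, m j = 0 := forall₂_congr fun j hj => by
          have hji : j ≠ i := fun h => hj (h ▸ Finset.mem_insert_self _ _)
          simp [hji.symm]
        rw [if_congr hcond rfl rfl]
        split_ifs
        · have hnorm : vecNorm m = vecNorm ⇑(m - Finsupp.single i 1 : Fin d →₀ ℕ) + 1 := by
            have h1 : m = (m - Finsupp.single i 1) + Finsupp.single i 1 :=
              (tsub_add_cancel_of_le (hle.2 (by omega))).symm
            conv_lhs => rw [h1]
            simp [vecNorm, Finset.sum_add_distrib, Finsupp.single_apply]
          rw [hnorm, pow_succ']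
          ring
        · simp
    have hconst : MvPowerSeries.constantCoeff
        (1 - MvPowerSeries.C indetU⁻¹ * (MvPowerSeries.X i : MvPowerSeries (Fin d) (RatFunc ℚ))) ≠
          0 := by simp
    have ih' : ∏ j ∈ J, (1 - MvPowerSeries.C indetU⁻¹ *
        (MvPowerSeries.X j : MvPowerSeries (Fin d) (RatFunc ℚ)))⁻¹ = g J := ih
    rw [geometricFactor, Finset.prod_insert hi, ih', hmul, ← mul_assoc,
      MvPowerSeries.inv_mul_cancel _ hconst, one_mul]

lemma coeff_zetaMonomial (v : Fin d → ℕ) (a : RatFunc ℚ) (n : Fin d →₀ ℕ) :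
    MvPowerSeries.coeff n (zetaMonomial v a) = if ⇑n = v then a else 0 := by
  classical
  rw [zetaMonomial, MvPowerSeries.coeff_monomial]
  refine if_congr ⟨fun h => by rw [h]; rfl, fun h => ?_⟩ rfl rfl
  rw [← h]
  exact (Finsupp.equivFunOnFinite.symm_apply_apply n).symm

/-- The series contributes `U^{-‖n - v‖}`, which combines with `U^{-‖v‖}` to `U^{-‖n‖}`. -/
lemma coeff_zetaMonomial_mul_geometricFactor (v : Fin d → ℕ) (a : RatFunc ℚ)
    (J : Finset (Fin d)) (n : Fin d →₀ ℕ) :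
    MvPowerSeries.coeff n
        (zetaMonomial v (a * indetU ^ (-(vecNorm v : ℤ))) * geometricFactor J) =
      if (∀ i ∈ J, v i ≤ n i) ∧ ∀ i ∉ J, n i = v i then a * indetU ^ (-(vecNorm n : ℤ)) else 0 := by
  classical
  rw [zetaMonomial, MvPowerSeries.coeff_monomial_mul, coeff_geometricFactor]
  by_cases hle : Finsupp.equivFunOnFinite.symm v ≤ n
  · have hle' : ∀ i, v i ≤ n i := fun i => hle i
    rw [if_pos hle]
    have hcond : (∀ i ∉ J, (n - Finsupp.equivFunOnFinite.symm v) i = 0) ↔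
        ((∀ i ∈ J, v i ≤ n i) ∧ ∀ i ∉ J, n i = v i) := by
      constructor
      · refine fun h => ⟨fun i _ => hle' i, fun i hi => le_antisymm ?_ (hle' i)⟩
        exact Nat.sub_eq_zero_iff_le.1 (h i hi)
      · exact fun h i hi => Nat.sub_eq_zero_iff_le.2 (h.2 i hi).le
    rw [if_congr hcond rfl rfl, mul_ite, mul_zero]
    refine if_congr Iff.rfl ?_ rfl
    have hnorm : vecNorm ⇑(n - Finsupp.equivFunOnFinite.symm v) + vecNorm v = vecNorm n := by
      rw [vecNorm, vecNorm, vecNorm, ← Finset.sum_add_distrib]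
      exact Finset.sum_congr rfl fun i _ => Nat.sub_add_cancel (hle' i)
    rw [← hnorm, mul_assoc]
    congr 1
    rw [inv_pow, zpow_neg, zpow_neg, zpow_natCast, zpow_natCast, ← mul_inv, pow_add, mul_comm]
  · rw [if_neg hle, if_neg]
    rintro ⟨h1, h2⟩
    refine hle fun i => ?_
    by_cases hi : i ∈ J
    · exact h1 i hi
    · exact (h2 i hi).ge

variable (O : Subalgebra ℂ (Fin d → ℂ⟦X⟧))

/-- The universal classes are Laurent polynomials. -/
lemma substituteU_locusPolynomial_eq_universalClass (n : Fin d → ℕ) (i₀ : Fin d) :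
    substituteU (Units.mk0 indetU RatFunc.X_ne_zero)
      (locusPolynomial (valuationColength O) n i₀) = universalClass O n := by
  classical
  -- The subsets are paired as `I`, `I ∪ {i₀}` with `i₀ ∉ I`. In `locusPolynomial` the second member
  -- contributes zero.
  have huniv : (Finset.univ : Finset (Finset (Fin d))) =
      (insert i₀ (Finset.univ.erase i₀)).powerset := by
    rw [Finset.insert_erase (Finset.mem_univ _), Finset.powerset_univ]
  rw [substituteU_locusPolynomial, universalClass, Finset.mul_sum, huniv,
    Finset.sum_powerset_insert (Finset.notMem_erase _ _),
    Finset.sum_powerset_insert (Finset.notMem_erase _ _), ← Finset.sum_add_distrib,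
    ← Finset.sum_add_distrib]
  refine Finset.sum_congr rfl fun I hI => ?_
  have hi : i₀ ∉ I := fun h => Finset.notMem_erase _ _ (Finset.mem_powerset.1 hI h)
  change _ = (indetU - 1)⁻¹ * indetU ^ (vecNorm n + 1) * ((-1) ^ I.card *
      indetU ^ (-(valuationColength O (n + indicatorVec I) : ℤ))) +
    (indetU - 1)⁻¹ * indetU ^ (vecNorm n + 1) * ((-1) ^ (insert i₀ I).card *
      indetU ^ (-(valuationColength O (n + indicatorVec (insert i₀ I)) : ℤ)))
  have hU := indetU_ne_zero
  have hU1 := indetU_sub_one_ne_zero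
  rw [Finset.insert_idem, if_pos rfl, mul_zero, add_zero, Finset.card_insert_of_notMem hi,
    indicatorVec_insert hi, ← add_assoc, valuationColength_add_single]
  generalize valuationColength O (n + indicatorVec I) = a
  rw [Units.val_zpow_eq_zpow_val, Units.val_mk0, zpow_sub₀ hU]
  simp only [zpow_neg, zpow_natCast]
  -- If `l` does not jump, the pair cancels in the universal class; if it jumps by one, `U^{-a} -
  -- U^{-a-1} = (U - 1) U^{-a-1}` absorbs the factor `(U - 1)⁻¹`.
  split_ifs with h1 h2 h2
  · omega
  · field_simp
    ring
  · simp only [add_zero]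
    ring
  · omega

variable {O} (hO : IsBranchRing O)

include hO

/-- Beyond the conductor in direction `i`, both `‖n‖` and every `l(n + 1_I)` increase by one, and
the two changes cancel. -/
lemma universalClass_add_single {n : Fin d → ℕ} {i : Fin d} (h : valueConductor O i ≤ n i) :
    universalClass O (n + Pi.single i 1) = universalClass O n := by
  rw [universalClass, universalClass, Finset.mul_sum, Finset.mul_sum]
  refine Finset.sum_congr rfl fun I _ => ?_
  change _ * ((-1) ^ I.card *
      indetU ^ (-(valuationColength O (n + Pi.single i 1 + indicatorVec I) : ℤ))) =
    _ * ((-1) ^ I.card * indetU ^ (-(valuationColength O (n + indicatorVec I) : ℤ)))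
  have hU := indetU_ne_zero
  have hnorm : vecNorm (n + Pi.single i 1) = vecNorm n + 1 := by
    simp [vecNorm, Finset.sum_add_distrib]
  rw [hnorm, add_right_comm n, valuationColength_add_single_of_conductor_le O hO
    (le_trans h (Nat.le_add_right _ _))]
  simp only [zpow_neg, zpow_natCast, pow_succ]
  field_simp

lemma universalClass_boundaryVector (n : Fin d → ℕ) :
    universalClass O (boundaryVector (valueConductor O)
      (Finset.univ.filter fun i => valueConductor O i ≤ n i) n) = universalClass O n := by
  set f := boundaryVector (valueConductor O)
    (Finset.univ.filter fun i => valueConductor O i ≤ n i) n with hf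
  have hfi : ∀ i, f i = if valueConductor O i ≤ n i then valueConductor O i else n i := fun i => by
    rw [hf, boundaryVector]; simp
  -- The vector `n` is reached from `f` by unit steps only in directions where `f` is already at the
  -- conductor.
  have key : ∀ m : Fin d → ℕ, (∀ i, m i ≠ 0 → valueConductor O i ≤ f i) →
      universalClass O (f + m) = universalClass O f := by
    intro m
    induction m using induction_add_single with
    | h0 => simp
    | h1 m i ih =>
      intro hm
      rw [← add_assoc, universalClass_add_single hO, ih fun j hj => hm j ?_]
      · exact ne_of_gt (lt_of_lt_of_le (Nat.pos_of_ne_zero hj) (Nat.le_add_right _ _))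
      · exact le_trans (hm i (by simp)) (Nat.le_add_right _ _)
  have hn : n = f + (n - f) := by
    funext i
    have := hfi i
    rw [Pi.add_apply, Pi.sub_apply]
    split_ifs at this <;> omega
  conv_rhs => rw [hn]
  refine (key _ fun i hi => ?_).symm
  have := hfi i
  rw [Pi.sub_apply] at hi
  split_ifs at this <;> omega

lemma valuationColength_conductor_add_indicatorVec (I : Finset (Fin d)) :
    valuationColength O (valueConductor O + indicatorVec I) =
      valuationColength O (valueConductor O) + I.card := by
  induction I using Finset.induction_on with
  | empty =>
    congr 1
  | insert i I hi ih =>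
    rw [indicatorVec_insert hi, ← add_assoc, valuationColength_add_single_of_conductor_le O hO
      (Nat.le_add_right _ _), ih, Finset.card_insert_of_notMem hi, add_assoc]

/-- At the conductor `l(c + 1_I) = l(c) + #I`, so the alternating sum is the binomial expansion of
`(1 - U⁻¹)^d`; the power of `U` comes from `δ + l(c) = ‖c‖`. -/
lemma universalClass_conductor :
    universalClass O (valueConductor O) =
      (indetU - 1) ^ ((d : ℤ) - 1) * indetU ^ ((singularityDegree O : ℤ) - d + 1) := by
  have hU := indetU_ne_zero
  have hU1 := indetU_sub_one_ne_zero
  have hδ := singularityDegree_add_valuationColength_conductor O hO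
  have hsum : ∑ I : Finset (Fin d), (-1 : RatFunc ℚ) ^ I.card *
      indetU ^ (-(valuationColength O (valueConductor O + indicatorVec I) : ℤ)) =
        (indetU ^ valuationColength O (valueConductor O))⁻¹ * (1 - indetU⁻¹) ^ d := by
    have h1 := Fintype.sum_pow_mul_eq_add_pow (Fin d) (-indetU⁻¹) (1 : RatFunc ℚ)
    rw [Fintype.card_fin] at h1
    rw [sub_eq_neg_add, ← h1, Finset.mul_sum]
    refine Finset.sum_congr rfl fun I _ => ?_
    rw [valuationColength_conductor_add_indicatorVec hO, zpow_neg, zpow_natCast, pow_add, mul_inv,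
      one_pow, mul_one, neg_pow (indetU⁻¹), inv_pow]
    ring
  have hsplit : (1 : RatFunc ℚ) - indetU⁻¹ = (indetU - 1) * indetU⁻¹ := by
    field_simp
  rw [universalClass]
  refine (congrArg _ hsum).trans ?_
  rw [hsplit, ← hδ, mul_pow, zpow_sub₀ hU1, zpow_add₀ hU, zpow_sub₀ hU]
  simp only [zpow_natCast, zpow_one, inv_pow]
  field_simp
  ring

/-- The coefficients of the universal zeta function. -/
theorem coeff_universalZeta (hd : 0 < d) (n : Fin d →₀ ℕ) [Decidable (⇑n ∈ valueSemigroup O)] :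
    MvPowerSeries.coeff n (universalZeta O) =
      if ⇑n ∈ valueSemigroup O then universalClass O n * indetU ^ (-(vecNorm n : ℤ)) else 0 := by
  classical
  set c := valueConductor O with hc
  -- The set `J₀` of directions beyond the conductor decides which of the three parts contributes to
  -- `T^n`: the finite sum for `J₀ = ∅`, the last term for `J₀` everything, and otherwise the single
  -- summand with `J = J₀`, `m = m₀`.
  set J₀ := Finset.univ.filter fun i => c i ≤ n i with hJ₀
  set m₀ : Fin d → ℕ := fun i => if i ∈ J₀ then 0 else n i with hm₀
  set X := universalClass O n * indetU ^ (-(vecNorm n : ℤ)) with hX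
  have hmemJ₀ : ∀ i, i ∈ J₀ ↔ c i ≤ n i := fun i => by simp [hJ₀]
  have hbv : boundaryVector c J₀ m₀ = boundaryVector c J₀ n := by
    funext i
    by_cases hi : i ∈ J₀
    · simp [boundaryVector, hi]
    · simp [boundaryVector, hm₀, hi]
  have h1 : MvPowerSeries.coeff n
      (∑ v ∈ (Fintype.piFinset fun i => Finset.range (c i)).filter (fun v => v ∈ valueSemigroup O),
        zetaMonomial v (universalClass O v * indetU ^ (-(vecNorm v : ℤ)))) =
      if J₀ = ∅ ∧ ⇑n ∈ valueSemigroup O then X else 0 := by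
    simp only [map_sum, coeff_zetaMonomial]
    rw [Finset.sum_ite_eq]
    refine if_congr ?_ rfl rfl
    rw [Finset.mem_filter, Fintype.mem_piFinset]
    refine and_congr_left fun _ => ?_
    rw [Finset.eq_empty_iff_forall_notMem]
    exact forall_congr' fun i => by rw [Finset.mem_range, hmemJ₀, not_le]
  have hterm : ∀ (J : Finset (Fin d)), ∀ m ∈ boundaryIndices (valueSemigroup O) J,
      MvPowerSeries.coeff n (zetaMonomial (boundaryVector c J m)
        (universalClass O (boundaryVector c J m) *
          indetU ^ (-(vecNorm (boundaryVector c J m) : ℤ))) * geometricFactor J) =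
        if J = J₀ ∧ m = m₀ then X else 0 := by
    intro J m hm
    rw [boundaryIndices, Finset.mem_filter, Fintype.mem_piFinset] at hm
    have hmJ : ∀ i ∈ J, m i = 0 := fun i hi => by
      have := hm.1 i
      rw [if_pos hi] at this
      simpa using this
    have hmc : ∀ i ∉ J, m i < c i := fun i hi => by
      have := hm.1 i
      rw [if_neg hi] at this
      simpa using this
    rw [coeff_zetaMonomial_mul_geometricFactor]
    have hcond : ((∀ i ∈ J, boundaryVector c J m i ≤ n i) ∧
        ∀ i ∉ J, n i = boundaryVector c J m i) ↔ J = J₀ ∧ m = m₀ := by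
      constructor
      · rintro ⟨ha, hb⟩
        have hJ : J = J₀ := by
          ext i
          rw [hmemJ₀]
          constructor
          · intro hi
            simpa [boundaryVector, hi] using ha i hi
          · intro hi
            by_contra hiJ
            have h3 := hb i hiJ
            rw [boundaryVector, if_neg hiJ] at h3
            have := hmc i hiJ
            omega
        refine ⟨hJ, funext fun i => ?_⟩
        by_cases hi : i ∈ J
        · rw [hmJ i hi, hm₀]
          simp [← hJ, hi]
        · have h3 := hb i hi
          rw [boundaryVector, if_neg hi] at h3
          rw [hm₀, ← hJ]
          simp [hi, h3]
      · rintro ⟨rfl, rfl⟩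
        refine ⟨fun i hi => ?_, fun i hi => ?_⟩
        · rw [boundaryVector, if_pos hi]
          exact (hmemJ₀ i).1 hi
        · rw [boundaryVector, if_neg hi, hm₀]
          simp [hi]
    by_cases hJm : J = J₀ ∧ m = m₀
    · rw [if_pos (hcond.2 hJm), if_pos hJm, hJm.1, hJm.2, hbv, hJ₀, hc,
        universalClass_boundaryVector hO]
    · rw [if_neg (fun h => hJm (hcond.1 h)), if_neg hJm]
  -- Membership in the semigroup depends only on the components below the conductor, so `B_{J₀}`
  -- detects whether `n ∈ S`.
  have hm₀mem : m₀ ∈ boundaryIndices (valueSemigroup O) J₀ ↔ ⇑n ∈ valueSemigroup O := by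
    rw [boundaryIndices, Finset.mem_filter, Fintype.mem_piFinset]
    constructor
    · rintro ⟨-, v, hv, h3, h4⟩
      refine mem_valueSemigroup_of_agree O hO hv fun i => ?_
      by_cases hi : i ∈ J₀
      · exact Or.inr ⟨h3 i hi, (hmemJ₀ i).1 hi⟩
      · left
        rw [h4 i hi, hm₀]
        simp [hi]
    · refine fun hn => ⟨fun i => ?_, n, hn, fun i hi => (hmemJ₀ i).1 hi, fun i hi => by
        simp [hm₀, hi]⟩
      by_cases hi : i ∈ J₀
      · simp [hm₀, hi]
      · have h3 : n i < c i := by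
          rw [← not_le, ← hmemJ₀]; exact hi
        simpa [hm₀, hi] using h3
  have h2 : MvPowerSeries.coeff n
      (∑ J ∈ Finset.univ.filter (fun J : Finset (Fin d) => J ≠ ∅ ∧ J ≠ Finset.univ),
        ∑ m ∈ boundaryIndices (valueSemigroup O) J, zetaMonomial (boundaryVector c J m)
          (universalClass O (boundaryVector c J m) *
            indetU ^ (-(vecNorm (boundaryVector c J m) : ℤ))) * geometricFactor J) =
      if (J₀ ≠ ∅ ∧ J₀ ≠ Finset.univ) ∧ ⇑n ∈ valueSemigroup O then X else 0 := by
    rw [map_sum]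
    have hinner : ∀ J : Finset (Fin d), MvPowerSeries.coeff n
        (∑ m ∈ boundaryIndices (valueSemigroup O) J, zetaMonomial (boundaryVector c J m)
          (universalClass O (boundaryVector c J m) *
            indetU ^ (-(vecNorm (boundaryVector c J m) : ℤ))) * geometricFactor J) =
        if J = J₀ then (if ⇑n ∈ valueSemigroup O then X else 0) else 0 := by
      intro J
      rw [map_sum, Finset.sum_congr rfl (hterm J)]
      by_cases hJ : J = J₀
      · subst hJ
        simp only [true_and, if_true]
        rw [Finset.sum_ite_eq', if_congr hm₀mem rfl rfl]
      · simp [hJ]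
    simp only [hinner]
    rw [Finset.sum_ite_eq', ite_and]
    refine if_congr ?_ rfl rfl
    simp
  have h3 : MvPowerSeries.coeff n
      (zetaMonomial c ((indetU - 1) ^ ((d : ℤ) - 1) *
        indetU ^ ((singularityDegree O : ℤ) - d + 1) * indetU ^ (-(vecNorm c : ℤ))) *
          geometricFactor Finset.univ) = if J₀ = Finset.univ then X else 0 := by
    rw [coeff_zetaMonomial_mul_geometricFactor, ← universalClass_conductor hO]
    by_cases hJ : J₀ = Finset.univ
    · have hcn : ∀ i, c i ≤ n i := fun i => (hmemJ₀ i).1 (hJ ▸ Finset.mem_univ i)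
      rw [if_pos ⟨fun i _ => hcn i, fun i hi => absurd (Finset.mem_univ i) hi⟩, if_pos hJ, hX,
        ← universalClass_boundaryVector hO n]
      congr 2
      funext i
      rw [boundaryVector, if_pos (by simpa using hcn i)]
    · rw [if_neg, if_neg hJ]
      rintro ⟨h, -⟩
      exact hJ (Finset.eq_univ_of_forall fun i => (hmemJ₀ i).2 (h i (Finset.mem_univ i)))
  -- For `d = 0` the first and the last part would both contribute.
  have hne : (∅ : Finset (Fin d)) ≠ Finset.univ := by
    have : Nonempty (Fin d) := ⟨⟨0, hd⟩⟩
    exact Finset.univ_nonempty.ne_empty.symm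
  have htot : MvPowerSeries.coeff n (universalZeta O) =
      (if J₀ = ∅ ∧ ⇑n ∈ valueSemigroup O then X else 0) +
        (if (J₀ ≠ ∅ ∧ J₀ ≠ Finset.univ) ∧ ⇑n ∈ valueSemigroup O then X else 0) +
        if J₀ = Finset.univ then X else 0 := by
    rw [← h1, ← h2, ← h3, ← map_add, ← map_add, universalZeta]
  rw [htot]
  by_cases hJ1 : J₀ = ∅
  · simp [hJ1, hne]
  · by_cases hJ2 : J₀ = Finset.univ
    · have hn : ⇑n ∈ valueSemigroup O := mem_valueSemigroup_of_conductor_le O hO fun i =>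
        (hmemJ₀ i).1 (hJ2 ▸ Finset.mem_univ i)
      simp [hJ2, hne.symm, hn]
    · simp [hJ1, hJ2]

end Universal
end

/-- Let `k` be big enough for the curve `Y`, let `P` be a singular point of `Y`, and `O` its
completed local ring, with coordinates `e` on the branches. If the semigroup of `O` is the
semigroup of the complex curve singularity `(X, Q)`, then the varieties `𝓘_n`, `n ∈ S`, exist and
`Z(T₁, …, T_d, O)` is obtained from the universal zeta function by the substitution
`U = [𝔸¹]`. -/
theorem lemma7 {k : Type u} [Field k]
    (Y : Over (Spec (CommRingCat.of k))) (hY : IsAlgebraicCurve Y) (hk : IsBigEnough Y)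
    (P : Y.left) (hP : IsSingularPoint Y P) (d : ℕ)
    (e : BranchCoordinates k (CompletedLocalRing Y P) d)
    (X : Over (Spec (CommRingCat.of ℂ))) (hX : IsAlgebraicCurve X)
    (Q : X.left) (hQ : IsSingularPoint X Q)
    (e' : BranchCoordinates ℂ (CompletedLocalRing X Q) d)
    (hS : valueSemigroup (branchImage e') = valueSemigroup (branchImage e)) :
    (∀ n ∈ valueSemigroup (branchImage e), LocusIsVariety (branchImage e) n) ∧
      IsSubstitution (universalZeta (branchImage e')) (lefschetzUnit k)
        (motivicZeta (branchImage e)) := by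
  classical
  have hO := isBranchRing_completedLocalRing hY P e
  have hO' := isBranchRing_completedLocalRing hX Q e'
  have := isLocalRing_completedLocalRing P hY
  have hd : 0 < d := branch_count_pos e
  have hclass := fun n hn => locus_class hO hd (n := n) hn
  have hl : valuationColength (branchImage e') = valuationColength (branchImage e) :=
    funext fun n => valuationColength_congr (branchImage e) hO hO' hS n
  refine ⟨fun n hn => (hclass n hn).1, ?_⟩
  have : Nonempty (Fin d) := ⟨⟨0, hd⟩⟩
  -- The branch `i₀` may vary with `n`. Both substitutions are made in the same Laurent polynomial,
  -- and its value at `U` is the universal class for any `i₀`.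
  choose! i₀ hi₀ using fun n hn => (hclass n hn).2
  let F : MvPowerSeries (Fin d) (LaurentPolynomial ℤ) := fun n =>
    if ⇑n ∈ valueSemigroup (branchImage e) then
      locusPolynomial (valuationColength (branchImage e)) n (i₀ n) *
        LaurentPolynomial.T (-(vecNorm n : ℤ)) else 0
  have hF : ∀ n, MvPowerSeries.coeff n F = if ⇑n ∈ valueSemigroup (branchImage e) then
      locusPolynomial (valuationColength (branchImage e)) n (i₀ n) *
        LaurentPolynomial.T (-(vecNorm n : ℤ)) else 0 := fun _ => rfl
  refine ⟨F, ?_, ?_⟩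
  · ext n
    rw [coeff_universalZeta hO' hd, MvPowerSeries.coeff_map, hS, hF]
    split_ifs with hn
    · rw [map_mul, substituteU_T, ← hl, substituteU_locusPolynomial_eq_universalClass,
        Units.val_zpow_eq_zpow_val, Units.val_mk0]
    · exact map_zero _
  · ext n
    rw [MvPowerSeries.coeff_map, hF]
    change _ = ite _ _ _
    split_ifs with hn
    · rw [map_mul, substituteU_T, hi₀ n hn]
    · exact map_zero _
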